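/- **Setting.** For real $C,H,\Lambda$ with $\Lambda\neq0$ consider on $\mathbb R^3$ the piecewise linear system $Z=(X,Y)$ with switching plane $\Sigma=\{z=0\}$, where $X$ acts for $z\ge 0$ and $Y$ for $z<0$ (solutions in the sense of Filippov), in the symmetric canonical form with real eigenvalue $A=-2C$ and complex eigenvalues $C\pm i$: $$X=\bigl(-2Cx-H((9C^2+1)z-\Lambda),\ \Lambda-(1+C^2)z,\ 2Cz+y\bigr),$$ $$Y=\bigl(-\Lambda-(1+C^2)z,\ -2Cy-H((9C^2+1)z+\Lambda),\ 2Cz+x\bigr).$$ It is equivariant under $S(x,y,z)=(-y,-x,-z)$. A *symmetric cycle* of half-period $T>0$ is a crossing periodic orbit that crosses $\Sigma$ upwards at $p_0=(x_0,y_0,0)$ with $x_0,y_0>0$, runs through $z>0$ for time $T$ to $Sp_0=(-y_0,-x_0,0)$ and returns through $z<0$ in time $T$ to $p_0$. Put $$M(p_0,T)=S_{Y\to X}(p_0)\,e^{T\,DY}\,S_{X\to Y}(Sp_0)\,e^{T\,DX},\qquad S_{X\to Y}=I+\frac{(Y-X)e_3^{\top}}{X_3},\quad S_{Y\to X}=I-\frac{(Y-X)e_3^{\top}}{Y_3}.$$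 The *transverse multipliers* of $M$ are the two roots of $q_M(\mu)=\mu^2-(\operatorname{tr}M-1)\mu+\det M$, and its *Schur–Cohn conditions* are $1-\det M>0$, $2-\operatorname{tr}M+\det M>0$, $\operatorname{tr}M+\det M>0$. Let $D=(1-H)(3H+1)$ and let $$x_0(y_0)=\frac{(H+1)y_0}{2H}+\frac{\Lambda C}{C^2+1}+\sqrt{\frac{\Lambda\bigl((C^2+1)(\Lambda+C(1-H)y_0)-\Lambda H\bigr)}{H(C^2+1)^2}+\frac{D\,y_0^2}{4H^2}}$$ be the branch $\Gamma$ of the conic $\Gamma_1:\ H(x^2+y^2)-(H+1)xy+\frac{2CH\Lambda(y-x)}{C^2+1}+\frac{\Lambda^2(H-1)}{C^2+1}=0$. Write $M_{C,H}(y_0)=M(p_0,t)$ with $p_0=(x_0(y_0),y_0,0)$ and $t$ the first positive time at which the $X$-trajectory of $p_0$ is again on $\Sigma$. Finally let $$m=\frac{2H}{H+\sqrt D+1},\qquad \tau_\Gamma=m^2\bigl(\Psi_2e^{2\pi C}+\Psi_{-1}e^{-\pi C}+\Psi_{-4}e^{-4\pi C}\bigr),$$ $$\Psi_2=-\tfrac{(H+1)(H-\sqrt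 D-3)}2,\quad \Psi_{-1}=\tfrac{(H^2-1)((H+1)\sqrt D-(H-1)^2+2)}{H^2},\quad \Psi_{-4}=\tfrac{(H+1)\sqrt D-(H-1)^2+2}{2},$$ and $H_{\rm crit}(C)=\dfrac1{2\cosh(\pi C)-1}$. All parameters $(C,H)$ below lie in $\Omega=\{C>0,\ 0<H<1\}$. **Theorem.** 1. For every symmetric cycle, the characteristic polynomial of its $M$ is $(\mu-1)q_M(\mu)$, and both transverse multipliers lie in the open unit disk if and only if the Schur–Cohn conditions hold. For each $C>0$ there is $\nu$ such that every symmetric cycle with $y_0>\nu$ satisfies $x_0=x_0(y_0)$ and has $M=M_{C,H}(y_0)$. 2. For every $(C,H)\in\Omega$, as $y_0\to\infty$, $\det M_{C,H}(y_0)\to m^2<1$ and $\operatorname{tr}M_{C,H}(y_0)\to\tau_\Gamma$. The roots of the limit polynomial $\mu^2-(\tau_\Gamma-1)\mu+m^2$ are both in the open unit disk if and only if $$2+m^2-\tau_\Gamma>0\qquad\text{and}\qquad \tau_\Gamma+m^2>0. \tag{1}$$ 3. The set $\widetilde{\mathcal B}_{\rm st}$ of $(C,H)\in\Omega$ satisfying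 (1) (the asymptotic stability band) is open in $\mathbb R^2$. If $(C,H)\in\widetilde{\mathcal B}_{\rm st}$, then for all sufficiently large $y_0$ the matrix $M_{C,H}(y_0)$ satisfies the Schur–Cohn conditions and its transverse multipliers lie in the open unit disk. For every $C>0$ there is $\nu$ such that, for all $H$ with $(C,H)\in\widetilde{\mathcal B}_{\rm st}$, every symmetric cycle with $y_0>\nu$ is orbitally asymptotically stable. 4. Let $\Lambda>0$. There are an open set $\mathcal B_{\rm st}\subset\Omega$ and continuous functions $x_0,y_0,T$ on it such that for every $(C,H)\in\mathcal B_{\rm st}$ they define a symmetric cycle, and this cycle is orbitally asymptotically stable. The set contains the large-amplitude tail: for every $C>0$ there is $\nu$ such that every symmetric cycle with $(C,H)\in\widetilde{\mathcal B}_{\rm st}$ and $y_0>\nu$ has $(C,H)\in\mathcal B_{\rm st}$ and is the cycle of this family. For every $C>0$, all $H<H_{\rm crit}(C)$ close enough to $H_{\rm crit}(C)$ satisfy $(C,H)\in\mathcal B_{\rm st}\cap\widetilde{\mathcal B}_{\rm st}$; as $H\uparrow H_{\rm crit}(C)$ one has $y_0(C,H)\to\infty$, and a transverse multiplier of the cycle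 tends to $1$. 5. The part of the boundary of $\widetilde{\mathcal B}_{\rm st}$ in $\Omega$ is the union of the upper boundary $\{2+m^2-\tau_\Gamma=0\}$ and the lower boundary $\{\tau_\Gamma+m^2=0\}$ (both taken in $\Omega$). For each $C>0$ the lower boundary contains a point $(C,H)$ with $H<H_{\rm crit}(C)$; and each $(C,H)\in\widetilde{\mathcal B}_{\rm st}$ has $H<H_{\rm crit}(C)$ and a point $(C,H')$ of the lower boundary with $H'<H$. - (i) The upper boundary is exactly the curve $H=H_{\rm crit}(C)$, $C>0$; at each of its points a transverse multiplier of $M_{C,H}(y_0)$ tends to $1$ as $y_0\to\infty$. - (ii) At each point of the lower boundary a transverse multiplier of $M_{C,H}(y_0)$ tends to $-1$ as $y_0\to\infty$. -/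

import Mathlib

open Filter Topology MeasureTheory

noncomputable section

namespace PWL

/-! ### The symmetric piecewise linear family -/

/-- The canonical vector field `X` on `z ≥ 0`; `A` is the real eigenvalue and `C ± i` are the
complex eigenvalues of its linear part. -/
def upperField (A C H Λ : ℝ) (p : Fin 3 → ℝ) : Fin 3 → ℝ :=
  ![A * p 0 - H * (((A - C) ^ 2 + 1) * p 2 - Λ), Λ - (1 + C ^ 2) * p 2, 2 * C * p 2 + p 1]

/-- The canonical vector field `Y` on `z < 0`. -/
def lowerField (a c h l : ℝ) (p : Fin 3 → ℝ) : Fin 3 → ℝ :=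
  ![l - (1 + c ^ 2) * p 2, a * p 1 - h * (((a - c) ^ 2 + 1) * p 2 - l), 2 * c * p 2 + p 0]

/-- The linear part `DX`. -/
def upperMatrix (A C H : ℝ) : Matrix (Fin 3) (Fin 3) ℝ :=
  !![A, 0, -(H * ((A - C) ^ 2 + 1)); 0, 0, -(1 + C ^ 2); 0, 1, 2 * C]

/-- The linear part `DY`. -/
def lowerMatrix (a c h : ℝ) : Matrix (Fin 3) (Fin 3) ℝ :=
  !![0, 0, -(1 + c ^ 2); 0, a, -(h * ((a - c) ^ 2 + 1)); 1, 0, 2 * c]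

/-- The involution `S(x, y, z) = (-y, -x, -z)`. -/
def symm (p : Fin 3 → ℝ) : Fin 3 → ℝ := ![-p 1, -p 0, -p 2]

/-- The point `(x, y, 0)` of the switching plane `Σ`. -/
def pt (x y : ℝ) : Fin 3 → ℝ := ![x, y, 0]

/-- The upper field of the symmetric family in the resonant case `A = -2C`. -/
def X (C H Λ : ℝ) : (Fin 3 → ℝ) → (Fin 3 → ℝ) := upperField (-2 * C) C H Λ

/-- The lower field of the symmetric family: `a = A = -2C`, `c = C`, `h = H`, `λ = -Λ`. -/
def Y (C H Λ : ℝ) : (Fin 3 → ℝ) → (Fin 3 → ℝ) := lowerField (-2 * C) C H (-Λ)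

/-- `DX` in the resonant case. -/
def DX (C H : ℝ) : Matrix (Fin 3) (Fin 3) ℝ := upperMatrix (-2 * C) C H

/-- `DY` in the resonant case. -/
def DY (C H : ℝ) : Matrix (Fin 3) (Fin 3) ℝ := lowerMatrix (-2 * C) C H

theorem X_eq (C H Λ : ℝ) (p : Fin 3 → ℝ) :
    X C H Λ p = (DX C H).mulVec p + ![H * Λ, Λ, 0] := by
  ext i
  fin_cases i <;> simp [X, DX, upperField, upperMatrix, dotProduct,
    Fin.sum_univ_three] <;> ring

theorem Y_eq (C H Λ : ℝ) (p : Fin 3 → ℝ) :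
    Y C H Λ p = (DY C H).mulVec p + ![-Λ, -(H * Λ), 0] := by
  ext i
  fin_cases i <;> simp [Y, DY, lowerField, lowerMatrix, dotProduct,
    Fin.sum_univ_three] <;> ring

/-- The pair `(X, Y)` is equivariant under `S`. -/
theorem X_symm (C H Λ : ℝ) (p : Fin 3 → ℝ) : X C H Λ (symm p) = symm (Y C H Λ p) := by
  ext i
  fin_cases i <;> simp [X, Y, upperField, lowerField, symm] <;> ring

/-! ### Flows, Filippov solutions, stability -/

/-- The flow of the affine field `p ↦ D p + b`. -/
def affineFlow (D : Matrix (Fin 3) (Fin 3) ℝ) (b : Fin 3 → ℝ) (t : ℝ) (p : Fin 3 → ℝ) :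
    Fin 3 → ℝ :=
  (NormedSpace.exp (t • D)).mulVec p + ∫ s in (0 : ℝ)..t, (NormedSpace.exp (s • D)).mulVec b

open scoped Matrix.Norms.Operator in
/-- `affineFlow D b` is indeed the flow: it starts at `p` and solves `u' = D u + b`. -/
theorem hasDerivAt_affineFlow (D : Matrix (Fin 3) (Fin 3) ℝ) (b p : Fin 3 → ℝ) (t : ℝ) :
    HasDerivAt (fun t => affineFlow D b t p) (D.mulVec (affineFlow D b t p) + b) t := by
  have hE : ∀ (w : Fin 3 → ℝ) (s : ℝ),
      HasDerivAt (fun u : ℝ => (NormedSpace.exp (u • D)).mulVec w)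
        (D.mulVec ((NormedSpace.exp (s • D)).mulVec w)) s := by
    intro w s
    have h := hasDerivAt_exp_smul_const' (𝕂 := ℝ) D s
    let L : Matrix (Fin 3) (Fin 3) ℝ →L[ℝ] (Fin 3 → ℝ) :=
      LinearMap.toContinuousLinearMap
        { toFun := fun M => M.mulVec w
          map_add' := fun M N => Matrix.add_mulVec M N w
          map_smul' := fun c M => Matrix.smul_mulVec c M w }
    have h2 := L.hasFDerivAt.comp_hasDerivAt s h
    rw [Matrix.mulVec_mulVec]
    exact h2
  have hc : Continuous fun s : ℝ => (NormedSpace.exp (s • D)).mulVec b :=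
    continuous_iff_continuousAt.2 fun s => (hE b s).continuousAt
  have hI : ∀ s, HasDerivAt
      (fun u => ∫ r in (0 : ℝ)..u, (NormedSpace.exp (r • D)).mulVec b)
      ((NormedSpace.exp (s • D)).mulVec b) s := fun s =>
    intervalIntegral.integral_hasDerivAt_right (hc.intervalIntegrable _ _)
      (hc.stronglyMeasurableAtFilter _ _) hc.continuousAt
  have key : D.mulVec (∫ r in (0 : ℝ)..t, (NormedSpace.exp (r • D)).mulVec b) + b
      = (NormedSpace.exp (t • D)).mulVec b := by
    let L : (Fin 3 → ℝ) →L[ℝ] (Fin 3 → ℝ) := LinearMap.toContinuousLinearMap D.mulVecLin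
    have h1 : D.mulVec (∫ r in (0 : ℝ)..t, (NormedSpace.exp (r • D)).mulVec b)
        = ∫ r in (0 : ℝ)..t, D.mulVec ((NormedSpace.exp (r • D)).mulVec b) :=
      (L.intervalIntegral_comp_comm (hc.intervalIntegrable 0 t)).symm
    have h2 := intervalIntegral.integral_eq_sub_of_hasDerivAt
      (fun s (_ : s ∈ Set.uIcc 0 t) => hE b s) ((L.continuous.comp hc).intervalIntegrable 0 t)
    rw [h1, h2]
    simp
  have := (hE p t).add (hI t)
  rw [affineFlow, Matrix.mulVec_add, add_assoc, key]
  exact this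

theorem affineFlow_zero (D : Matrix (Fin 3) (Fin 3) ℝ) (b p : Fin 3 → ℝ) :
    affineFlow D b 0 p = p := by
  simp [affineFlow]

/-- The flow of `X`. -/
def flowX (C H Λ : ℝ) : ℝ → (Fin 3 → ℝ) → (Fin 3 → ℝ) := affineFlow (DX C H) ![H * Λ, Λ, 0]

/-- The flow of `Y`. -/
def flowY (C H Λ : ℝ) : ℝ → (Fin 3 → ℝ) → (Fin 3 → ℝ) := affineFlow (DY C H) ![-Λ, -(H * Λ), 0]

/-- The Filippov set-valued right-hand side of the piecewise system. -/
def filippov (C H Λ : ℝ) (p : Fin 3 → ℝ) : Set (Fin 3 → ℝ) :=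
  if 0 < p 2 then {X C H Λ p}
  else if p 2 < 0 then {Y C H Λ p}
  else segment ℝ (X C H Λ p) (Y C H Λ p)

/-- Filippov solutions on `[0, ∞)`: locally absolutely continuous curves (written as integrals of
their a.e. derivative `v`) that satisfy the differential inclusion almost everywhere. -/
def IsFilippovSolution (C H Λ : ℝ) (γ : ℝ → (Fin 3 → ℝ)) : Prop :=
  ∃ v : ℝ → (Fin 3 → ℝ),
    (∀ t : ℝ, 0 ≤ t → IntervalIntegrable v volume 0 t) ∧
    (∀ᵐ t ∂(volume.restrict (Set.Ici (0 : ℝ))), v t ∈ filippov C H Λ (γ t)) ∧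
    ∀ t : ℝ, 0 ≤ t → γ t = γ 0 + ∫ s in (0 : ℝ)..t, v s

/-- Orbital asymptotic stability of a set `K` (used for the orbit of a cycle): Lyapunov stability
together with local attraction, for all Filippov solutions. -/
def OrbitallyAsymptoticallyStable (C H Λ : ℝ) (K : Set (Fin 3 → ℝ)) : Prop :=
  (∀ ε : ℝ, 0 < ε → ∃ δ : ℝ, 0 < δ ∧ ∀ γ : ℝ → (Fin 3 → ℝ), IsFilippovSolution C H Λ γ →
    Metric.infDist (γ 0) K < δ → ∀ t : ℝ, 0 ≤ t → Metric.infDist (γ t) K < ε) ∧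
  (∃ δ : ℝ, 0 < δ ∧ ∀ γ : ℝ → (Fin 3 → ℝ), IsFilippovSolution C H Λ γ →
    Metric.infDist (γ 0) K < δ → Tendsto (fun t => Metric.infDist (γ t) K) atTop (𝓝 0))

/-- `(x, y, 0)` is the upward crossing point of a crossing symmetric periodic orbit of period `2T`:
both fields point upwards there, the `X`-arc runs through `z > 0` for time `T` and ends at
`S(x, y, 0) = (-y, -x, 0)`, and the `Y`-arc runs through `z < 0` for time `T` back to the start. -/
structure IsSymmetricCycle (C H Λ x y T : ℝ) : Prop where
  T_pos : 0 < T
  X_up : 0 < X C H Λ (pt x y) 2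
  Y_up : 0 < Y C H Λ (pt x y) 2
  upper_arc : ∀ s ∈ Set.Ioo 0 T, 0 < flowX C H Λ s (pt x y) 2
  upper_end : flowX C H Λ T (pt x y) = symm (pt x y)
  lower_arc : ∀ s ∈ Set.Ioo 0 T, flowY C H Λ s (symm (pt x y)) 2 < 0
  lower_end : flowY C H Λ T (symm (pt x y)) = pt x y

/-- The orbit (a closed curve in `ℝ³`) of a symmetric cycle. -/
def cycleOrbit (C H Λ x y T : ℝ) : Set (Fin 3 → ℝ) :=
  (fun s => flowX C H Λ s (pt x y)) '' Set.Icc 0 T ∪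
    (fun s => flowY C H Λ s (symm (pt x y))) '' Set.Icc 0 T

/-- The symmetric cycle is orbitally asymptotically stable. -/
def IsStableCycle (C H Λ x y T : ℝ) : Prop :=
  OrbitallyAsymptoticallyStable C H Λ (cycleOrbit C H Λ x y T)

/-! ### The saltation-corrected monodromy matrix -/

/-- The normal `e₃ = ∇f` of `Σ = {f = 0}`, `f(x, y, z) = z`. -/
def e₃ : Fin 3 → ℝ := ![0, 0, 1]

/-- `S_{X → Y}(p) = I + (Y - X) e₃ᵀ / Xf`. -/
def saltationXY (C H Λ : ℝ) (p : Fin 3 → ℝ) : Matrix (Fin 3) (Fin 3) ℝ :=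
  1 + (1 / X C H Λ p 2) • Matrix.vecMulVec (Y C H Λ p - X C H Λ p) e₃

/-- `S_{Y → X}(p) = I - (Y - X) e₃ᵀ / Yf`. -/
def saltationYX (C H Λ : ℝ) (p : Fin 3 → ℝ) : Matrix (Fin 3) (Fin 3) ℝ :=
  1 - (1 / Y C H Λ p 2) • Matrix.vecMulVec (Y C H Λ p - X C H Λ p) e₃

/-- `M = S_{Y → X}(p₀) e^{T DY} S_{X → Y}(p₁) e^{T DX}` with `p₀ = (x, y, 0)`, `p₁ = S p₀`. -/
def monodromy (C H Λ x y T : ℝ) : Matrix (Fin 3) (Fin 3) ℝ :=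
  saltationYX C H Λ (pt x y) * NormedSpace.exp (T • DY C H) *
    saltationXY C H Λ (symm (pt x y)) * NormedSpace.exp (T • DX C H)

/-- The transverse quadratic `q(μ) = μ² - (tr M - 1) μ + det M`, whose roots are the two transverse
multipliers of `M`. -/
def transversePoly (M : Matrix (Fin 3) (Fin 3) ℝ) : Polynomial ℂ :=
  Polynomial.X ^ 2 - Polynomial.C ((M.trace - 1 : ℝ) : ℂ) * Polynomial.X
    + Polynomial.C ((M.det : ℝ) : ℂ)

/-! ### The conic, its branch at infinity and the half-return time -/

/-- The conic `Γ₁` in the coordinates `(x, y)` of `Σ`. -/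
def conic (C H Λ : ℝ) : Set (ℝ × ℝ) :=
  {p | H * (p.1 ^ 2 + p.2 ^ 2) - (H + 1) * p.1 * p.2 + 2 * C * H * Λ * (p.2 - p.1) / (C ^ 2 + 1)
    + Λ ^ 2 * (H - 1) / (C ^ 2 + 1) = 0}

/-- The discriminant `D(Γ₁)` of the quadratic part of the conic. -/
def disc (H : ℝ) : ℝ := (1 - H) * (3 * H + 1)

/-- The radicand in the parametrization of the branch. -/
def branchRadicand (C H Λ y : ℝ) : ℝ :=
  Λ * ((C ^ 2 + 1) * (Λ + C * (1 - H) * y) - Λ * H) / (H * (C ^ 2 + 1) ^ 2)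
    + disc H * y ^ 2 / (4 * H ^ 2)

/-- The branch `Γ` of `Γ₁` carrying the initial point `(x₀(y₀), y₀, 0)`. -/
def branchX (C H Λ y : ℝ) : ℝ :=
  (H + 1) * y / (2 * H) + Λ * C / (C ^ 2 + 1) + Real.sqrt (branchRadicand C H Λ y)

theorem branchX_mem_conic (C H Λ y : ℝ) (hH : H ≠ 0) (h : 0 ≤ branchRadicand C H Λ y) :
    (branchX C H Λ y, y) ∈ conic C H Λ := by
  have hs := Real.sq_sqrt h
  have hC : C ^ 2 + 1 ≠ 0 := by positivity
  simp only [conic, Set.mem_ofPred_eq, branchX]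
  set r := Real.sqrt (branchRadicand C H Λ y) with hr
  have e : H * (((H + 1) * y / (2 * H) + Λ * C / (C ^ 2 + 1) + r) ^ 2 + y ^ 2)
      - (H + 1) * ((H + 1) * y / (2 * H) + Λ * C / (C ^ 2 + 1) + r) * y
      + 2 * C * H * Λ * (y - ((H + 1) * y / (2 * H) + Λ * C / (C ^ 2 + 1) + r)) / (C ^ 2 + 1)
      + Λ ^ 2 * (H - 1) / (C ^ 2 + 1) = H * (r ^ 2 - branchRadicand C H Λ y) := by
    unfold branchRadicand disc
    field_simp
    ring
  rw [e, hs]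
  ring

/-- The half-return time `t^X` of `(x, y, 0)`: the first positive time at which the `X`-trajectory
is again on `Σ`. -/
def halfReturnTime (C H Λ x y : ℝ) : ℝ :=
  sInf {t : ℝ | 0 < t ∧ flowX C H Λ t (pt x y) 2 = 0}

/-- The monodromy matrix along the branch `Γ`, as a function of `y₀ = y`. -/
def branchMonodromy (C H Λ y : ℝ) : Matrix (Fin 3) (Fin 3) ℝ :=
  monodromy C H Λ (branchX C H Λ y) y (halfReturnTime C H Λ (branchX C H Λ y) y)

/-! ### The asymptotic quantities and the stability band -/

/-- `m_{Γ₁} = 2H / (H + √D(Γ₁) + 1)`. -/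
def mΓ (H : ℝ) : ℝ := 2 * H / (H + Real.sqrt (disc H) + 1)

def Ψp2 (H : ℝ) : ℝ := -((H + 1) * (H - Real.sqrt (disc H) - 3)) / 2

def Ψm1 (H : ℝ) : ℝ :=
  (H ^ 2 - 1) * ((H + 1) * Real.sqrt (disc H) - (H - 1) ^ 2 + 2) / H ^ 2

def Ψm4 (H : ℝ) : ℝ := ((H + 1) * Real.sqrt (disc H) - (H - 1) ^ 2 + 2) / 2

/-- The asymptotic trace `τ_{Γ₁}`. -/
def τΓ (C H : ℝ) : ℝ :=
  mΓ H ^ 2 * (Ψp2 H * Real.exp (2 * Real.pi * C) + Ψm1 H * Real.exp (-(Real.pi * C))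
    + Ψm4 H * Real.exp (-(4 * Real.pi * C)))

/-- The region `C > 0`, `0 < H < 1` of the `(C, H)`-plane. -/
def paramRegion : Set (ℝ × ℝ) := {p | 0 < p.1 ∧ 0 < p.2 ∧ p.2 < 1}

/-- The asymptotic stability band. -/
def stabilityBand : Set (ℝ × ℝ) :=
  {p | p ∈ paramRegion ∧ 0 < 2 + mΓ p.2 ^ 2 - τΓ p.1 p.2 ∧ 0 < τΓ p.1 p.2 + mΓ p.2 ^ 2}

/-- The upper boundary `2 + m² - τ = 0`. -/
def upperBoundary : Set (ℝ × ℝ) := {p | p ∈ paramRegion ∧ 2 + mΓ p.2 ^ 2 - τΓ p.1 p.2 = 0}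

/-- The lower boundary `τ + m² = 0`. -/
def lowerBoundary : Set (ℝ × ℝ) := {p | p ∈ paramRegion ∧ τΓ p.1 p.2 + mΓ p.2 ^ 2 = 0}

/-- `H_crit(C) = 1 / (2 cosh(πC) - 1)`. -/
def Hcrit (C : ℝ) : ℝ := 1 / (2 * Real.cosh (Real.pi * C) - 1)

/-- The Schur–Cohn conditions `1 - det M > 0`, `2 - tr M + det M > 0`, `tr M + det M > 0`. -/
def SchurCohn (M : Matrix (Fin 3) (Fin 3) ℝ) : Prop :=
  0 < 1 - M.det ∧ 0 < 2 - M.trace + M.det ∧ 0 < M.trace + M.det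

end PWL

end

open Filter Topology MeasureTheory

noncomputable section

namespace PWL

/-! ### Explicit flows -/

theorem lipschitzWith_affine (D : Matrix (Fin 3) (Fin 3) ℝ) (b : Fin 3 → ℝ) :
    ∃ K, LipschitzWith K (fun p : Fin 3 → ℝ => D.mulVec p + b) := by
  let L : (Fin 3 → ℝ) →L[ℝ] (Fin 3 → ℝ) := LinearMap.toContinuousLinearMap D.mulVecLin
  refine ⟨‖L‖₊, LipschitzWith.of_dist_le_mul fun p q => ?_⟩
  rw [dist_add_right]
  exact L.lipschitz.dist_le_mul p q

theorem affineFlow_unique (D : Matrix (Fin 3) (Fin 3) ℝ) (b : Fin 3 → ℝ) {u : ℝ → Fin 3 → ℝ}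
    (hu : ∀ t, HasDerivAt u (D.mulVec (u t) + b) t) (t : ℝ) :
    affineFlow D b t (u 0) = u t := by
  obtain ⟨K, hK⟩ := lipschitzWith_affine D b
  have := ODE_solution_unique_univ (v := fun _ p => D.mulVec p + b) (s := fun _ => Set.univ)
    (K := K) (t₀ := 0) (f := fun t => affineFlow D b t (u 0)) (g := u)
    (fun _ => hK.lipschitzOnWith) (fun t => ⟨hasDerivAt_affineFlow D b (u 0) t, trivial⟩)
    (fun t => ⟨hu t, trivial⟩) (affineFlow_zero D b (u 0))
  exact congrFun this t

theorem affineFlow_add (D : Matrix (Fin 3) (Fin 3) ℝ) (b p : Fin 3 → ℝ) (s t : ℝ) :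
    affineFlow D b (s + t) p = affineFlow D b t (affineFlow D b s p) := by
  have := affineFlow_unique D b (u := fun r => affineFlow D b (s + r) p)
    (fun r => (hasDerivAt_affineFlow D b p (s + r)).comp_const_add s r) t
  simpa using this.symm

theorem affineFlow_zero_right (D : Matrix (Fin 3) (Fin 3) ℝ) (t : ℝ) (p : Fin 3 → ℝ) :
    affineFlow D 0 t p = (NormedSpace.exp (t • D)).mulVec p := by
  simp [affineFlow]

/-- The field is transported by the linearized flow. -/
theorem exp_mulVec_field (D : Matrix (Fin 3) (Fin 3) ℝ) (b p : Fin 3 → ℝ) (t : ℝ) :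
    (NormedSpace.exp (t • D)).mulVec (D.mulVec p + b) =
      D.mulVec (affineFlow D b t p) + b := by
  rw [← affineFlow_zero_right]
  have := affineFlow_unique D 0 (u := fun t => D.mulVec (affineFlow D b t p) + b) (fun t => ?_) t
  · simpa [affineFlow_zero] using this
  · let L : (Fin 3 → ℝ) →L[ℝ] (Fin 3 → ℝ) := LinearMap.toContinuousLinearMap D.mulVecLin
    have := (L.hasFDerivAt.comp_hasDerivAt t (hasDerivAt_affineFlow D b p t)).add_const b
    rw [add_zero]
    exact this

/-- The height `z` along the `X`-trajectory of `(x, y, z)`, with `k = Λ / (1 + C²)`. -/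
def height (C k y z t : ℝ) : ℝ :=
  k + Real.exp (C * t) * ((z - k) * Real.cos t + (y + C * z + C * k) * Real.sin t)

/-- The coordinate `y` along the `X`-trajectory of `(x, y, z)`. -/
def slope (C k y z t : ℝ) : ℝ :=
  Real.exp (C * t) * ((y + C * z + C * k) * Real.cos t - (z - k) * Real.sin t)
    - C * height C k y z t - C * k

/-- The `X`-trajectory in closed form. -/
def explicitFlow (C H k : ℝ) (t : ℝ) (p : Fin 3 → ℝ) : Fin 3 → ℝ :=
  ![Real.exp (-2 * C * t) * (p 0 - H * p 1 + 2 * C * H * p 2) + H * slope C k (p 1) (p 2) t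
      - 2 * C * H * height C k (p 1) (p 2) t,
    slope C k (p 1) (p 2) t, height C k (p 1) (p 2) t]

theorem hasDerivAt_expCos (C α β t : ℝ) :
    HasDerivAt (fun t => Real.exp (C * t) * (α * Real.cos t + β * Real.sin t))
      (Real.exp (C * t) * (C * (α * Real.cos t + β * Real.sin t)
        + (β * Real.cos t - α * Real.sin t))) t := by
  have h1 : HasDerivAt (fun t => Real.exp (C * t)) (Real.exp (C * t) * (C * 1)) t :=
    ((hasDerivAt_id t).const_mul C).exp
  have h2 := ((Real.hasDerivAt_cos t).const_mul α).add ((Real.hasDerivAt_sin t).const_mul β)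
  refine (h1.mul h2).congr_deriv ?_
  simp only [Pi.add_apply]
  ring

theorem hasDerivAt_height (C k y z t : ℝ) :
    HasDerivAt (height C k y z) (2 * C * height C k y z t + slope C k y z t) t := by
  refine ((hasDerivAt_expCos C (z - k) (y + C * z + C * k) t).const_add k).congr_deriv ?_
  simp only [slope, height]
  ring

theorem hasDerivAt_slope (C k y z t : ℝ) :
    HasDerivAt (slope C k y z) ((1 + C ^ 2) * (k - height C k y z t)) t := by
  have h := ((hasDerivAt_expCos C (y + C * z + C * k) (-(z - k)) t).sub
    ((hasDerivAt_height C k y z t).const_mul C)).sub_const (C * k)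
  refine (h.congr_deriv ?_).congr_of_eventuallyEq (Eventually.of_forall fun s => ?_)
  · simp only [slope, height]
    ring
  · simp only [slope, Pi.sub_apply]
    ring

theorem explicitFlow_zero (C H k : ℝ) (p : Fin 3 → ℝ) : explicitFlow C H k 0 p = p := by
  ext i
  fin_cases i <;> simp [explicitFlow, height, slope] <;> ring

theorem hasDerivAt_explicitFlow (C H k : ℝ) (p : Fin 3 → ℝ) (t : ℝ) :
    HasDerivAt (fun t => explicitFlow C H k t p)
      ((DX C H).mulVec (explicitFlow C H k t p) + ![H * (k * (1 + C ^ 2)), k * (1 + C ^ 2), 0])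
      t := by
  have hz := hasDerivAt_height C k (p 1) (p 2) t
  have hy := hasDerivAt_slope C k (p 1) (p 2) t
  have he : HasDerivAt (fun t => Real.exp (-2 * C * t))
      (Real.exp (-2 * C * t) * (-2 * C * 1)) t :=
    ((hasDerivAt_id t).const_mul (-2 * C)).exp
  have hx := ((he.mul_const (p 0 - H * p 1 + 2 * C * H * p 2)).add (hy.const_mul H)).sub
    (hz.const_mul (2 * C * H))
  rw [hasDerivAt_pi]
  intro i
  fin_cases i
  · refine hx.congr_deriv ?_
    simp [DX, upperMatrix, explicitFlow]
    ring
  · refine hy.congr_deriv ?_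
    simp [DX, upperMatrix, explicitFlow]
    ring
  · refine hz.congr_deriv ?_
    simp [DX, upperMatrix, explicitFlow]
    ring

/-- The height of the equilibrium of `X`. -/
def eqHeight (C Λ : ℝ) : ℝ := Λ / (1 + C ^ 2)

theorem eqHeight_mul (C Λ : ℝ) : eqHeight C Λ * (1 + C ^ 2) = Λ := by
  have : (1 + C ^ 2) ≠ 0 := by positivity
  simp [eqHeight, this]

theorem flowX_eq (C H Λ t : ℝ) (p : Fin 3 → ℝ) :
    flowX C H Λ t p = explicitFlow C H (eqHeight C Λ) t p := by
  have := affineFlow_unique (DX C H) ![H * Λ, Λ, 0]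
    (u := fun t => explicitFlow C H (eqHeight C Λ) t p) (fun t => ?_) t
  · simpa [explicitFlow_zero, flowX] using this
  · have h := hasDerivAt_explicitFlow C H (eqHeight C Λ) p t
    rwa [eqHeight_mul] at h

theorem hasDerivAt_flowX (C H Λ : ℝ) (p : Fin 3 → ℝ) (t : ℝ) :
    HasDerivAt (fun t => flowX C H Λ t p) (X C H Λ (flowX C H Λ t p)) t := by
  rw [X_eq]
  exact hasDerivAt_affineFlow _ _ p t

theorem flowX_zero (C H Λ : ℝ) (p : Fin 3 → ℝ) : flowX C H Λ 0 p = p := affineFlow_zero _ _ p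

theorem flowX_add (C H Λ s t : ℝ) (p : Fin 3 → ℝ) :
    flowX C H Λ (s + t) p = flowX C H Λ t (flowX C H Λ s p) := affineFlow_add _ _ p s t

theorem continuous_flowX (C H Λ : ℝ) :
    Continuous fun q : ℝ × (Fin 3 → ℝ) => flowX C H Λ q.1 q.2 := by
  simp only [flowX_eq]
  refine continuous_pi fun i => ?_
  fin_cases i <;> simp only [explicitFlow, slope, height] <;> simp <;> fun_prop

/-! ### The symmetry -/

theorem symm_symm (p : Fin 3 → ℝ) : symm (symm p) = p := by
  ext i
  fin_cases i <;> simp [symm]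

/-- The symmetry as a linear map. -/
def symmLinear : (Fin 3 → ℝ) →ₗ[ℝ] (Fin 3 → ℝ) where
  toFun := symm
  map_add' p q := by
    ext i
    fin_cases i <;> simp [symm] <;> ring
  map_smul' c p := by
    ext i
    fin_cases i <;> simp [symm]

/-- The symmetry as a continuous linear map. -/
def symmCLM : (Fin 3 → ℝ) →L[ℝ] (Fin 3 → ℝ) := LinearMap.toContinuousLinearMap symmLinear

theorem symmCLM_apply (p : Fin 3 → ℝ) : symmCLM p = symm p := rfl

theorem continuous_symm : Continuous symm := symmCLM.continuous

theorem norm_symm (p : Fin 3 → ℝ) : ‖symm p‖ = ‖p‖ := by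
  have key : ∀ q : Fin 3 → ℝ, ‖symm q‖ ≤ ‖q‖ := by
    intro q
    rw [pi_norm_le_iff_of_nonneg (norm_nonneg q)]
    intro i
    fin_cases i
    · simpa [symm] using norm_le_pi_norm q 1
    · simpa [symm] using norm_le_pi_norm q 0
    · simpa [symm] using norm_le_pi_norm q 2
  refine le_antisymm (key p) ?_
  simpa [symm_symm] using key (symm p)

theorem symm_sub (p q : Fin 3 → ℝ) : symm (p - q) = symm p - symm q := symmCLM.map_sub p q

theorem symm_add (p q : Fin 3 → ℝ) : symm (p + q) = symm p + symm q := symmCLM.map_add p q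

theorem symm_smul (c : ℝ) (p : Fin 3 → ℝ) : symm (c • p) = c • symm p := symmCLM.map_smul c p

theorem dist_symm (p q : Fin 3 → ℝ) : dist (symm p) (symm q) = dist p q := by
  rw [dist_eq_norm, ← symm_sub, norm_symm, dist_eq_norm]

theorem Y_symm (C H Λ : ℝ) (p : Fin 3 → ℝ) : Y C H Λ (symm p) = symm (X C H Λ p) := by
  rw [← symm_symm (Y C H Λ (symm p)), ← X_symm, symm_symm]

theorem flowY_symm (C H Λ t : ℝ) (p : Fin 3 → ℝ) :
    flowY C H Λ t (symm p) = symm (flowX C H Λ t p) := by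
  have := affineFlow_unique (DY C H) ![-Λ, -(H * Λ), 0]
    (u := fun t => symm (flowX C H Λ t p)) (fun t => ?_) t
  · simpa [flowX_zero, flowY] using this
  · have h := symmCLM.hasFDerivAt.comp_hasDerivAt t (hasDerivAt_flowX C H Λ p t)
    rw [← Y_eq, Y_symm]
    exact h

/-! ### Filippov solutions -/

theorem continuous_X (C H Λ : ℝ) : Continuous (X C H Λ) := by
  refine continuous_pi fun i => ?_
  fin_cases i <;> simp [X, upperField] <;> fun_prop

theorem continuous_Y (C H Λ : ℝ) : Continuous (Y C H Λ) := by
  refine continuous_pi fun i => ?_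
  fin_cases i <;> simp [Y, lowerField] <;> fun_prop

theorem symm_mem_filippov {C H Λ : ℝ} {p v : Fin 3 → ℝ} (hv : v ∈ filippov C H Λ p) :
    symm v ∈ filippov C H Λ (symm p) := by
  have hz : symm p 2 = -p 2 := by simp [symm]
  unfold filippov at hv ⊢
  rw [hz, X_symm, Y_symm]
  rcases lt_trichotomy (p 2) 0 with h | h | h
  · rw [if_neg h.le.not_gt, if_pos h] at hv
    rw [if_pos (by linarith), Set.mem_singleton_iff.1 hv]
    rfl
  · rw [if_neg (by linarith), if_neg (by linarith)] at hv ⊢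
    rw [segment_symm]
    obtain ⟨a, b, ha, hb, hab, rfl⟩ := hv
    exact ⟨a, b, ha, hb, hab, by rw [symm_add, symm_smul, symm_smul]⟩
  · rw [if_pos h] at hv
    rw [if_neg (by linarith), if_pos (by linarith), Set.mem_singleton_iff.1 hv]
    rfl

namespace IsFilippovSolution

variable {C H Λ : ℝ} {γ : ℝ → Fin 3 → ℝ}

theorem continuousOn (h : IsFilippovSolution C H Λ γ) : ContinuousOn γ (Set.Ici 0) := by
  obtain ⟨v, hv, -, hγ⟩ := h
  intro t ht
  have ht : 0 ≤ t := ht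
  have h1 : ContinuousOn (fun s => γ 0 + ∫ r in (0 : ℝ)..s, v r) (Set.Icc 0 (t + 1)) := by
    have := intervalIntegral.continuousOn_primitive_interval'
      (hv (t + 1) (by linarith)) (Set.left_mem_uIcc)
    rw [Set.uIcc_of_le (by linarith)] at this
    exact continuousOn_const.add this
  have h2 : ContinuousOn γ (Set.Icc 0 (t + 1)) := h1.congr fun s hs => hγ s hs.1
  refine (h2 t ⟨ht, by linarith⟩).mono_of_mem_nhdsWithin ?_
  rw [← Set.Ici_inter_Iic]
  exact inter_mem_nhdsWithin _ (Iic_mem_nhds (by linarith))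

theorem shift (h : IsFilippovSolution C H Λ γ) {s : ℝ} (hs : 0 ≤ s) :
    IsFilippovSolution C H Λ (fun t => γ (s + t)) := by
  obtain ⟨v, hv, hF, hγ⟩ := h
  have hi : ∀ t, 0 ≤ t → IntervalIntegrable v volume s (s + t) := fun t ht =>
    (hv s hs).symm.trans (hv (s + t) (by linarith))
  refine ⟨fun t => v (s + t), fun t ht => ?_, ?_, fun t ht => ?_⟩
  · simpa using (hi t ht).comp_add_left s
  · rw [ae_restrict_iff' measurableSet_Ici] at hF ⊢
    have := (measurePreserving_add_left volume s).quasiMeasurePreserving.ae hF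
    filter_upwards [this] with t ht h0
    exact ht (add_nonneg hs h0)
  · simp only [add_zero]
    rw [intervalIntegral.integral_comp_add_left (fun t => v t) s, add_zero, hγ s hs,
      hγ (s + t) (by linarith), add_assoc,
      intervalIntegral.integral_add_adjacent_intervals (hv s hs) (hi t ht)]

theorem map_symm (h : IsFilippovSolution C H Λ γ) :
    IsFilippovSolution C H Λ (fun t => symm (γ t)) := by
  obtain ⟨v, hv, hF, hγ⟩ := h
  refine ⟨fun t => symm (v t), fun t ht => ?_, ?_, fun t ht => ?_⟩
  · exact ⟨symmCLM.integrable_comp (hv t ht).1, symmCLM.integrable_comp (hv t ht).2⟩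
  · filter_upwards [hF] with t ht
    exact symm_mem_filippov ht
  · have := symmCLM.intervalIntegral_comp_comm (hv t ht)
    simp only [symmCLM_apply] at this
    rw [this, ← symm_add, ← hγ t ht]

/-- While it runs through `z > 0`, a Filippov solution follows the flow of `X`. -/
theorem eq_flowX (h : IsFilippovSolution C H Λ γ) {w : ℝ} (hpos : ∀ u ∈ Set.Ioo 0 w, 0 < γ u 2) :
    ∀ u ∈ Set.Icc 0 w, γ u = flowX C H Λ u (γ 0) := by
  rcases lt_or_ge w 0 with hw | hw
  · intro u hu
    linarith [hu.1, hu.2]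
  have hc := h.continuousOn
  obtain ⟨v, hv, hF, hγ⟩ := h
  set g : ℝ → Fin 3 → ℝ := fun t => γ (max 0 (min t w)) with hg
  have hgc : Continuous g :=
    hc.comp_continuous (by fun_prop) fun t => Set.mem_Ici.2 (le_max_left _ _)
  have hgI : ∀ t ∈ Set.Icc 0 w, g t = γ t := fun t ht => by
    simp [hg, min_eq_left ht.2, max_eq_right ht.1]
  set G : ℝ → Fin 3 → ℝ := fun t => γ 0 + ∫ s in (0 : ℝ)..t, X C H Λ (g s) with hG
  have hXc : Continuous fun s => X C H Λ (g s) := (continuous_X C H Λ).comp hgc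
  have hGd : ∀ t, HasDerivAt G (X C H Λ (g t)) t := fun t =>
    (intervalIntegral.integral_hasDerivAt_right (hXc.intervalIntegrable _ _)
      (hXc.stronglyMeasurableAtFilter _ _) hXc.continuousAt).const_add _
  have hGγ : ∀ t ∈ Set.Icc 0 w, G t = γ t := by
    intro t ht
    rw [hγ t ht.1]
    simp only [hG]
    congr 1
    refine intervalIntegral.integral_congr_ae ?_
    rw [ae_restrict_iff' measurableSet_Ici] at hF
    have h0 : ∀ᵐ s : ℝ, s ≠ t := by
      simp [ae_iff, measure_singleton]
    filter_upwards [hF, h0] with s hs hst hsI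
    rw [Set.uIoc_of_le ht.1] at hsI
    have h2 := hs hsI.1.le
    have h3 : s < w := lt_of_lt_of_le (lt_of_le_of_ne hsI.2 hst) ht.2
    rw [filippov, if_pos (hpos s ⟨hsI.1, h3⟩), Set.mem_singleton_iff] at h2
    rw [h2, hgI s ⟨hsI.1.le, h3.le⟩]
  obtain ⟨K, hK⟩ := lipschitzWith_affine (DX C H) ![H * Λ, Λ, 0]
  have hK' : LipschitzWith K (X C H Λ) := by
    have : X C H Λ = fun p => (DX C H).mulVec p + ![H * Λ, Λ, 0] := funext fun p => X_eq C H Λ p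
    rwa [this]
  have huniq := ODE_solution_unique (v := fun _ => X C H Λ) (f := G)
    (g := fun t => flowX C H Λ t (γ 0)) (a := 0) (b := w) (fun _ => hK')
    (fun t _ => (hGd t).continuousAt.continuousWithinAt)
    (fun t ht => by
      have := (hGd t).hasDerivWithinAt (s := Set.Ici t)
      rwa [hgI t ⟨ht.1, ht.2.le⟩, ← hGγ t ⟨ht.1, ht.2.le⟩] at this)
    (fun t _ => (hasDerivAt_flowX C H Λ (γ 0) t).continuousAt.continuousWithinAt)
    (fun t _ => (hasDerivAt_flowX C H Λ (γ 0) t).hasDerivWithinAt)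
    (by simp [hG, flowX_zero])
  intro u hu
  rw [← hGγ u hu]
  exact huniq hu

end IsFilippovSolution

theorem pt_apply_two (x y : ℝ) : pt x y 2 = 0 := by simp [pt]

/-- Near an upward crossing point all Filippov directions point upwards at a definite rate. -/
theorem exists_upward_bounds (C H Λ : ℝ) {x y : ℝ} (hx : 0 < x) (hy : 0 < y) {ε : ℝ}
    (hε : 0 < ε) :
    ∃ c V R : ℝ, 0 < c ∧ 0 < V ∧ 0 < R ∧ R ≤ ε ∧ ∀ q : Fin 3 → ℝ, dist q (pt x y) < R →
      ∀ v ∈ filippov C H Λ q, c ≤ v 2 ∧ ‖v‖ ≤ V := by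
  set b := pt x y
  have hXb : X C H Λ b 2 = y := by simp [b, X, upperField, pt]
  have hYb : Y C H Λ b 2 = x := by simp [b, Y, lowerField, pt]
  set c := min x y / 2
  have hm : 0 < min x y := lt_min hx hy
  have hc : 0 < c := half_pos hm
  have hcx : c < x := lt_of_lt_of_le (half_lt_self hm) (min_le_left _ _)
  have hcy : c < y := lt_of_lt_of_le (half_lt_self hm) (min_le_right _ _)
  set V := max ‖X C H Λ b‖ ‖Y C H Λ b‖ + 1
  have hX := (continuous_X C H Λ)
  have hY := (continuous_Y C H Λ)
  have e1 : ∀ᶠ q in 𝓝 b, c < X C H Λ q 2 :=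
    ((continuous_apply 2).comp hX).continuousAt.eventually_const_lt (by simpa [hXb] using hcy)
  have e2 : ∀ᶠ q in 𝓝 b, c < Y C H Λ q 2 :=
    ((continuous_apply 2).comp hY).continuousAt.eventually_const_lt (by simpa [hYb] using hcx)
  have e3 : ∀ᶠ q in 𝓝 b, ‖X C H Λ q‖ < V :=
    hX.norm.continuousAt.eventually_lt_const
      (lt_of_le_of_lt (le_max_left _ ‖Y C H Λ b‖) (lt_add_one _))
  have e4 : ∀ᶠ q in 𝓝 b, ‖Y C H Λ q‖ < V :=
    hY.norm.continuousAt.eventually_lt_const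
      (lt_of_le_of_lt (le_max_right ‖X C H Λ b‖ _) (lt_add_one _))
  obtain ⟨R, hR, hball⟩ := Metric.eventually_nhds_iff.1 (e1.and (e2.and (e3.and e4)))
  refine ⟨c, V, min R ε, hc, by positivity, lt_min hR hε, min_le_right _ _, fun q hq v hv => ?_⟩
  obtain ⟨h1, h2, h3, h4⟩ := hball (lt_of_lt_of_le hq (min_le_left _ _))
  unfold filippov at hv
  split_ifs at hv
  · rw [Set.mem_singleton_iff.1 hv]
    exact ⟨h1.le, h3.le⟩
  · rw [Set.mem_singleton_iff.1 hv]
    exact ⟨h2.le, h4.le⟩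
  · obtain ⟨α, β, hα, hβ, hαβ, rfl⟩ := hv
    refine ⟨?_, ?_⟩
    · simp only [Pi.add_apply, Pi.smul_apply, smul_eq_mul]
      nlinarith
    · refine (norm_add_le _ _).trans ?_
      rw [norm_smul, norm_smul, Real.norm_of_nonneg hα, Real.norm_of_nonneg hβ]
      have e1 := mul_le_mul_of_nonneg_left h3.le hα
      have e2 := mul_le_mul_of_nonneg_left h4.le hβ
      have e3 : α * V + β * V = V := by rw [← add_mul, hαβ, one_mul]
      linarith

namespace IsFilippovSolution

variable {C H Λ : ℝ} {γ : ℝ → Fin 3 → ℝ}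

theorem rise_of_stay (h : IsFilippovSolution C H Λ γ) {b : Fin 3 → ℝ} {c V R : ℝ}
    (hb : ∀ q : Fin 3 → ℝ, dist q b < R → ∀ v ∈ filippov C H Λ q, c ≤ v 2 ∧ ‖v‖ ≤ V)
    {u : ℝ} (hu : 0 ≤ u) (hs : ∀ s ∈ Set.Ioo 0 u, dist (γ s) b < R) :
    γ 0 2 + c * u ≤ γ u 2 ∧ dist (γ u) (γ 0) ≤ V * u := by
  obtain ⟨v, hv, hF, hγ⟩ := h
  rw [ae_restrict_iff' measurableSet_Ici] at hF
  have h0 : ∀ᵐ s : ℝ, s ≠ u := by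
    simp [ae_iff, measure_singleton]
  have key : ∀ᵐ s : ℝ, s ∈ Set.uIoc 0 u → c ≤ v s 2 ∧ ‖v s‖ ≤ V := by
    filter_upwards [hF, h0] with s hFs hsu hsI
    rw [Set.uIoc_of_le hu] at hsI
    exact hb _ (hs s ⟨hsI.1, lt_of_le_of_ne hsI.2 hsu⟩) _ (hFs hsI.1.le)
  constructor
  · let L : (Fin 3 → ℝ) →L[ℝ] ℝ := ContinuousLinearMap.proj 2
    have h1 : (∫ s in (0 : ℝ)..u, v s) 2 = ∫ s in (0 : ℝ)..u, v s 2 :=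
      (L.intervalIntegral_comp_comm (hv u hu)).symm
    have h2 : ∫ _ in (0 : ℝ)..u, c ≤ ∫ s in (0 : ℝ)..u, v s 2 := by
      refine intervalIntegral.integral_mono_ae_restrict hu intervalIntegrable_const
        ⟨L.integrable_comp (hv u hu).1, L.integrable_comp (hv u hu).2⟩ ?_
      rw [← restrict_Ioc_eq_restrict_Icc]
      refine (ae_restrict_iff' measurableSet_Ioc).2 ?_
      filter_upwards [key] with s hs hsI
      exact (hs (by rwa [Set.uIoc_of_le hu])).1
    rw [hγ u hu, Pi.add_apply, h1]
    simp at h2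
    linarith
  · rw [hγ u hu, dist_eq_norm, add_sub_cancel_left]
    have := intervalIntegral.norm_integral_le_of_norm_le_const_ae (f := v) (a := 0) (b := u)
      (C := V) (key.mono fun s hs hsI => (hs hsI).2)
    simpa [abs_of_nonneg hu] using this

theorem stay (h : IsFilippovSolution C H Λ γ) {b : Fin 3 → ℝ} {c V R : ℝ} (hV : 0 < V)
    (hb : ∀ q : Fin 3 → ℝ, dist q b < R → ∀ v ∈ filippov C H Λ q, c ≤ v 2 ∧ ‖v‖ ≤ V)
    {w : ℝ} (hw : dist (γ 0) b + V * w < R) : ∀ u ∈ Set.Icc 0 w, dist (γ u) b < R := by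
  by_contra! hcon
  obtain ⟨u₁, hu₁, hd₁⟩ := hcon
  set S := {u ∈ Set.Icc 0 w | R ≤ dist (γ u) b}
  have hcont : ContinuousOn (fun u => dist (γ u) b) (Set.Icc 0 w) :=
    (continuous_id.dist continuous_const).comp_continuousOn
      (h.continuousOn.mono Set.Icc_subset_Ici_self)
  have hS : IsCompact S := by
    refine isCompact_Icc.of_isClosed_subset ?_ fun u hu => hu.1
    exact hcont.preimage_isClosed_of_isClosed isClosed_Icc isClosed_Ici
  obtain ⟨u₀, hu₀, hmin⟩ := hS.exists_isLeast ⟨u₁, hu₁, hd₁⟩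
  have := (h.rise_of_stay hb hu₀.1.1 fun s hs => by
    by_contra! hR
    exact absurd (hmin ⟨⟨hs.1.le, hs.2.le.trans hu₀.1.2⟩, hR⟩) (not_le.2 hs.2)).2
  have h1 : V * u₀ ≤ V * w := mul_le_mul_of_nonneg_left hu₀.1.2 hV.le
  have h2 := dist_triangle (γ u₀) (γ 0) b
  linarith [hu₀.2]

end IsFilippovSolution

/-- A Filippov solution starting just below an upward crossing point reaches the switching plane
nearby. -/
theorem exists_reach_section (C H Λ : ℝ) {x y : ℝ} (hx : 0 < x) (hy : 0 < y) {ε : ℝ}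
    (hε : 0 < ε) :
    ∃ δ > 0, ∀ γ, IsFilippovSolution C H Λ γ → dist (γ 0) (pt x y) < δ → γ 0 2 ≤ 0 →
      ∃ s, 0 ≤ s ∧ γ s 2 = 0 ∧ ∀ u ∈ Set.Icc 0 s, dist (γ u) (pt x y) < ε := by
  obtain ⟨c, V, R, hc, hV, hR, hRε, hb⟩ := exists_upward_bounds C H Λ hx hy hε
  have hδ : 0 < R / (2 * (1 + V / c)) := by positivity
  refine ⟨_, hδ, fun γ hγ hd hz => ?_⟩
  set δ := R / (2 * (1 + V / c))
  have hδR : δ + V * (δ / c) < R := by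
    have : δ + V * (δ / c) = R / 2 := by
      simp only [δ]
      field_simp
    linarith
  set s₁ := -(γ 0 2) / c
  have hs₁ : 0 ≤ s₁ := div_nonneg (by linarith) hc.le
  have hzd : -(γ 0 2) ≤ δ := by
    have h1 := dist_le_pi_dist (γ 0) (pt x y) 2
    rw [pt_apply_two, Real.dist_eq, sub_zero, abs_of_nonpos hz] at h1
    linarith
  have hw : dist (γ 0) (pt x y) + V * s₁ < R := by
    have : V * s₁ ≤ V * (δ / c) :=
      mul_le_mul_of_nonneg_left (div_le_div_of_nonneg_right hzd hc.le) hV.le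
    linarith
  have hstay := hγ.stay hV hb hw
  have hr := (hγ.rise_of_stay hb hs₁ fun s hs => hstay s ⟨hs.1.le, hs.2.le⟩).1
  have hz₁ : 0 ≤ γ s₁ 2 := by
    have : c * s₁ = -(γ 0 2) := by
      simp only [s₁]
      field_simp
    linarith
  have hcont : ContinuousOn (fun u => γ u 2) (Set.Icc 0 s₁) :=
    (continuous_apply 2).comp_continuousOn (hγ.continuousOn.mono Set.Icc_subset_Ici_self)
  obtain ⟨s, hs, hs0⟩ := intermediate_value_Icc hs₁ hcont ⟨hz, hz₁⟩
  exact ⟨s, hs.1, hs0, fun u hu => (hstay u ⟨hu.1, hu.2.trans hs.2⟩).trans_le hRε⟩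

/-- A Filippov solution starting near an upward crossing point in `z ≥ 0` enters `z > 0`. -/
theorem exists_leave_up (C H Λ : ℝ) {x y : ℝ} (hx : 0 < x) (hy : 0 < y) :
    ∃ δ > 0, ∃ η > 0, ∀ γ, IsFilippovSolution C H Λ γ → dist (γ 0) (pt x y) < δ → 0 ≤ γ 0 2 →
      ∀ u ∈ Set.Ioc 0 η, 0 < γ u 2 := by
  obtain ⟨c, V, R, hc, hV, hR, -, hb⟩ := exists_upward_bounds C H Λ hx hy one_pos
  refine ⟨R / 2, half_pos hR, R / (4 * V), by positivity, fun γ hγ hd hz u hu => ?_⟩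
  have hw : dist (γ 0) (pt x y) + V * (R / (4 * V)) < R := by
    have : V * (R / (4 * V)) = R / 4 := by field_simp
    linarith
  have hstay := hγ.stay hV hb hw
  have hr := (hγ.rise_of_stay hb hu.1.le fun s hs => hstay s ⟨hs.1.le, hs.2.le.trans hu.2⟩).1
  have := mul_pos hc hu.1
  linarith

/-- Points from which every Filippov solution starts along the flow of `X` into `z > 0`. -/
def EntersUpper (q : Fin 3 → ℝ) : Prop := 0 < q 2 ∨ ∃ x y : ℝ, 0 < x ∧ 0 < y ∧ q = pt x y

theorem IsFilippovSolution.exists_pos_of_entersUpper {C H Λ : ℝ} {γ : ℝ → Fin 3 → ℝ}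
    (h : IsFilippovSolution C H Λ γ) (he : EntersUpper (γ 0)) :
    ∃ η > 0, ∀ u ∈ Set.Ioc 0 η, 0 < γ u 2 := by
  rcases he with hz | ⟨x, y, hx, hy, hq⟩
  · have hc : ContinuousWithinAt (fun u => γ u 2) (Set.Ici 0) 0 :=
      (continuous_apply 2).continuousAt.comp_continuousWithinAt (h.continuousOn 0 Set.self_mem_Ici)
    have := hc.eventually_const_lt hz
    obtain ⟨η, hη, hsub⟩ := (mem_nhdsGE_iff_exists_Icc_subset).1 this
    exact ⟨η, hη, fun u hu => hsub ⟨hu.1.le, hu.2⟩⟩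
  · obtain ⟨δ, hδ, η, hη, hpos⟩ := exists_leave_up C H Λ hx hy
    exact ⟨η, hη, hpos γ h (by simpa [hq] using hδ) (by simp [hq, pt_apply_two])⟩

/-- A Filippov solution follows the flow of `X` as long as that flow stays in `z > 0`. -/
theorem IsFilippovSolution.follow {C H Λ : ℝ} {γ : ℝ → Fin 3 → ℝ}
    (h : IsFilippovSolution C H Λ γ) (he : EntersUpper (γ 0)) {w : ℝ}
    (hpos : ∀ u ∈ Set.Ioo 0 w, 0 < flowX C H Λ u (γ 0) 2) :
    ∀ u ∈ Set.Icc 0 w, γ u = flowX C H Λ u (γ 0) := by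
  set S := {u : ℝ | γ u = flowX C H Λ u (γ 0)}
  have hcont : ContinuousOn (fun u => γ u - flowX C H Λ u (γ 0)) (Set.Icc 0 w) :=
    (h.continuousOn.mono Set.Icc_subset_Ici_self).sub fun t _ =>
      (hasDerivAt_flowX C H Λ (γ 0) t).continuousAt.continuousWithinAt
  have hS : IsClosed (S ∩ Set.Icc 0 w) := by
    have := hcont.preimage_isClosed_of_isClosed isClosed_Icc (isClosed_singleton (x := 0))
    convert this using 1
    ext u
    simp only [S, Set.mem_inter_iff, Set.mem_preimage, Set.mem_singleton_iff, sub_eq_zero]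
    exact and_comm
  refine hS.Icc_subset_of_forall_exists_gt (by simp [S, flowX_zero]) ?_
  rintro u ⟨huS, hu⟩ r hr
  have hsh := h.shift hu.1
  have hE : EntersUpper (γ (u + 0)) := by
    rw [add_zero]
    rcases hu.1.eq_or_lt with h0 | h0
    · rwa [← h0]
    · left
      rw [show γ u = _ from huS]
      exact hpos u ⟨h0, hu.2⟩
  obtain ⟨η, hη, hη'⟩ := hsh.exists_pos_of_entersUpper hE
  have hm : 0 < min η (r - u) := lt_min hη (sub_pos.2 hr)
  have := hsh.eq_flowX (w := η) (fun s hs => hη' s ⟨hs.1, hs.2.le⟩) (min η (r - u))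
    ⟨hm.le, min_le_left _ _⟩
  refine ⟨u + min η (r - u), ?_, by linarith, by linarith [min_le_right η (r - u)]⟩
  simp only [add_zero] at this
  simp only [S, Set.mem_ofPred_eq]
  rw [this, show γ u = _ from huS, ← flowX_add]

/-! ### Stability of a symmetric cycle from its half-return map -/

/-- Asymptotic stability of a fixed point of a discrete dynamical system. -/
def DiscreteAsymptoticallyStable (P : ℝ × ℝ → ℝ × ℝ) (p₀ : ℝ × ℝ) : Prop :=
  ∀ ε > 0, ∃ δ > 0, ∀ p, dist p p₀ < δ →
    (∀ n, dist (P^[n] p) p₀ < ε) ∧ Tendsto (fun n => P^[n] p) atTop (𝓝 p₀)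

/-- `τ` is a half-return time and `P` the half-return map (followed by `S`) at the point `p` of
the switching plane. -/
structure IsHalfReturn (C H Λ : ℝ) (τ : ℝ × ℝ → ℝ) (P : ℝ × ℝ → ℝ × ℝ) (p : ℝ × ℝ) : Prop where
  fst_pos : 0 < p.1
  snd_pos : 0 < p.2
  time_pos : 0 < τ p
  upper : ∀ u ∈ Set.Ioo 0 (τ p), 0 < flowX C H Λ u (pt p.1 p.2) 2
  return_eq : flowX C H Λ (τ p) (pt p.1 p.2) = symm (pt (P p).1 (P p).2)

theorem continuous_pt : Continuous fun p : ℝ × ℝ => pt p.1 p.2 := by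
  refine continuous_pi fun i => ?_
  fin_cases i <;> simp [pt] <;> fun_prop

section Orbit

variable {C H Λ x y T : ℝ}

theorem IsSymmetricCycle.x_pos (h : IsSymmetricCycle C H Λ x y T) : 0 < x := by
  simpa [Y, lowerField, pt] using h.Y_up

theorem IsSymmetricCycle.y_pos (h : IsSymmetricCycle C H Λ x y T) : 0 < y := by
  simpa [X, upperField, pt] using h.X_up

theorem cycleOrbit_eq : cycleOrbit C H Λ x y T =
    (fun s => flowX C H Λ s (pt x y)) '' Set.Icc 0 T ∪
      symm '' ((fun s => flowX C H Λ s (pt x y)) '' Set.Icc 0 T) := by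
  simp only [cycleOrbit, Set.image_image, flowY_symm]

theorem symm_image_cycleOrbit : symm '' cycleOrbit C H Λ x y T = cycleOrbit C H Λ x y T := by
  rw [cycleOrbit_eq, Set.image_union, Set.union_comm]
  congr 1
  rw [Set.image_image]
  simp [symm_symm]

theorem infDist_symm_cycleOrbit (q : Fin 3 → ℝ) :
    Metric.infDist (symm q) (cycleOrbit C H Λ x y T) =
      Metric.infDist q (cycleOrbit C H Λ x y T) := by
  have hi : Isometry symm := Isometry.of_dist_eq dist_symm
  conv_lhs => rw [← symm_image_cycleOrbit]
  exact Metric.infDist_image hi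

theorem flowX_mem_cycleOrbit {u : ℝ} (hu : u ∈ Set.Icc 0 T) :
    flowX C H Λ u (pt x y) ∈ cycleOrbit C H Λ x y T := Or.inl ⟨u, hu, rfl⟩

theorem isCompact_cycleOrbit : IsCompact (cycleOrbit C H Λ x y T) := by
  have hc : Continuous fun s => flowX C H Λ s (pt x y) :=
    (continuous_flowX C H Λ).comp (continuous_id.prodMk continuous_const)
  rw [cycleOrbit_eq]
  exact (isCompact_Icc.image hc).union ((isCompact_Icc.image hc).image continuous_symm)

variable {τ : ℝ × ℝ → ℝ} {P : ℝ × ℝ → ℝ × ℝ}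

theorem eventually_forall_lt {Φ : ℝ × (Fin 3 → ℝ) → ℝ} (hΦ : Continuous Φ) {σ : ℝ × ℝ → ℝ}
    {p₀ : ℝ × ℝ} (hσ : ContinuousAt σ p₀) {ι : ℝ × ℝ → Fin 3 → ℝ} (hι : Continuous ι) {ε : ℝ}
    (h0 : ∀ θ ∈ Set.Icc (0 : ℝ) 1, Φ (θ * σ p₀, ι p₀) < ε) :
    ∀ᶠ p in 𝓝 p₀, ∀ θ ∈ Set.Icc (0 : ℝ) 1, Φ (θ * σ p, ι p) < ε := by
  refine isCompact_Icc.eventually_forall_of_forall_eventually fun θ hθ => ?_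
  have h1 : Tendsto (fun z : (ℝ × ℝ) × ℝ => σ z.1) (𝓝 (p₀, θ)) (𝓝 (σ p₀)) :=
    hσ.tendsto.comp continuous_fst.continuousAt
  have h2 : Tendsto (fun z : (ℝ × ℝ) × ℝ => z.2 * σ z.1) (𝓝 (p₀, θ)) (𝓝 (θ * σ p₀)) :=
    (continuous_snd.tendsto (p₀, θ)).mul h1
  have h3 : Tendsto (fun z : (ℝ × ℝ) × ℝ => ι z.1) (𝓝 (p₀, θ)) (𝓝 (ι p₀)) :=
    (hι.comp continuous_fst).tendsto (p₀, θ)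
  exact ((hΦ.tendsto (θ * σ p₀, ι p₀)).comp (h2.prodMk_nhds h3)).eventually_lt_const (h0 θ hθ)

theorem eventually_tube (hτ : ContinuousAt τ (x, y)) (hτ0 : τ (x, y) = T) (hT : 0 < T) {ε : ℝ}
    (hε : 0 < ε) : ∀ᶠ p in 𝓝 (x, y), 0 < τ p → ∀ u ∈ Set.Icc 0 (τ p),
      Metric.infDist (flowX C H Λ u (pt p.1 p.2)) (cycleOrbit C H Λ x y T) < ε := by
  have hΦ : Continuous fun w : ℝ × (Fin 3 → ℝ) =>
      Metric.infDist (flowX C H Λ w.1 w.2) (cycleOrbit C H Λ x y T) :=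
    (Metric.continuous_infDist_pt _).comp (continuous_flowX C H Λ)
  have key := eventually_forall_lt hΦ hτ continuous_pt (ε := ε) fun θ hθ => by
    rw [hτ0, Metric.infDist_zero_of_mem]
    · exact hε
    · exact flowX_mem_cycleOrbit ⟨mul_nonneg hθ.1 hT.le, by nlinarith [hθ.2]⟩
  filter_upwards [key] with p hp hpos u hu
  have := hp (u / τ p) ⟨div_nonneg hu.1 hpos.le, div_le_one_of_le₀ hu.2 hpos.le⟩
  rwa [div_mul_cancel₀ _ hpos.ne'] at this

theorem entersUpper_pt {a b : ℝ} (ha : 0 < a) (hb : 0 < b) : EntersUpper (pt a b) :=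
  Or.inr ⟨a, b, ha, hb, rfl⟩

theorem IsHalfReturn.follow {p : ℝ × ℝ} (hp : IsHalfReturn C H Λ τ P p) {γ : ℝ → Fin 3 → ℝ}
    (hγ : IsFilippovSolution C H Λ γ) (h0 : γ 0 = pt p.1 p.2) :
    ∀ u ∈ Set.Icc 0 (τ p), γ u = flowX C H Λ u (pt p.1 p.2) := by
  rw [← h0]
  refine hγ.follow (by rw [h0]; exact entersUpper_pt hp.fst_pos hp.snd_pos) ?_
  rw [h0]
  exact hp.upper

theorem IsHalfReturn.next {p : ℝ × ℝ} (hp : IsHalfReturn C H Λ τ P p) {γ : ℝ → Fin 3 → ℝ}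
    (hγ : IsFilippovSolution C H Λ γ) (h0 : γ 0 = pt p.1 p.2) :
    IsFilippovSolution C H Λ (fun t => symm (γ (τ p + t))) ∧
      symm (γ (τ p + 0)) = pt (P p).1 (P p).2 := by
  refine ⟨(hγ.shift hp.time_pos.le).map_symm, ?_⟩
  rw [add_zero, hp.follow hγ h0 _ ⟨hp.time_pos.le, le_rfl⟩, hp.return_eq, symm_symm]

theorem infDist_lt_of_iterates {G : Set (ℝ × ℝ)} {ε θ : ℝ} (hθ : 0 < θ)
    (hG : ∀ p ∈ G, IsHalfReturn C H Λ τ P p ∧ θ ≤ τ p ∧ ∀ u ∈ Set.Icc 0 (τ p),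
      Metric.infDist (flowX C H Λ u (pt p.1 p.2)) (cycleOrbit C H Λ x y T) < ε)
    {γ : ℝ → Fin 3 → ℝ} (hγ : IsFilippovSolution C H Λ γ) {p : ℝ × ℝ}
    (h0 : γ 0 = pt p.1 p.2) (hit : ∀ n, P^[n] p ∈ G) {t : ℝ} (ht : 0 ≤ t) :
    Metric.infDist (γ t) (cycleOrbit C H Λ x y T) < ε := by
  obtain ⟨n, hn⟩ := exists_nat_gt (t / θ)
  rw [div_lt_iff₀ hθ] at hn
  induction n generalizing γ p t with
  | zero =>
    simp at hn
    linarith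
  | succ n ih =>
    obtain ⟨hp, hle, hclose⟩ := hG p (hit 0)
    rcases le_or_gt t (τ p) with h | h
    · rw [hp.follow hγ h0 t ⟨ht, h⟩]
      exact hclose t ⟨ht, h⟩
    · obtain ⟨h1, h2⟩ := hp.next hγ h0
      have := ih h1 h2 (fun m => by simpa using hit (m + 1)) (t := t - τ p) (by linarith)
        (by push_cast at hn; linarith)
      rwa [infDist_symm_cycleOrbit, add_sub_cancel] at this

theorem eventually_infDist_lt {G G' : Set (ℝ × ℝ)} {ε θ : ℝ} (hθ : 0 < θ)
    (hG : ∀ p ∈ G, IsHalfReturn C H Λ τ P p ∧ θ ≤ τ p ∧ ∀ u ∈ Set.Icc 0 (τ p),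
      Metric.infDist (flowX C H Λ u (pt p.1 p.2)) (cycleOrbit C H Λ x y T) < ε)
    (hG' : ∀ p ∈ G', IsHalfReturn C H Λ τ P p) (N : ℕ)
    {γ : ℝ → Fin 3 → ℝ} (hγ : IsFilippovSolution C H Λ γ) {p : ℝ × ℝ}
    (h0 : γ 0 = pt p.1 p.2) (hit' : ∀ n, P^[n] p ∈ G') (hit : ∀ n, N ≤ n → P^[n] p ∈ G) :
    ∃ t₀, 0 ≤ t₀ ∧ ∀ t, t₀ ≤ t → Metric.infDist (γ t) (cycleOrbit C H Λ x y T) < ε := by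
  induction N generalizing γ p with
  | zero =>
    exact ⟨0, le_rfl, fun t ht =>
      infDist_lt_of_iterates hθ hG hγ h0 (fun n => hit n (Nat.zero_le n)) ht⟩
  | succ N ih =>
    have hp := hG' p (hit' 0)
    obtain ⟨h1, h2⟩ := hp.next hγ h0
    obtain ⟨t₀, ht₀, h⟩ := ih h1 h2 (fun m => by simpa using hit' (m + 1))
      (fun m hm => by simpa using hit (m + 1) (by omega))
    refine ⟨τ p + t₀, add_nonneg hp.time_pos.le ht₀, fun t ht => ?_⟩
    have := h (t - τ p) (by linarith)
    rwa [infDist_symm_cycleOrbit, add_sub_cancel] at this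

/-- The initial points from which every Filippov solution reaches the `ε`-neighbourhood of `p₀` in
the switching plane, up to the symmetry, without leaving the `ε`-neighbourhood of the cycle. -/
def entrySet (C H Λ x y T ε : ℝ) : Set (Fin 3 → ℝ) :=
  {q | ∀ γ, IsFilippovSolution C H Λ γ → γ 0 = q → ∃ s, 0 ≤ s ∧
    (∀ u ∈ Set.Icc 0 s, Metric.infDist (γ u) (cycleOrbit C H Λ x y T) < ε) ∧
    ∃ p : ℝ × ℝ, dist p (x, y) < ε ∧ (γ s = pt p.1 p.2 ∨ γ s = symm (pt p.1 p.2))}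

theorem symm_mem_entrySet {ε : ℝ} {q : Fin 3 → ℝ} (hq : symm q ∈ entrySet C H Λ x y T ε) :
    q ∈ entrySet C H Λ x y T ε := by
  intro γ hγ h0
  obtain ⟨s, hs, h1, p, hp, h2⟩ := hq _ hγ.map_symm (by simp [h0])
  refine ⟨s, hs, fun u hu => by rw [← infDist_symm_cycleOrbit]; exact h1 u hu, p, hp, ?_⟩
  rcases h2 with h2 | h2
  · right
    rw [← h2, symm_symm]
  · left
    rw [← symm_symm (γ s), h2, symm_symm]

theorem symm_mem_nhds_entrySet {ε : ℝ} {q : Fin 3 → ℝ}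
    (hq : entrySet C H Λ x y T ε ∈ 𝓝 q) : entrySet C H Λ x y T ε ∈ 𝓝 (symm q) := by
  have hc : Tendsto symm (𝓝 (symm q)) (𝓝 q) := by
    have := continuous_symm.tendsto (symm q)
    rwa [symm_symm] at this
  filter_upwards [hc hq] with r hr
  exact symm_mem_entrySet hr

theorem mem_entrySet_of_path {ε w : ℝ} {q : Fin 3 → ℝ} (hw : 0 ≤ w) (he : EntersUpper q)
    (hpos : ∀ u ∈ Set.Ioo 0 w, 0 < flowX C H Λ u q 2)
    (hclose : ∀ u ∈ Set.Icc 0 w, Metric.infDist (flowX C H Λ u q) (cycleOrbit C H Λ x y T) < ε)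
    (hend : flowX C H Λ w q ∈ entrySet C H Λ x y T ε) : q ∈ entrySet C H Λ x y T ε := by
  intro γ hγ h0
  subst h0
  have hf := hγ.follow he hpos
  obtain ⟨s, hs, h1, p, hp, h2⟩ := hend _ (hγ.shift hw)
    (by rw [add_zero]; exact hf w ⟨hw, le_rfl⟩)
  refine ⟨w + s, add_nonneg hw hs, fun u hu => ?_, p, hp, h2⟩
  rcases le_or_gt u w with h | h
  · rw [hf u ⟨hu.1, h⟩]
    exact hclose u ⟨hu.1, h⟩
  · have := h1 (u - w) ⟨by linarith, by linarith [hu.2]⟩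
    rwa [add_sub_cancel] at this

theorem pt_self {q : Fin 3 → ℝ} (h : q 2 = 0) : q = pt (q 0) (q 1) := by
  ext i
  fin_cases i <;> simp [pt, h]

theorem dist_le_dist_pt (q : Fin 3 → ℝ) (x y : ℝ) : dist (q 0, q 1) (x, y) ≤ dist q (pt x y) := by
  rw [Prod.dist_eq]
  exact max_le (by simpa [pt] using dist_le_pi_dist q (pt x y) 0)
    (by simpa [pt] using dist_le_pi_dist q (pt x y) 1)

theorem IsSymmetricCycle.pt_mem (h : IsSymmetricCycle C H Λ x y T) :
    pt x y ∈ cycleOrbit C H Λ x y T := by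
  simpa [flowX_zero] using
    flowX_mem_cycleOrbit (C := C) (H := H) (Λ := Λ) (x := x) (y := y) ⟨le_rfl, h.T_pos.le⟩

theorem IsSymmetricCycle.eventually_mem_entrySet_below (h : IsSymmetricCycle C H Λ x y T) {ε : ℝ}
    (hε : 0 < ε) : ∀ᶠ q in 𝓝 (pt x y), q 2 ≤ 0 → q ∈ entrySet C H Λ x y T ε := by
  obtain ⟨δ, hδ, hr⟩ := exists_reach_section C H Λ h.x_pos h.y_pos hε
  filter_upwards [Metric.ball_mem_nhds _ hδ] with q hq hz γ hγ h0
  obtain ⟨s, hs, hs0, hcl⟩ := hr γ hγ (by rw [h0]; exact hq) (by rw [h0]; exact hz)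
  refine ⟨s, hs, fun u hu => (Metric.infDist_le_dist_of_mem h.pt_mem).trans_lt (hcl u hu),
    (γ s 0, γ s 1), ?_, Or.inl (pt_self hs0)⟩
  exact (dist_le_dist_pt _ _ _).trans_lt (hcl s ⟨hs, le_rfl⟩)

theorem IsSymmetricCycle.eventually_mem_entrySet_above (h : IsSymmetricCycle C H Λ x y T) {ε : ℝ}
    (hε : 0 < ε) : ∀ᶠ q in 𝓝 (symm (pt x y)), 0 ≤ q 2 → q ∈ entrySet C H Λ x y T ε := by
  have hc : Tendsto symm (𝓝 (symm (pt x y))) (𝓝 (pt x y)) := by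
    have := continuous_symm.tendsto (symm (pt x y))
    rwa [symm_symm] at this
  filter_upwards [hc.eventually (h.eventually_mem_entrySet_below hε)] with q hq hz
  exact symm_mem_entrySet (hq (by simpa [symm] using hz))

/-- Uniform closeness of `X`-trajectories to an arc of the cycle. -/
theorem eventually_flowX_near_arc {u w ε : ℝ} (hu : 0 ≤ u) (hw : u + w ≤ T) (hε : 0 < ε) :
    ∀ᶠ q in 𝓝 (flowX C H Λ u (pt x y)), ∀ s ∈ Set.Icc 0 w,
      Metric.infDist (flowX C H Λ s q) (cycleOrbit C H Λ x y T) < ε := by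
  refine isCompact_Icc.eventually_forall_of_forall_eventually fun s hs => ?_
  have hc : Continuous fun z : (Fin 3 → ℝ) × ℝ =>
      Metric.infDist (flowX C H Λ z.2 z.1) (cycleOrbit C H Λ x y T) :=
    (Metric.continuous_infDist_pt _).comp ((continuous_flowX C H Λ).comp continuous_swap)
  refine hc.continuousAt.eventually_lt_const ?_
  simp only [← flowX_add]
  rw [Metric.infDist_zero_of_mem]
  · exact hε
  · exact flowX_mem_cycleOrbit ⟨add_nonneg hu hs.1, by linarith [hs.2]⟩

theorem IsSymmetricCycle.entrySet_mem_nhds_interior (h : IsSymmetricCycle C H Λ x y T) {ε : ℝ}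
    (hε : 0 < ε) {u : ℝ} (hu : u ∈ Set.Ioo 0 T) :
    entrySet C H Λ x y T ε ∈ 𝓝 (flowX C H Λ u (pt x y)) := by
  have hab := eventually_nhds_iff.1 (h.eventually_mem_entrySet_above hε)
  obtain ⟨O, hO, hOo, hOm⟩ := hab
  have hc : Continuous fun s => flowX C H Λ s (pt x y) :=
    (continuous_flowX C H Λ).comp (continuous_id.prodMk continuous_const)
  have hT : ∀ᶠ s in 𝓝[<] T, flowX C H Λ s (pt x y) ∈ O := by
    refine nhdsWithin_le_nhds (hc.continuousAt.eventually_mem (hOo.mem_nhds ?_))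
    rw [h.upper_end]
    exact hOm
  obtain ⟨r, hrO, hr⟩ := (hT.and (Ioo_mem_nhdsLT hu.2)).exists
  have hw : 0 ≤ r - u := by linarith [hr.1]
  have e1 : ∀ᶠ q in 𝓝 (flowX C H Λ u (pt x y)), ∀ s ∈ Set.Icc 0 (r - u),
      0 < flowX C H Λ s q 2 := by
    refine isCompact_Icc.eventually_forall_of_forall_eventually fun s hs => ?_
    have hc : Continuous fun z : (Fin 3 → ℝ) × ℝ => flowX C H Λ z.2 z.1 2 :=
      (continuous_apply 2).comp ((continuous_flowX C H Λ).comp continuous_swap)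
    refine hc.continuousAt.eventually_const_lt ?_
    simp only [← flowX_add]
    exact h.upper_arc _ ⟨by linarith [hu.1, hs.1], by linarith [hs.2, hr.2]⟩
  have e2 := eventually_flowX_near_arc (C := C) (H := H) (Λ := Λ) (x := x) (y := y) (T := T)
    (u := u) (w := r - u) hu.1.le (by linarith [hr.2]) hε
  have e3 : ∀ᶠ q in 𝓝 (flowX C H Λ u (pt x y)), flowX C H Λ (r - u) q ∈ O := by
    have hc : Continuous fun q => flowX C H Λ (r - u) q :=
      (continuous_flowX C H Λ).comp (continuous_const.prodMk continuous_id)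
    refine hc.continuousAt.eventually_mem (hOo.mem_nhds ?_)
    rwa [← flowX_add, add_sub_cancel]
  filter_upwards [e1, e2, e3] with q h1 h2 h3
  have hz := h1 0 ⟨le_rfl, hw⟩
  rw [flowX_zero] at hz
  exact mem_entrySet_of_path hw (Or.inl hz) (fun s hs => h1 s ⟨hs.1.le, hs.2.le⟩) h2
    (hO _ h3 (h1 _ ⟨hw, le_rfl⟩).le)

theorem IsSymmetricCycle.entrySet_mem_nhds_pt (h : IsSymmetricCycle C H Λ x y T) {ε : ℝ}
    (hε : 0 < ε) : entrySet C H Λ x y T ε ∈ 𝓝 (pt x y) := by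
  obtain ⟨δ, hδ, η, hη, hup⟩ := exists_leave_up C H Λ h.x_pos h.y_pos
  set w := min η (T / 2)
  have hT := h.T_pos
  have hw : 0 < w := lt_min hη (half_pos hT)
  have hwT : w < T := lt_of_le_of_lt (min_le_right _ _) (half_lt_self hT)
  have e1 := h.eventually_mem_entrySet_below hε
  have e2 := eventually_flowX_near_arc (C := C) (H := H) (Λ := Λ) (x := x) (y := y) (T := T)
    (u := 0) (w := w) le_rfl (by linarith) hε
  rw [flowX_zero] at e2
  have e3 : ∀ᶠ q in 𝓝 (pt x y), flowX C H Λ w q ∈ entrySet C H Λ x y T ε := by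
    have hc : Continuous fun q => flowX C H Λ w q :=
      (continuous_flowX C H Λ).comp (continuous_const.prodMk continuous_id)
    exact hc.continuousAt.eventually_mem (h.entrySet_mem_nhds_interior hε ⟨hw, hwT⟩)
  filter_upwards [e1, e2, e3, Metric.ball_mem_nhds _ hδ] with q h1 h2 h3 h4
  rcases le_or_gt (q 2) 0 with hz | hz
  · exact h1 hz
  · intro γ hγ h0
    have hpos : ∀ u ∈ Set.Ioo 0 w, 0 < γ u 2 := fun u hu =>
      hup γ hγ (by rw [h0]; exact h4) (by rw [h0]; exact hz.le) u
        ⟨hu.1, hu.2.le.trans (min_le_left _ _)⟩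
    have hf := hγ.eq_flowX hpos
    refine mem_entrySet_of_path hw.le (Or.inl hz) (fun u hu => ?_) h2 h3 γ hγ h0
    rw [← h0, ← hf u ⟨hu.1.le, hu.2.le⟩]
    exact hpos u hu

theorem IsSymmetricCycle.entrySet_mem_nhds (h : IsSymmetricCycle C H Λ x y T) {ε : ℝ}
    (hε : 0 < ε) {q : Fin 3 → ℝ} (hq : q ∈ cycleOrbit C H Λ x y T) :
    entrySet C H Λ x y T ε ∈ 𝓝 q := by
  have hup : ∀ u ∈ Set.Icc 0 T, entrySet C H Λ x y T ε ∈ 𝓝 (flowX C H Λ u (pt x y)) := by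
    intro u hu
    rcases hu.1.eq_or_lt with h0 | h0
    · rw [← h0, flowX_zero]
      exact h.entrySet_mem_nhds_pt hε
    · rcases hu.2.eq_or_lt with h1 | h1
      · rw [h1, h.upper_end]
        exact symm_mem_nhds_entrySet (h.entrySet_mem_nhds_pt hε)
      · exact h.entrySet_mem_nhds_interior hε ⟨h0, h1⟩
  rw [cycleOrbit_eq] at hq
  rcases hq with ⟨u, hu, rfl⟩ | ⟨_, ⟨u, hu, rfl⟩, rfl⟩
  · exact hup u hu
  · exact symm_mem_nhds_entrySet (hup u hu)

theorem IsSymmetricCycle.exists_entry (h : IsSymmetricCycle C H Λ x y T) {ε : ℝ} (hε : 0 < ε) :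
    ∃ δ > 0, ∀ q, Metric.infDist q (cycleOrbit C H Λ x y T) < δ →
      q ∈ entrySet C H Λ x y T ε := by
  have hsub : cycleOrbit C H Λ x y T ⊆ interior (entrySet C H Λ x y T ε) := fun q hq =>
    mem_interior_iff_mem_nhds.2 (h.entrySet_mem_nhds hε hq)
  obtain ⟨δ, hδ, hth⟩ := isCompact_cycleOrbit.exists_thickening_subset_open isOpen_interior hsub
  refine ⟨δ, hδ, fun q hq => interior_subset (hth ?_)⟩
  rw [Metric.mem_thickening_iff]
  exact (Metric.infDist_lt_iff ⟨_, h.pt_mem⟩).1 hq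

/-- A symmetric cycle is orbitally asymptotically stable when its half-return map is
asymptotically stable at the fixed point. -/
theorem IsSymmetricCycle.isStableCycle (h : IsSymmetricCycle C H Λ x y T)
    (hret : ∀ᶠ p in 𝓝 (x, y), IsHalfReturn C H Λ τ P p) (hτ : ContinuousAt τ (x, y))
    (hτ0 : τ (x, y) = T) (hP : DiscreteAsymptoticallyStable P (x, y)) :
    IsStableCycle C H Λ x y T := by
  have hT := h.T_pos
  have hgood : ∀ ε > 0, ∃ r > 0, ∀ p ∈ Metric.ball (x, y) r, IsHalfReturn C H Λ τ P p ∧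
      T / 2 ≤ τ p ∧ ∀ u ∈ Set.Icc 0 (τ p),
        Metric.infDist (flowX C H Λ u (pt p.1 p.2)) (cycleOrbit C H Λ x y T) < ε := by
    intro ε hε
    have e2 : ∀ᶠ p in 𝓝 (x, y), T / 2 < τ p :=
      hτ.eventually_const_lt (by rw [hτ0]; exact half_lt_self hT)
    have e3 := eventually_tube (C := C) (H := H) (Λ := Λ) hτ hτ0 hT hε
    obtain ⟨r, hr, hb⟩ := Metric.eventually_nhds_iff_ball.1 (hret.and (e2.and e3))
    refine ⟨r, hr, fun p hp => ?_⟩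
    obtain ⟨h1, h2, h3⟩ := hb p hp
    exact ⟨h1, h2.le, h3 h1.time_pos⟩
  refine ⟨fun ε hε => ?_, ?_⟩
  · obtain ⟨r, hr, hG⟩ := hgood ε hε
    obtain ⟨δ, hδ, hit⟩ := hP r hr
    obtain ⟨δ', hδ', hent⟩ := h.exists_entry (lt_min hε hδ)
    refine ⟨δ', hδ', fun γ hγ hd t ht => ?_⟩
    obtain ⟨s, hs, h1, p, hp, h2⟩ := hent _ hd γ hγ rfl
    rcases le_or_gt t s with hts | hts
    · exact (h1 t ⟨ht, hts⟩).trans_le (min_le_left _ _)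
    · have hi := (hit p (hp.trans_le (min_le_right _ _))).1
      have ht' : 0 ≤ t - s := by linarith
      rcases h2 with h2 | h2
      · have := infDist_lt_of_iterates (half_pos hT) hG (hγ.shift hs) (p := p)
          (by rw [add_zero, h2]) hi ht'
        rwa [add_sub_cancel] at this
      · have := infDist_lt_of_iterates (half_pos hT) hG (hγ.shift hs).map_symm (p := p)
          (by rw [add_zero, h2, symm_symm]) hi ht'
        rwa [infDist_symm_cycleOrbit, add_sub_cancel] at this
  · obtain ⟨r', hr', hG'⟩ := hgood 1 one_pos
    obtain ⟨δ, hδ, hit⟩ := hP r' hr'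
    obtain ⟨δ', hδ', hent⟩ := h.exists_entry hδ
    refine ⟨δ', hδ', fun γ hγ hd => ?_⟩
    obtain ⟨s, hs, h1, p, hp, h2⟩ := hent _ hd γ hγ rfl
    obtain ⟨hi, hlim⟩ := hit p hp
    rw [Metric.tendsto_atTop]
    intro ε hε
    obtain ⟨r, hr, hG⟩ := hgood ε hε
    obtain ⟨N, hN⟩ := Metric.tendsto_atTop.1 hlim r hr
    have hG'' : ∀ p ∈ Metric.ball (x, y) r', IsHalfReturn C H Λ τ P p := fun p hp => (hG' p hp).1
    have key : ∃ t₀, 0 ≤ t₀ ∧ ∀ t, t₀ ≤ t →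
        Metric.infDist (γ (s + t)) (cycleOrbit C H Λ x y T) < ε := by
      rcases h2 with h2 | h2
      · exact eventually_infDist_lt (half_pos hT) hG hG'' N (hγ.shift hs) (p := p)
          (by rw [add_zero, h2]) hi hN
      · obtain ⟨t₀, ht₀, h3⟩ := eventually_infDist_lt (half_pos hT) hG hG'' N
          (hγ.shift hs).map_symm (p := p) (by rw [add_zero, h2, symm_symm]) hi hN
        exact ⟨t₀, ht₀, fun t ht => by rw [← infDist_symm_cycleOrbit]; exact h3 t ht⟩
    obtain ⟨t₀, ht₀, h3⟩ := key
    refine ⟨s + t₀, fun t ht => ?_⟩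
    have := h3 (t - s) (by linarith)
    rw [add_sub_cancel] at this
    rwa [Real.dist_eq, sub_zero, abs_of_nonneg Metric.infDist_nonneg]

end Orbit

/-! ### Asymptotic stability of a planar fixed point -/

/-- A quadratic Lyapunov function for the linearization gives asymptotic stability. -/
theorem discreteAsymptoticallyStable_of_lyapunov {P : ℝ × ℝ → ℝ × ℝ} {p₀ : ℝ × ℝ}
    {L : ℝ × ℝ →L[ℝ] ℝ × ℝ} (hfix : P p₀ = p₀) (hL : HasFDerivAt P L p₀)
    {W : ℝ × ℝ → ℝ} {c K ρ : ℝ} (hc : 0 < c) (hK : 0 < K) (hρ : 0 < ρ) (hρ1 : ρ < 1)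
    (hlow : ∀ v, c * ‖v‖ ^ 2 ≤ W v) (hup : ∀ v, W v ≤ K * ‖v‖ ^ 2)
    (hdec : ∀ v, W (L v) ≤ ρ * W v)
    (hadd : ∀ s > 0, ∀ a r, W (a + r) ≤ (1 + s) * W a + (1 + 1 / s) * W r) :
    DiscreteAsymptoticallyStable P p₀ := by
  set s := (1 - ρ) / (2 * ρ)
  have hs : 0 < s := div_pos (by linarith) (by linarith)
  have hsρ : (1 + s) * ρ = (1 + ρ) / 2 := by
    simp only [s]
    field_simp
    ring
  set A := (1 + 1 / s) * K / c
  have hA : 0 < A := by positivity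
  set e := √((1 - ρ) / (4 * A))
  have he : 0 < e := Real.sqrt_pos.2 (div_pos (by linarith) (by linarith))
  have heA : A * e ^ 2 = (1 - ρ) / 4 := by
    rw [Real.sq_sqrt (div_nonneg (by linarith) (by linarith))]
    field_simp
  set ρ' := (3 + ρ) / 4
  have hρ'0 : 0 ≤ ρ' := by simp only [ρ']; linarith
  have hρ'1 : ρ' < 1 := by simp only [ρ']; linarith
  have hW0 : ∀ v, 0 ≤ W v := fun v => le_trans (by positivity) (hlow v)
  obtain ⟨r, hr, hcontr⟩ : ∃ r > 0, ∀ p, dist p p₀ < r → W (P p - p₀) ≤ ρ' * W (p - p₀) := by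
    have := hL.isLittleO.def he
    obtain ⟨r, hr, hb⟩ := Metric.eventually_nhds_iff.1 this
    refine ⟨r, hr, fun p hp => ?_⟩
    have h1 := hb hp
    rw [hfix] at h1
    set v := p - p₀
    set w := P p - p₀ - L v
    have h2 : P p - p₀ = L v + w := by simp [w]
    have h3 : W w ≤ K * (e * ‖v‖) ^ 2 := (hup w).trans (by gcongr)
    have h4 : (1 + 1 / s) * W w ≤ (1 - ρ) / 4 * W v := by
      calc (1 + 1 / s) * W w ≤ (1 + 1 / s) * (K * (e * ‖v‖) ^ 2) := by gcongr
        _ = A * e ^ 2 * (c * ‖v‖ ^ 2) := by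
          simp only [A]
          field_simp
        _ ≤ (1 - ρ) / 4 * W v := by
          rw [heA]
          exact mul_le_mul_of_nonneg_left (hlow v) (by linarith)
    have h5 : (1 + s) * W (L v) ≤ (1 + ρ) / 2 * W v := by
      rw [← hsρ, mul_assoc]
      exact mul_le_mul_of_nonneg_left (hdec v) (by linarith)
    rw [h2]
    refine (hadd s hs _ _).trans ?_
    simp only [ρ']
    linarith
  intro ε hε
  set m := min r ε
  have hm : 0 < m := lt_min hr hε
  have hsmall : ∀ v, W v < c * m ^ 2 → ‖v‖ < m := fun v hv =>
    lt_of_pow_lt_pow_left₀ 2 hm.le (lt_of_mul_lt_mul_left ((hlow v).trans_lt hv) hc.le)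
  refine ⟨m * √(c / K), by positivity, fun p hp => ?_⟩
  have hp0 : W (p - p₀) < c * m ^ 2 := by
    refine (hup _).trans_lt ?_
    rw [dist_eq_norm] at hp
    have h1 : ‖p - p₀‖ ^ 2 < (m * √(c / K)) ^ 2 := by gcongr
    rw [mul_pow, Real.sq_sqrt (by positivity)] at h1
    calc K * ‖p - p₀‖ ^ 2 < K * (m ^ 2 * (c / K)) := by gcongr
      _ = c * m ^ 2 := by field_simp
  have hit : ∀ n, W (P^[n] p - p₀) ≤ ρ' ^ n * W (p - p₀) := by
    intro n
    induction n with
    | zero => simp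
    | succ n ih =>
      have h1 : W (P^[n] p - p₀) < c * m ^ 2 :=
        (ih.trans (mul_le_of_le_one_left (hW0 _) (pow_le_one₀ hρ'0 hρ'1.le))).trans_lt hp0
      have h2 := hcontr (P^[n] p) (by
        rw [dist_eq_norm]
        exact (hsmall _ h1).trans_le (min_le_left _ _))
      rw [Function.iterate_succ_apply', pow_succ' ρ', mul_assoc]
      exact h2.trans (mul_le_mul_of_nonneg_left ih hρ'0)
  refine ⟨fun n => ?_, ?_⟩
  · rw [dist_eq_norm]
    refine (hsmall _ ?_).trans_le (min_le_right _ _)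
    exact ((hit n).trans (mul_le_of_le_one_left (hW0 _) (pow_le_one₀ hρ'0 hρ'1.le))).trans_lt hp0
  · rw [tendsto_iff_norm_sub_tendsto_zero]
    have h1 : Tendsto (fun n => ρ' ^ n * W (p - p₀) / c) atTop (𝓝 0) := by
      have := ((tendsto_pow_atTop_nhds_zero_of_lt_one hρ'0 hρ'1).mul_const (W (p - p₀))).div_const c
      simpa using this
    have h2 : Tendsto (fun n => ‖P^[n] p - p₀‖ ^ 2) atTop (𝓝 0) := by
      refine squeeze_zero (fun n => by positivity) (fun n => ?_) h1
      rw [le_div_iff₀ hc, mul_comm]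
      exact (hlow _).trans (hit n)
    have h3 := h2.sqrt
    simpa [Real.sqrt_sq] using h3

/-- Schur–Cohn type criterion for a planar map with companion-like derivative. -/
theorem discreteAsymptoticallyStable_of_hasFDerivAt {P : ℝ × ℝ → ℝ × ℝ} {p₀ : ℝ × ℝ}
    {L : ℝ × ℝ →L[ℝ] ℝ × ℝ} {α β σ : ℝ} (hfix : P p₀ = p₀) (hL : HasFDerivAt P L p₀)
    (hLv : ∀ v, L v = (α * v.2, -β * v.1 + σ * v.2)) (hα : 0 < α) (hβ : 0 < β)
    (hδ : α * β < 1) (h1 : 0 < 1 - σ + α * β) (h2 : 0 < 1 + σ + α * β) :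
    DiscreteAsymptoticallyStable P p₀ := by
  set δ := α * β with hδdef
  have hδ0 : 0 < δ := mul_pos hα hβ
  set V : ℝ → ℝ → ℝ := fun a b =>
    (1 + δ - σ) / 2 * (a + b) ^ 2 + (1 + δ + σ) / 2 * (a - b) ^ 2 with hV
  set W : ℝ × ℝ → ℝ := fun v => V (v.1 / α) v.2 + V v.2 (-δ * (v.1 / α) + σ * v.2) with hW
  have hV0 : ∀ a b, 0 ≤ V a b := fun a b => by
    simp only [hV]
    have : 0 < 1 + δ - σ := by linarith
    have : 0 < 1 + δ + σ := by linarith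
    positivity
  set κ := min (1 + δ - σ) (1 + δ + σ)
  have hκ : 0 < κ := lt_min (by linarith) (by linarith)
  have hVlow : ∀ a b, κ * (a ^ 2 + b ^ 2) ≤ V a b := fun a b => by
    simp only [hV]
    have e1 : κ ≤ 1 + δ - σ := min_le_left _ _
    have e2 : κ ≤ 1 + δ + σ := min_le_right _ _
    nlinarith [mul_le_mul_of_nonneg_right e1 (sq_nonneg (a + b)),
      mul_le_mul_of_nonneg_right e2 (sq_nonneg (a - b))]
  have hWlow : ∀ v, κ * ((v.1 / α) ^ 2 + v.2 ^ 2) ≤ W v := fun v =>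
    (hVlow _ _).trans (le_add_of_nonneg_right (hV0 _ _))
  have hVup : ∀ a b, V a b ≤ 2 * (1 + δ) * (a ^ 2 + b ^ 2) := fun a b => by
    simp only [hV]
    nlinarith [mul_nonneg h1.le (sq_nonneg (a - b)), mul_nonneg h2.le (sq_nonneg (a + b))]
  set K₁ := 2 * (1 + δ) * (1 + 2 * (1 + δ ^ 2 + σ ^ 2))
  have hK₁ : 0 < K₁ := by positivity
  have hWup : ∀ v, W v ≤ K₁ * ((v.1 / α) ^ 2 + v.2 ^ 2) := fun v => by
    set a := v.1 / α with ha
    set b := v.2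
    have e1 : b ^ 2 + (-δ * a + σ * b) ^ 2 ≤ 2 * (1 + δ ^ 2 + σ ^ 2) * (a ^ 2 + b ^ 2) := by
      nlinarith [sq_nonneg (δ * a + σ * b), sq_nonneg a, sq_nonneg b, sq_nonneg (δ * b),
        sq_nonneg (σ * a)]
    have e2 : W v = V a b + V b (-δ * a + σ * b) := rfl
    rw [e2]
    calc V a b + V b (-δ * a + σ * b)
        ≤ 2 * (1 + δ) * (a ^ 2 + b ^ 2) + 2 * (1 + δ) * (b ^ 2 + (-δ * a + σ * b) ^ 2) :=
          add_le_add (hVup _ _) (hVup _ _)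
      _ ≤ 2 * (1 + δ) * (a ^ 2 + b ^ 2)
          + 2 * (1 + δ) * (2 * (1 + δ ^ 2 + σ ^ 2) * (a ^ 2 + b ^ 2)) := by gcongr
      _ = K₁ * (a ^ 2 + b ^ 2) := by simp only [K₁]; ring
  have hWL : ∀ v, W (L v) = W v - (1 - δ) * (((1 + δ) * (v.1 / α) - σ * v.2) ^ 2
      + (σ * δ * (v.1 / α) + (1 + δ - σ ^ 2) * v.2) ^ 2) := fun v => by
    simp only [hW, hV, hLv]
    have e1 : α * v.2 / α = v.2 := by field_simp
    have e2 : -β * v.1 = -δ * (v.1 / α) := by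
      rw [hδdef]
      field_simp
    rw [e1, e2]
    ring
  set d := (1 + δ - σ) * (1 + σ + δ)
  have hd : 0 < d := mul_pos (by linarith) (by linarith)
  set t := (1 + δ) ^ 2 + σ ^ 2 + (σ * δ) ^ 2 + (1 + δ - σ ^ 2) ^ 2
  have ht : 0 < t := by positivity
  have hQ : ∀ a b : ℝ, d ^ 2 / t * (a ^ 2 + b ^ 2) ≤
      ((1 + δ) * a - σ * b) ^ 2 + (σ * δ * a + (1 + δ - σ ^ 2) * b) ^ 2 := fun a b => by
    rw [div_mul_eq_mul_div, div_le_iff₀ ht]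
    set X := (1 + δ) * a - σ * b with hX
    set Z := σ * δ * a + (1 + δ - σ ^ 2) * b with hZ
    have ea : d * a = (1 + δ - σ ^ 2) * X + σ * Z := by simp only [d, hX, hZ]; ring
    have eb : d * b = (1 + δ) * Z - σ * δ * X := by simp only [d, hX, hZ]; ring
    have : d ^ 2 * (a ^ 2 + b ^ 2) = (d * a) ^ 2 + (d * b) ^ 2 := by ring
    rw [this, ea, eb]
    simp only [t]
    nlinarith [sq_nonneg ((1 + δ - σ ^ 2) * Z - σ * X), sq_nonneg ((1 + δ) * X + σ * δ * Z)]
  set μ := (1 - δ) * (d ^ 2 / t) / K₁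
  have hμ : 0 < μ := by
    have : 0 < 1 - δ := by linarith
    positivity
  have hdec : ∀ v, W (L v) ≤ (1 - min μ (1 / 2)) * W v := fun v => by
    have e0 : 0 ≤ W v := add_nonneg (hV0 _ _) (hV0 _ _)
    have e1 := mul_le_mul_of_nonneg_left (hQ (v.1 / α) v.2) (show 0 ≤ 1 - δ by linarith)
    have e2 : μ * W v ≤ (1 - δ) * (d ^ 2 / t * ((v.1 / α) ^ 2 + v.2 ^ 2)) := by
      calc μ * W v ≤ μ * (K₁ * ((v.1 / α) ^ 2 + v.2 ^ 2)) := by gcongr; exact hWup v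
        _ = _ := by simp only [μ]; field_simp
    have e3 : min μ (1 / 2) * W v ≤ μ * W v := by gcongr; exact min_le_left _ _
    rw [hWL]
    linarith
  have hmin : 0 < min μ (1 / 2) := lt_min hμ (by norm_num)
  have hmin2 : min μ (1 / 2) ≤ 1 / 2 := min_le_right _ _
  have hnorm : ∀ v : ℝ × ℝ, ‖v‖ ^ 2 ≤ v.1 ^ 2 + v.2 ^ 2 := fun v => by
    rw [Prod.norm_def]
    rcases max_cases ‖v.1‖ ‖v.2‖ with h | h <;> rw [h.1, Real.norm_eq_abs, sq_abs] <;>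
      linarith [sq_nonneg v.1, sq_nonneg v.2]
  have hnorm' : ∀ v : ℝ × ℝ, v.1 ^ 2 ≤ ‖v‖ ^ 2 ∧ v.2 ^ 2 ≤ ‖v‖ ^ 2 := fun v => by
    constructor
    · rw [← sq_abs]
      exact pow_le_pow_left₀ (abs_nonneg _) (norm_fst_le v) 2
    · rw [← sq_abs]
      exact pow_le_pow_left₀ (abs_nonneg _) (norm_snd_le v) 2
  refine discreteAsymptoticallyStable_of_lyapunov hfix hL (W := W)
    (c := κ * min (1 / α ^ 2) 1) (K := K₁ * (1 / α ^ 2 + 1)) (ρ := 1 - min μ (1 / 2))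
    (by positivity) (by positivity) (by linarith) (by linarith) (fun v => ?_) (fun v => ?_) hdec ?_
  · refine le_trans ?_ (hWlow v)
    rw [mul_assoc, div_pow]
    gcongr
    have e1 : min (1 / α ^ 2) 1 * v.1 ^ 2 ≤ 1 / α ^ 2 * v.1 ^ 2 := by gcongr; exact min_le_left _ _
    have e2 : min (1 / α ^ 2) 1 * v.2 ^ 2 ≤ 1 * v.2 ^ 2 := by gcongr; exact min_le_right _ _
    have e3 : min (1 / α ^ 2) 1 * ‖v‖ ^ 2 ≤ min (1 / α ^ 2) 1 * (v.1 ^ 2 + v.2 ^ 2) := by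
      gcongr
      exact hnorm v
    have e4 : 1 / α ^ 2 * v.1 ^ 2 = v.1 ^ 2 / α ^ 2 := by ring
    linarith
  · refine (hWup v).trans ?_
    rw [mul_assoc K₁ (1 / α ^ 2 + 1), div_pow]
    refine mul_le_mul_of_nonneg_left ?_ hK₁.le
    have e1 : v.1 ^ 2 / α ^ 2 ≤ ‖v‖ ^ 2 / α ^ 2 :=
      div_le_div_of_nonneg_right (hnorm' v).1 (sq_nonneg α)
    have e4 : 1 / α ^ 2 * ‖v‖ ^ 2 = ‖v‖ ^ 2 / α ^ 2 := by ring
    linarith [(hnorm' v).2]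
  · intro s hs a r
    have hsq : ∀ x y : ℝ, (x + y) ^ 2 ≤ (1 + s) * x ^ 2 + (1 + 1 / s) * y ^ 2 := fun x y => by
      have : (1 + s) * x ^ 2 + (1 + 1 / s) * y ^ 2 - (x + y) ^ 2 = (s * x - y) ^ 2 / s := by
        field_simp
        ring
      have h0 : 0 ≤ (s * x - y) ^ 2 / s := by positivity
      linarith
    have hVadd : ∀ a b x y, V (a + x) (b + y) ≤ (1 + s) * V a b + (1 + 1 / s) * V x y := by
      intro a b x y
      simp only [hV]
      have e1 := mul_le_mul_of_nonneg_left (hsq (a + b) (x + y))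
        (show 0 ≤ (1 + δ - σ) / 2 by linarith)
      have e2 := mul_le_mul_of_nonneg_left (hsq (a - b) (x - y))
        (show 0 ≤ (1 + δ + σ) / 2 by linarith)
      have e3 : a + x + (b + y) = a + b + (x + y) := by ring
      have e4 : a + x - (b + y) = a - b + (x - y) := by ring
      rw [e3, e4]
      linarith
    simp only [hW, Prod.fst_add, Prod.snd_add, add_div]
    have e1 := hVadd (a.1 / α) a.2 (r.1 / α) r.2
    have e2 := hVadd a.2 (-δ * (a.1 / α) + σ * a.2) r.2 (-δ * (r.1 / α) + σ * r.2)
    have e3 : -δ * (a.1 / α + r.1 / α) + σ * (a.2 + r.2) =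
      -δ * (a.1 / α) + σ * a.2 + (-δ * (r.1 / α) + σ * r.2) := by ring
    rw [e3]
    linarith

/-! ### The half-return map in terms of the transit time -/

/-- The slope at arrival, up to the factor `-k / sin t`, for the transit time `t`. -/
def arrival (C t : ℝ) : ℝ := Real.exp (C * t) - Real.cos t - C * Real.sin t

/-- The slope at departure, up to the factor `-k / sin t`, for the transit time `t`. -/
def departure (C t : ℝ) : ℝ := Real.exp (-(C * t)) - Real.cos t + C * Real.sin t

theorem hasDerivAt_exp_mul (C t : ℝ) :
    HasDerivAt (fun t => Real.exp (C * t)) (C * Real.exp (C * t)) t := by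
  refine ((hasDerivAt_id t).const_mul C).exp.congr_deriv ?_
  simp [mul_comm]

theorem hasDerivAt_exp_neg_mul (C t : ℝ) :
    HasDerivAt (fun t => Real.exp (-(C * t))) (-C * Real.exp (-(C * t))) t := by
  refine ((hasDerivAt_id t).const_mul C).neg.exp.congr_deriv ?_
  simp [mul_comm]

theorem hasDerivAt_arrival (C t : ℝ) :
    HasDerivAt (arrival C) (C * Real.exp (C * t) + Real.sin t - C * Real.cos t) t := by
  refine (((hasDerivAt_exp_mul C t).sub (Real.hasDerivAt_cos t)).sub
    ((Real.hasDerivAt_sin t).const_mul C)).congr_deriv ?_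
  ring

theorem hasDerivAt_departure (C t : ℝ) :
    HasDerivAt (departure C) (-C * Real.exp (-(C * t)) + Real.sin t + C * Real.cos t) t := by
  refine (((hasDerivAt_exp_neg_mul C t).sub (Real.hasDerivAt_cos t)).add
    ((Real.hasDerivAt_sin t).const_mul C)).congr_deriv ?_
  ring

theorem exp_mul_exp_neg (u : ℝ) : Real.exp u * Real.exp (-u) = 1 := by
  rw [← Real.exp_add, add_neg_cancel, Real.exp_zero]

theorem hasDerivAt_exp_mul_departure (C t : ℝ) :
    HasDerivAt (fun t => Real.exp (C * t) * departure C t)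
      ((1 + C ^ 2) * Real.exp (C * t) * Real.sin t) t := by
  refine ((hasDerivAt_exp_mul C t).mul (hasDerivAt_departure C t)).congr_deriv ?_
  simp only [departure]
  ring

theorem hasDerivAt_exp_neg_mul_arrival (C t : ℝ) :
    HasDerivAt (fun t => Real.exp (-(C * t)) * arrival C t)
      ((1 + C ^ 2) * Real.exp (-(C * t)) * Real.sin t) t := by
  refine ((hasDerivAt_exp_neg_mul C t).mul (hasDerivAt_arrival C t)).congr_deriv ?_
  simp only [arrival]
  ring

theorem departure_pos_of_le_pi {C t : ℝ} (ht : 0 < t) (ht' : t ≤ Real.pi) : 0 < departure C t := by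
  have h : StrictMonoOn (fun t => Real.exp (C * t) * departure C t) (Set.Icc 0 Real.pi) := by
    refine strictMonoOn_of_deriv_pos (convex_Icc _ _) (fun t _ =>
      (hasDerivAt_exp_mul_departure C t).continuousAt.continuousWithinAt) fun t ht => ?_
    rw [interior_Icc] at ht
    rw [(hasDerivAt_exp_mul_departure C t).deriv]
    have := Real.sin_pos_of_pos_of_lt_pi ht.1 ht.2
    positivity
  have := h ⟨le_rfl, Real.pi_pos.le⟩ ⟨ht.le, ht'⟩ ht
  simp only [mul_zero, departure, Real.exp_zero, Real.cos_zero, Real.sin_zero, neg_zero] at this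
  norm_num at this
  exact (pos_iff_pos_of_mul_pos this).1 (Real.exp_pos _)

theorem sin_neg_of_mem {t : ℝ} (ht : t ∈ Set.Ioo Real.pi (2 * Real.pi)) : Real.sin t < 0 := by
  have := Real.sin_pos_of_pos_of_lt_pi (x := t - Real.pi) (by linarith [ht.1]) (by linarith [ht.2])
  rw [Real.sin_sub_pi] at this
  linarith

theorem arrival_pos {C t : ℝ} (hC : 0 < C) (ht : 0 < t) (ht' : t < 2 * Real.pi) :
    0 < arrival C t := by
  rcases le_or_gt t Real.pi with h | h
  · have hm : StrictMonoOn (fun t => Real.exp (-(C * t)) * arrival C t) (Set.Icc 0 Real.pi) := by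
      refine strictMonoOn_of_deriv_pos (convex_Icc _ _) (fun t _ =>
        (hasDerivAt_exp_neg_mul_arrival C t).continuousAt.continuousWithinAt) fun t ht => ?_
      rw [interior_Icc] at ht
      rw [(hasDerivAt_exp_neg_mul_arrival C t).deriv]
      have := Real.sin_pos_of_pos_of_lt_pi ht.1 ht.2
      positivity
    have := hm ⟨le_rfl, Real.pi_pos.le⟩ ⟨ht.le, h⟩ ht
    simp only [mul_zero, arrival, Real.exp_zero, Real.cos_zero, Real.sin_zero, neg_zero] at this
    norm_num at this
    exact (pos_iff_pos_of_mul_pos this).1 (Real.exp_pos _)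
  · have h1 := sin_neg_of_mem ⟨h, ht'⟩
    have h2 : 1 < Real.exp (C * t) := Real.one_lt_exp_iff.2 (mul_pos hC ht)
    have h3 := Real.cos_le_one t
    have h4 := mul_neg_of_pos_of_neg hC h1
    unfold arrival
    linarith

theorem departure_two_pi {C : ℝ} (hC : 0 < C) : departure C (2 * Real.pi) < 0 := by
  have : Real.exp (-(C * (2 * Real.pi))) < 1 := by
    rw [Real.exp_lt_one_iff]
    have := mul_pos hC Real.two_pi_pos
    linarith
  simp only [departure, Real.cos_two_pi, Real.sin_two_pi]
  linarith

/-- The initial slope `y` whose transit time is `t`. -/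
def slopeOf (C k t : ℝ) : ℝ := -k * departure C t / Real.sin t

/-- The final slope (with reversed sign) after the transit time `t`. -/
def endOf (C k t : ℝ) : ℝ := -k * arrival C t / Real.sin t

theorem hasDerivAt_slopeOf (C k : ℝ) {t : ℝ} (hs : Real.sin t ≠ 0) :
    HasDerivAt (slopeOf C k) (-k * Real.exp (-(C * t)) * arrival C t / Real.sin t ^ 2) t := by
  refine (((hasDerivAt_departure C t).const_mul (-k)).div (Real.hasDerivAt_sin t) hs).congr_deriv ?_
  have h := exp_mul_exp_neg (C * t)
  have hsc := Real.sin_sq_add_cos_sq t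
  congr 1
  simp only [departure, arrival]
  linear_combination (-k) * hsc + k * h

theorem hasDerivAt_endOf (C k : ℝ) {t : ℝ} (hs : Real.sin t ≠ 0) :
    HasDerivAt (endOf C k) (-k * Real.exp (C * t) * departure C t / Real.sin t ^ 2) t := by
  refine (((hasDerivAt_arrival C t).const_mul (-k)).div (Real.hasDerivAt_sin t) hs).congr_deriv ?_
  have h := exp_mul_exp_neg (C * t)
  have hsc := Real.sin_sq_add_cos_sq t
  congr 1
  simp only [departure, arrival]
  linear_combination (-k) * hsc + k * h

theorem strictAntiOn_slopeOf {C k : ℝ} (hC : 0 < C) (hk : 0 < k) :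
    StrictAntiOn (slopeOf C k) (Set.Ioo Real.pi (2 * Real.pi)) := by
  refine strictAntiOn_of_deriv_neg (convex_Ioo _ _) (fun t ht =>
    (hasDerivAt_slopeOf C k (sin_neg_of_mem ht).ne).continuousAt.continuousWithinAt) fun t ht => ?_
  rw [interior_Ioo] at ht
  have hs := sin_neg_of_mem ht
  rw [(hasDerivAt_slopeOf C k hs.ne).deriv]
  have h1 := arrival_pos hC (Real.pi_pos.trans ht.1) ht.2
  have : 0 < Real.sin t ^ 2 := sq_pos_of_neg hs
  refine div_neg_of_neg_of_pos ?_ this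
  have : 0 < k * Real.exp (-(C * t)) * arrival C t := by positivity
  linarith

theorem strictMonoOn_slopeOf {C k : ℝ} (hC : 0 < C) (hk : k < 0) :
    StrictMonoOn (slopeOf C k) (Set.Ioo 0 Real.pi) := by
  have hsin : ∀ t ∈ Set.Ioo 0 Real.pi, 0 < Real.sin t := fun t ht =>
    Real.sin_pos_of_pos_of_lt_pi ht.1 ht.2
  refine strictMonoOn_of_deriv_pos (convex_Ioo _ _) (fun t ht =>
    (hasDerivAt_slopeOf C k (hsin t ht).ne').continuousAt.continuousWithinAt) fun t ht => ?_
  rw [interior_Ioo] at ht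
  have hs := hsin t ht
  rw [(hasDerivAt_slopeOf C k hs.ne').deriv]
  have h1 := arrival_pos hC ht.1 (by linarith [ht.2, Real.pi_pos])
  have h2 : 0 < -k := by linarith
  positivity

theorem height_pt (C k y t : ℝ) :
    height C k y 0 t = Real.exp (C * t) * (y * Real.sin t + k * departure C t) := by
  have h := exp_mul_exp_neg (C * t)
  simp only [height, departure]
  linear_combination (-k) * h

theorem height_pt_eq_zero_iff {C k y t : ℝ} :
    height C k y 0 t = 0 ↔ y * Real.sin t = -k * departure C t := by
  rw [height_pt, mul_eq_zero, or_iff_right (Real.exp_ne_zero _)]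
  constructor <;> intro h <;> linarith

theorem height_pt_pos_iff {C k y t : ℝ} :
    0 < height C k y 0 t ↔ 0 < y * Real.sin t + k * departure C t := by
  rw [height_pt]
  exact mul_pos_iff_of_pos_left (Real.exp_pos _)

theorem slope_mul_sin {C k y t : ℝ} (h : height C k y 0 t = 0) :
    slope C k y 0 t * Real.sin t = k * arrival C t := by
  have h1 := height_pt_eq_zero_iff.1 h
  have h2 := exp_mul_exp_neg (C * t)
  have hsc := Real.sin_sq_add_cos_sq t
  simp only [slope, h]
  simp only [departure] at h1
  simp only [arrival]
  linear_combination (Real.exp (C * t) * Real.cos t) * h1 + (k * Real.exp (C * t)) * hsc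
    - k * Real.cos t * h2

theorem flowX_pt_two (C H Λ x y t : ℝ) :
    flowX C H Λ t (pt x y) 2 = height C (eqHeight C Λ) y 0 t := by
  simp [flowX_eq, explicitFlow, pt]

theorem flowX_pt_one (C H Λ x y t : ℝ) :
    flowX C H Λ t (pt x y) 1 = slope C (eqHeight C Λ) y 0 t := by
  simp [flowX_eq, explicitFlow, pt]

theorem flowX_pt_zero (C H Λ x y t : ℝ) :
    flowX C H Λ t (pt x y) 0 = Real.exp (-2 * C * t) * (x - H * y)
      + H * slope C (eqHeight C Λ) y 0 t - 2 * C * H * height C (eqHeight C Λ) y 0 t := by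
  simp [flowX_eq, explicitFlow, pt]

/-- The half-return map in closed form, for the transit time `t`. -/
theorem flowX_return {C H Λ x y t : ℝ} (hs : Real.sin t ≠ 0)
    (hy : y = slopeOf C (eqHeight C Λ) t) :
    flowX C H Λ t (pt x y) = symm (pt (endOf C (eqHeight C Λ) t)
      (H * endOf C (eqHeight C Λ) t - Real.exp (-2 * C * t) * (x - H * y))) := by
  have hz : height C (eqHeight C Λ) y 0 t = 0 := by
    rw [height_pt_eq_zero_iff, hy, slopeOf]
    field_simp
  have hsl : slope C (eqHeight C Λ) y 0 t = -endOf C (eqHeight C Λ) t := by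
    have := slope_mul_sin hz
    rw [endOf]
    field_simp
    linarith
  ext i
  fin_cases i
  · change flowX C H Λ t (pt x y) 0 = _
    rw [flowX_pt_zero, hz, hsl]
    simp [symm, pt]
    ring
  · change flowX C H Λ t (pt x y) 1 = _
    rw [flowX_pt_one, hsl]
    simp [symm, pt]
  · change flowX C H Λ t (pt x y) 2 = _
    rw [flowX_pt_two, hz]
    simp [symm, pt]

theorem eqHeight_pos {C Λ : ℝ} (hΛ : 0 < Λ) : 0 < eqHeight C Λ := by
  unfold eqHeight
  positivity

theorem eqHeight_neg {C Λ : ℝ} (hΛ : Λ < 0) : eqHeight C Λ < 0 :=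
  div_neg_of_neg_of_pos hΛ (by positivity)

/-- The arc stays in `z > 0` up to the transit time. -/
theorem height_pos_of_lt {C k t u : ℝ} (hC : 0 < C) (hk : 0 < k)
    (ht : t ∈ Set.Ioo Real.pi (2 * Real.pi)) (hy : 0 < slopeOf C k t) (hu : u ∈ Set.Ioo 0 t) :
    0 < height C k (slopeOf C k t) 0 u := by
  rw [height_pt_pos_iff]
  rcases le_or_gt u Real.pi with h | h
  · have h1 := departure_pos_of_le_pi (C := C) hu.1 h
    have h2 := Real.sin_nonneg_of_nonneg_of_le_pi hu.1.le h
    positivity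
  · have hu' : u ∈ Set.Ioo Real.pi (2 * Real.pi) := ⟨h, hu.2.trans ht.2⟩
    have h1 := strictAntiOn_slopeOf hC hk hu' ht hu.2
    have hs := sin_neg_of_mem hu'
    have h2 : slopeOf C k u * Real.sin u = -k * departure C u := by
      rw [slopeOf]
      field_simp [hs.ne]
    nlinarith

/-- The equations satisfied by a symmetric cycle. -/
theorem IsSymmetricCycle.equations {C H Λ x y T : ℝ} (h : IsSymmetricCycle C H Λ x y T) :
    height C (eqHeight C Λ) y 0 T = 0 ∧ slope C (eqHeight C Λ) y 0 T = -x ∧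
      H * x - y = Real.exp (-2 * C * T) * (x - H * y) := by
  have h0 := congrFun h.upper_end 0
  have h1 := congrFun h.upper_end 1
  have h2 := congrFun h.upper_end 2
  rw [flowX_pt_two] at h2
  rw [flowX_pt_one] at h1
  rw [flowX_pt_zero] at h0
  simp [symm, pt] at h0 h1 h2
  refine ⟨h2, h1, ?_⟩
  rw [h1, h2] at h0
  simp only [neg_mul]
  linarith

theorem IsSymmetricCycle.height_pos {C H Λ x y T : ℝ} (h : IsSymmetricCycle C H Λ x y T) {s : ℝ}
    (hs : s ∈ Set.Ioo 0 T) : 0 < height C (eqHeight C Λ) y 0 s := by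
  rw [← flowX_pt_two C H Λ x]
  exact h.upper_arc s hs

theorem IsSymmetricCycle.time_mem_of_pos {C H Λ x y T : ℝ} (h : IsSymmetricCycle C H Λ x y T)
    (hC : 0 < C) (hΛ : 0 < Λ) : T ∈ Set.Ioo Real.pi (2 * Real.pi) := by
  have hk := eqHeight_pos (C := C) hΛ
  have hy := h.y_pos
  have h0 := h.equations.1
  constructor
  · by_contra! hle
    have h1 := departure_pos_of_le_pi (C := C) h.T_pos hle
    have h2 := Real.sin_nonneg_of_nonneg_of_le_pi h.T_pos.le hle
    have : 0 < height C (eqHeight C Λ) y 0 T := by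
      rw [height_pt_pos_iff]
      positivity
    linarith
  · have h2 : height C (eqHeight C Λ) y 0 (2 * Real.pi) < 0 := by
      rw [height_pt, Real.sin_two_pi, mul_zero, zero_add]
      exact mul_neg_of_pos_of_neg (Real.exp_pos _)
        (mul_neg_of_pos_of_neg hk (departure_two_pi hC))
    by_contra! hle
    rcases hle.eq_or_lt with he | hl
    · rw [he] at h2
      linarith
    · have := h.height_pos ⟨Real.two_pi_pos, hl⟩
      linarith

theorem IsSymmetricCycle.time_mem_of_neg {C H Λ x y T : ℝ} (h : IsSymmetricCycle C H Λ x y T)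
    (hΛ : Λ < 0) : T ∈ Set.Ioo 0 Real.pi := by
  refine ⟨h.T_pos, ?_⟩
  have hk := eqHeight_neg (C := C) hΛ
  have h2 : height C (eqHeight C Λ) y 0 Real.pi < 0 := by
    rw [height_pt, Real.sin_pi, mul_zero, zero_add]
    exact mul_neg_of_pos_of_neg (Real.exp_pos _)
      (mul_neg_of_neg_of_pos hk (departure_pos_of_le_pi Real.pi_pos le_rfl))
  by_contra! hle
  rcases hle.eq_or_lt with he | hl
  · have := h.equations.1
    rw [← he] at this
    linarith
  · have := h.height_pos ⟨Real.pi_pos, hl⟩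
    linarith

theorem IsSymmetricCycle.slopeOf_eq {C H Λ x y T : ℝ} (h : IsSymmetricCycle C H Λ x y T)
    (hs : Real.sin T ≠ 0) : y = slopeOf C (eqHeight C Λ) T ∧ x = endOf C (eqHeight C Λ) T := by
  obtain ⟨h0, h1, -⟩ := h.equations
  have h2 := height_pt_eq_zero_iff.1 h0
  have h3 := slope_mul_sin h0
  rw [h1] at h3
  constructor
  · rw [slopeOf]
    field_simp
    linarith
  · rw [endOf]
    field_simp
    linarith

/-! ### The parameter `H` of the cycle with a given half-period -/

def cycleNum (C t : ℝ) : ℝ := Real.exp (C * t) * departure C t + Real.exp (-(C * t)) * arrival C t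

def cycleDen (C t : ℝ) : ℝ := Real.exp (C * t) * arrival C t + Real.exp (-(C * t)) * departure C t

/-- The value of `H` for which the symmetric cycle has half-period `t`. -/
def cycleH (C t : ℝ) : ℝ := cycleNum C t / cycleDen C t

theorem cycleH_of_fixed {C H t : ℝ} (hd : cycleDen C t ≠ 0)
    (h : H * arrival C t - departure C t =
      Real.exp (-2 * C * t) * (arrival C t - H * departure C t)) : H = cycleH C t := by
  have h1 := exp_mul_exp_neg (C * t)
  have h2 : Real.exp (-2 * C * t) = Real.exp (-(C * t)) * Real.exp (-(C * t)) := by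
    rw [← Real.exp_add]
    ring_nf
  rw [h2] at h
  rw [cycleH, eq_div_iff hd, cycleDen, cycleNum]
  linear_combination Real.exp (C * t) * h
    + (Real.exp (-(C * t)) * (arrival C t - H * departure C t)) * h1

theorem fixed_of_cycleH {C t : ℝ} (hd : cycleDen C t ≠ 0) :
    cycleH C t * arrival C t - departure C t =
      Real.exp (-2 * C * t) * (arrival C t - cycleH C t * departure C t) := by
  have h1 := exp_mul_exp_neg (C * t)
  have h2 : Real.exp (-2 * C * t) = Real.exp (-(C * t)) * Real.exp (-(C * t)) := by
    rw [← Real.exp_add]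
    ring_nf
  have h3 : cycleH C t * cycleDen C t = cycleNum C t := div_mul_cancel₀ _ hd
  simp only [cycleDen, cycleNum] at h3
  rw [h2]
  linear_combination Real.exp (-(C * t)) * h3
    - (cycleH C t * arrival C t - departure C t) * h1

theorem hasDerivAt_cycleNum (C t : ℝ) :
    HasDerivAt (cycleNum C)
      ((1 + C ^ 2) * (Real.exp (C * t) + Real.exp (-(C * t))) * Real.sin t) t := by
  refine ((hasDerivAt_exp_mul_departure C t).add
    (hasDerivAt_exp_neg_mul_arrival C t)).congr_deriv ?_
  ring

/-- The difference of denominator and numerator of `cycleH`. -/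
def cycleGap (C t : ℝ) : ℝ :=
  (Real.exp (C * t) - Real.exp (-(C * t))) * (arrival C t - departure C t)

theorem cycleDen_eq (C t : ℝ) : cycleDen C t = cycleNum C t + cycleGap C t := by
  simp only [cycleDen, cycleNum, cycleGap]
  ring

theorem hasDerivAt_arrival_sub_departure (C t : ℝ) :
    HasDerivAt (fun t => arrival C t - departure C t)
      (C * (Real.exp (C * t) + Real.exp (-(C * t)) - 2 * Real.cos t)) t := by
  refine ((hasDerivAt_arrival C t).sub (hasDerivAt_departure C t)).congr_deriv ?_
  ring

theorem hasDerivAt_cycleGap (C t : ℝ) :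
    HasDerivAt (cycleGap C)
      (C * (Real.exp (C * t) + Real.exp (-(C * t))) * (arrival C t - departure C t)
        + (Real.exp (C * t) - Real.exp (-(C * t)))
          * (C * (Real.exp (C * t) + Real.exp (-(C * t)) - 2 * Real.cos t))) t := by
  refine (((hasDerivAt_exp_mul C t).sub (hasDerivAt_exp_neg_mul C t)).mul
    (hasDerivAt_arrival_sub_departure C t)).congr_deriv ?_
  simp only [Pi.sub_apply]
  ring

theorem exp_add_exp_neg_ge (C t : ℝ) (hC : 0 < C) (ht : 0 < t) :
    2 * Real.cos t < Real.exp (C * t) + Real.exp (-(C * t)) := by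
  have h1 := Real.cos_le_one t
  have h2 : 1 < Real.exp (C * t) := Real.one_lt_exp_iff.2 (mul_pos hC ht)
  have h3 := exp_mul_exp_neg (C * t)
  nlinarith [Real.exp_pos (-(C * t))]

theorem exp_sub_exp_neg_pos {C t : ℝ} (hC : 0 < C) (ht : 0 < t) :
    0 < Real.exp (C * t) - Real.exp (-(C * t)) := by
  have : Real.exp (-(C * t)) < Real.exp (C * t) := Real.exp_lt_exp.2 (by
    have := mul_pos hC ht
    linarith)
  linarith

theorem departure_lt_arrival {C t : ℝ} (hC : 0 < C) (ht : 0 < t) :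
    departure C t < arrival C t := by
  have h : StrictMonoOn (fun t => arrival C t - departure C t) (Set.Ici 0) := by
    refine strictMonoOn_of_deriv_pos (convex_Ici _) (fun t _ =>
      (hasDerivAt_arrival_sub_departure C t).continuousAt.continuousWithinAt) fun t ht => ?_
    rw [interior_Ici] at ht
    rw [(hasDerivAt_arrival_sub_departure C t).deriv]
    have := exp_add_exp_neg_ge C t hC ht
    exact mul_pos hC (by linarith)
  have := h Set.self_mem_Ici ht.le ht
  simp [arrival, departure] at this
  simp only [arrival, departure]
  linarith

theorem cycleGap_pos {C t : ℝ} (hC : 0 < C) (ht : 0 < t) : 0 < cycleGap C t :=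
  mul_pos (exp_sub_exp_neg_pos hC ht) (sub_pos.2 (departure_lt_arrival hC ht))

theorem deriv_cycleGap_pos {C t : ℝ} (hC : 0 < C) (ht : 0 < t) :
    0 < C * (Real.exp (C * t) + Real.exp (-(C * t))) * (arrival C t - departure C t)
        + (Real.exp (C * t) - Real.exp (-(C * t)))
          * (C * (Real.exp (C * t) + Real.exp (-(C * t)) - 2 * Real.cos t)) := by
  have h1 := departure_lt_arrival hC ht
  have h2 := exp_add_exp_neg_ge C t hC ht
  have h3 := exp_sub_exp_neg_pos hC ht
  have h4 : 0 < arrival C t - departure C t := by linarith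
  have h5 : 0 < Real.exp (C * t) + Real.exp (-(C * t)) - 2 * Real.cos t := by linarith
  positivity

theorem strictMonoOn_cycleGap {C : ℝ} (hC : 0 < C) :
    StrictMonoOn (cycleGap C) (Set.Ici Real.pi) := by
  refine strictMonoOn_of_deriv_pos (convex_Ici _) (fun t _ =>
    (hasDerivAt_cycleGap C t).continuousAt.continuousWithinAt) fun t ht => ?_
  rw [interior_Ici] at ht
  rw [(hasDerivAt_cycleGap C t).deriv]
  exact deriv_cycleGap_pos hC (Real.pi_pos.trans ht)

theorem strictAntiOn_cycleNum (C : ℝ) :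
    StrictAntiOn (cycleNum C) (Set.Icc Real.pi (2 * Real.pi)) := by
  refine strictAntiOn_of_deriv_neg (convex_Icc _ _) (fun t _ =>
    (hasDerivAt_cycleNum C t).continuousAt.continuousWithinAt) fun t ht => ?_
  rw [interior_Icc] at ht
  rw [(hasDerivAt_cycleNum C t).deriv]
  exact mul_neg_of_pos_of_neg (by positivity) (sin_neg_of_mem ht)

theorem cycleNum_pos {C t : ℝ} (hC : 0 < C) (ht : 0 < t) (ht' : t < 2 * Real.pi)
    (hd : 0 < departure C t) : 0 < cycleNum C t := by
  have := arrival_pos hC ht ht'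
  unfold cycleNum
  positivity

theorem cycleDen_pos {C t : ℝ} (hC : 0 < C) (ht : 0 < t) (ht' : t < 2 * Real.pi)
    (hd : 0 < departure C t) : 0 < cycleDen C t := by
  have := arrival_pos hC ht ht'
  unfold cycleDen
  positivity

theorem cycleH_mem {C t : ℝ} (hC : 0 < C) (ht : 0 < t) (ht' : t < 2 * Real.pi)
    (hd : 0 < departure C t) : (C, cycleH C t) ∈ paramRegion := by
  have h1 := cycleNum_pos hC ht ht' hd
  have h2 := cycleDen_pos hC ht ht' hd
  refine ⟨hC, div_pos h1 h2, ?_⟩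
  show cycleH C t < 1
  rw [cycleH, div_lt_one h2, cycleDen_eq]
  linarith [cycleGap_pos hC ht]

theorem cycleH_lt {C s t : ℝ} (hC : 0 < C) (hs : Real.pi ≤ s) (hst : s < t)
    (ht : t < 2 * Real.pi) (hd : 0 < departure C t) : cycleH C t < cycleH C s := by
  have ht0 : 0 < t := by linarith [Real.pi_pos]
  have hs0 : 0 < s := by linarith [Real.pi_pos]
  have h1 := cycleNum_pos hC ht0 ht hd
  have h2 := strictAntiOn_cycleNum C ⟨hs, by linarith⟩ ⟨by linarith, ht.le⟩ hst
  have h3 := strictMonoOn_cycleGap hC (Set.mem_Ici.2 hs) (Set.mem_Ici.2 (hs.trans hst.le)) hst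
  have h4 := cycleGap_pos hC hs0
  rw [cycleH, cycleH, cycleDen_eq, cycleDen_eq, div_lt_div_iff₀ (by linarith) (by linarith)]
  nlinarith

theorem cycleH_pi (C : ℝ) (hC : 0 < C) : cycleH C Real.pi = Hcrit C := by
  have h := exp_mul_exp_neg (C * Real.pi)
  have hch : 2 * Real.cosh (Real.pi * C) =
      Real.exp (C * Real.pi) + Real.exp (-(C * Real.pi)) := by
    rw [Real.cosh_eq, mul_comm Real.pi C]
    ring
  have hgt := exp_add_exp_neg_ge C Real.pi hC Real.pi_pos
  have ha := Real.exp_pos (C * Real.pi)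
  have hb := Real.exp_pos (-(C * Real.pi))
  rw [cycleH, Hcrit, hch]
  have hnum : cycleNum C Real.pi = 2 + (Real.exp (C * Real.pi) + Real.exp (-(C * Real.pi))) := by
    simp only [cycleNum, departure, arrival, Real.cos_pi, Real.sin_pi]
    linear_combination 2 * h
  have hden : cycleDen C Real.pi = (2 + (Real.exp (C * Real.pi) + Real.exp (-(C * Real.pi))))
      * (Real.exp (C * Real.pi) + Real.exp (-(C * Real.pi)) - 1) := by
    simp only [cycleDen, departure, arrival, Real.cos_pi, Real.sin_pi]
    linear_combination -2 * h
  have hne : Real.exp (C * Real.pi) + Real.exp (-(C * Real.pi)) - 1 ≠ 0 := by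
    have h2 : 1 < Real.exp (C * Real.pi) := Real.one_lt_exp_iff.2 (mul_pos hC Real.pi_pos)
    linarith
  rw [hnum, hden, div_mul_eq_div_div, div_self (by positivity)]

theorem IsSymmetricCycle.eq_cycleH {C H Λ x y T : ℝ} (h : IsSymmetricCycle C H Λ x y T)
    (hΛ : Λ ≠ 0) (hs : Real.sin T ≠ 0) (hd : cycleDen C T ≠ 0) : H = cycleH C T := by
  obtain ⟨hy, hx⟩ := h.slopeOf_eq hs
  have h3 := h.equations.2.2
  have hk : eqHeight C Λ ≠ 0 := div_ne_zero hΛ (by positivity)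
  have hx' : arrival C T = x * (-Real.sin T / eqHeight C Λ) := by
    rw [hx, endOf]
    field_simp
  have hy' : departure C T = y * (-Real.sin T / eqHeight C Λ) := by
    rw [hy, slopeOf]
    field_simp
  refine cycleH_of_fixed hd ?_
  rw [hx', hy']
  linear_combination (-Real.sin T / eqHeight C Λ) * h3

/-! ### The symmetric cycles for `Λ > 0` and their stability -/

theorem slopeOf_pos_iff {C k t : ℝ} (hk : 0 < k) (ht : t ∈ Set.Ioo Real.pi (2 * Real.pi)) :
    0 < slopeOf C k t ↔ 0 < departure C t := by
  have hs := sin_neg_of_mem ht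
  have : slopeOf C k t = departure C t * (-k / Real.sin t) := by
    rw [slopeOf]
    ring
  rw [this]
  exact mul_pos_iff_of_pos_right (div_pos_of_neg_of_neg (by linarith) hs)

theorem endOf_pos {C k t : ℝ} (hC : 0 < C) (hk : 0 < k)
    (ht : t ∈ Set.Ioo Real.pi (2 * Real.pi)) : 0 < endOf C k t := by
  have hs := sin_neg_of_mem ht
  have := arrival_pos hC (Real.pi_pos.trans ht.1) ht.2
  exact div_pos_of_neg_of_neg (by nlinarith) hs

/-- The symmetric cycle with half-period `t`. -/
theorem isSymmetricCycle_of_time {C Λ t : ℝ} (hC : 0 < C) (hΛ : 0 < Λ)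
    (ht : t ∈ Set.Ioo Real.pi (2 * Real.pi)) (hd : 0 < departure C t) :
    IsSymmetricCycle C (cycleH C t) Λ (endOf C (eqHeight C Λ) t) (slopeOf C (eqHeight C Λ) t) t := by
  have hk := eqHeight_pos (C := C) hΛ
  have ht0 := Real.pi_pos.trans ht.1
  have hs := sin_neg_of_mem ht
  have hy := (slopeOf_pos_iff hk ht).2 hd
  have hx := endOf_pos hC hk ht
  have hden := cycleDen_pos hC ht0 ht.2 hd
  have hend : flowX C (cycleH C t) Λ t (pt (endOf C (eqHeight C Λ) t) (slopeOf C (eqHeight C Λ) t))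
      = symm (pt (endOf C (eqHeight C Λ) t) (slopeOf C (eqHeight C Λ) t)) := by
    rw [flowX_return hs.ne rfl]
    congr 2
    have h := fixed_of_cycleH hden.ne'
    have hx' : endOf C (eqHeight C Λ) t = arrival C t * (-eqHeight C Λ / Real.sin t) := by
      rw [endOf]
      ring
    have hy' : slopeOf C (eqHeight C Λ) t = departure C t * (-eqHeight C Λ / Real.sin t) := by
      rw [slopeOf]
      ring
    rw [hx', hy']
    linear_combination (-eqHeight C Λ / Real.sin t) * h
  have hup : ∀ s ∈ Set.Ioo 0 t, 0 < flowX C (cycleH C t) Λ s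
      (pt (endOf C (eqHeight C Λ) t) (slopeOf C (eqHeight C Λ) t)) 2 := fun s hs => by
    rw [flowX_pt_two]
    exact height_pos_of_lt hC hk ht hy hs
  refine ⟨ht0, ?_, ?_, hup, hend, fun s hs => ?_, ?_⟩
  · simpa [X, upperField, pt] using hy
  · simpa [Y, lowerField, pt] using hx
  · rw [flowY_symm]
    have := hup s hs
    simpa [symm] using this
  · rw [flowY_symm, hend, symm_symm]

theorem contDiff_departure (C : ℝ) : ContDiff ℝ 1 (departure C) := by
  unfold departure
  fun_prop

theorem hasStrictDerivAt_slopeOf (C k : ℝ) {t : ℝ} (hs : Real.sin t ≠ 0) :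
    HasStrictDerivAt (slopeOf C k) (-k * Real.exp (-(C * t)) * arrival C t / Real.sin t ^ 2) t := by
  have h : ContDiffAt ℝ 1 (slopeOf C k) t :=
    (contDiffAt_const.mul (contDiff_departure C).contDiffAt).div
      Real.contDiff_sin.contDiffAt hs
  exact h.hasStrictDerivAt' (hasDerivAt_slopeOf C k hs) one_ne_zero

/-- The half-return map, in terms of a half-return time `θ` depending on `y`. -/
def halfMap (C H k : ℝ) (θ : ℝ → ℝ) (p : ℝ × ℝ) : ℝ × ℝ :=
  (endOf C k (θ p.2), H * endOf C k (θ p.2) - Real.exp (-2 * C * θ p.2) * (p.1 - H * p.2))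

theorem hasFDerivAt_halfMap {C H k t a b : ℝ} {θ : ℝ → ℝ} {x y : ℝ} (hθ : HasDerivAt θ b y)
    (hθy : θ y = t) (he : HasDerivAt (endOf C k) a t) :
    ∃ L : ℝ × ℝ →L[ℝ] ℝ × ℝ, HasFDerivAt (halfMap C H k θ) L (x, y) ∧
      ∀ v, L v = (a * b * v.2, -Real.exp (-2 * C * t) * v.1
        + (H * (a * b) + H * Real.exp (-2 * C * t)
          + 2 * C * b * Real.exp (-2 * C * t) * (x - H * y)) * v.2) := by
  subst hθy
  have h1 : HasFDerivAt (fun p : ℝ × ℝ => endOf C k (θ p.2))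
      ((a * b) • ContinuousLinearMap.snd ℝ ℝ ℝ) (x, y) :=
    HasDerivAt.comp_hasFDerivAt (x, y) (f := fun p : ℝ × ℝ => p.2)
      (h₂ := fun s => endOf C k (θ s)) (he.comp y hθ) hasFDerivAt_snd
  have h2 : HasDerivAt (fun s => Real.exp (-2 * C * θ s))
      (Real.exp (-2 * C * θ y) * (-2 * C * b)) y := (hθ.const_mul (-2 * C)).exp
  have h3 : HasFDerivAt (fun p : ℝ × ℝ => Real.exp (-2 * C * θ p.2))
      ((Real.exp (-2 * C * θ y) * (-2 * C * b)) • ContinuousLinearMap.snd ℝ ℝ ℝ) (x, y) :=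
    HasDerivAt.comp_hasFDerivAt (x, y) (f := fun p : ℝ × ℝ => p.2)
      (h₂ := fun s => Real.exp (-2 * C * θ s)) h2 hasFDerivAt_snd
  have h4 : HasFDerivAt (fun p : ℝ × ℝ => p.1 - H * p.2)
      (ContinuousLinearMap.fst ℝ ℝ ℝ - H • ContinuousLinearMap.snd ℝ ℝ ℝ) (x, y) :=
    hasFDerivAt_fst.sub (hasFDerivAt_snd.const_mul H)
  refine ⟨_, h1.prodMk ((h1.const_mul H).sub (h3.mul h4)), fun v => ?_⟩
  ext
  · simp
  · simp
    ring

theorem eventually_isHalfReturn {C H Λ t x : ℝ} (hC : 0 < C) (hΛ : 0 < Λ)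
    (ht : t ∈ Set.Ioo Real.pi (2 * Real.pi)) (hd : 0 < departure C t) (hx : 0 < x) {θ : ℝ → ℝ}
    (hθ : ContinuousAt θ (slopeOf C (eqHeight C Λ) t))
    (hθt : θ (slopeOf C (eqHeight C Λ) t) = t)
    (hinv : ∀ᶠ y in 𝓝 (slopeOf C (eqHeight C Λ) t), slopeOf C (eqHeight C Λ) (θ y) = y) :
    ∀ᶠ p in 𝓝 (x, slopeOf C (eqHeight C Λ) t),
      IsHalfReturn C H Λ (fun p => θ p.2) (halfMap C H (eqHeight C Λ) θ) p := by
  have hk := eqHeight_pos (C := C) hΛ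
  have hy := (slopeOf_pos_iff hk ht).2 hd
  have e1 : ∀ᶠ y in 𝓝 (slopeOf C (eqHeight C Λ) t), θ y ∈ Set.Ioo Real.pi (2 * Real.pi) :=
    hθ.eventually_mem (by rw [hθt]; exact Ioo_mem_nhds ht.1 ht.2)
  have e2 : ∀ᶠ y in 𝓝 (slopeOf C (eqHeight C Λ) t), 0 < y := eventually_gt_nhds hy
  have e3 : ∀ᶠ x' in 𝓝 x, 0 < x' := eventually_gt_nhds hx
  rw [nhds_prod_eq]
  filter_upwards [e3.prod_mk (hinv.and (e1.and e2))] with p hp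
  obtain ⟨hp1, hp2, hp3, hp4⟩ := hp
  refine ⟨hp1, hp4, Real.pi_pos.trans hp3.1, fun u hu => ?_, ?_⟩
  · rw [flowX_pt_two]
    have := height_pos_of_lt hC hk hp3 (by rw [hp2]; exact hp4) hu
    rwa [hp2] at this
  · exact flowX_return (sin_neg_of_mem hp3).ne hp2.symm

theorem two_mul_exp_neg_lt {C t : ℝ} (hC : 0 < C) (ht : Real.pi < t) :
    2 * C * Real.exp (-(C * t)) < 1 := by
  have h1 := Real.add_one_le_exp (C * t)
  have h2 := exp_mul_exp_neg (C * t)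
  have h3 := Real.pi_gt_three
  have h4 : 2 * C < Real.exp (C * t) := by nlinarith
  calc 2 * C * Real.exp (-(C * t)) < Real.exp (C * t) * Real.exp (-(C * t)) := by
        gcongr
    _ = 1 := h2

/-- The Schur–Cohn conditions for the half-return map at a symmetric cycle with `Λ > 0`. -/
theorem halfMap_schurCohn {C t H σ : ℝ} (hC : 0 < C) (ht : t ∈ Set.Ioo Real.pi (2 * Real.pi))
    (hd : 0 < departure C t) (hH : H = cycleH C t)
    (hσ : σ * arrival C t = H * (Real.exp (C * t) ^ 2 * departure C t)
      + H * Real.exp (-(C * t)) ^ 2 * arrival C t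
      + 2 * C * Real.exp (-(C * t)) * Real.sin t * (arrival C t - H * departure C t)) :
    0 < arrival C t * (1 - σ) + departure C t ∧ 0 < arrival C t * (1 + σ) + departure C t := by
  have ht0 := Real.pi_pos.trans ht.1
  have hs := sin_neg_of_mem ht
  have hA := arrival_pos hC ht0 ht.2
  have hAD := departure_lt_arrival hC ht0
  have hden := cycleDen_pos hC ht0 ht.2 hd
  obtain ⟨-, hH0, hH1⟩ := cycleH_mem hC ht0 ht.2 hd
  simp only at hH0 hH1
  rw [← hH] at hH0 hH1
  have hHd : H * cycleDen C t = cycleNum C t := by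
    rw [hH]
    exact div_mul_cancel₀ _ hden.ne'
  have hab := exp_mul_exp_neg (C * t)
  have ha1 : 1 < Real.exp (C * t) := Real.one_lt_exp_iff.2 (mul_pos hC ht0)
  have hb0 := Real.exp_pos (-(C * t))
  have hCb := two_mul_exp_neg_lt hC ht.1
  have hcosm := Real.neg_one_le_cos t
  have hsm := Real.neg_one_le_sin t
  have hX : arrival C t = Real.exp (C * t) - Real.cos t - C * Real.sin t := rfl
  have hY : departure C t = Real.exp (-(C * t)) - Real.cos t + C * Real.sin t := rfl
  have hN : cycleNum C t = Real.exp (C * t) * departure C t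
    + Real.exp (-(C * t)) * arrival C t := rfl
  have hD : cycleDen C t = Real.exp (C * t) * arrival C t
    + Real.exp (-(C * t)) * departure C t := rfl
  set a := Real.exp (C * t)
  set b := Real.exp (-(C * t))
  set A := arrival C t
  set B := departure C t
  set s := Real.sin t
  have hA' : a * B < A := by
    have : A - a * B = (a - 1) * (1 + Real.cos t) + C * (a + 1) * (-s) := by
      rw [hX, hY]
      linear_combination -hab
    have h1 : 0 ≤ (a - 1) * (1 + Real.cos t) := mul_nonneg (by linarith) (by linarith)
    have h2 : 0 < C * (a + 1) * (-s) := by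
      have : 0 < -s := by linarith
      positivity
    linarith
  constructor
  · have key : cycleDen C t * (A * (1 - σ) + B) =
        (a - b ^ 3) * (A ^ 2 - (a * B) ^ 2) + 2 * C * (-s) * (A ^ 2 - B ^ 2) := by
      have e : cycleDen C t * (A * (1 - σ) + B) = cycleDen C t * (A + B)
          - cycleNum C t * (a ^ 2 * B + b ^ 2 * A - 2 * C * b * s * B)
          - cycleDen C t * (2 * C * b * s * A) := by
        linear_combination (-cycleDen C t) * hσ
          - (a ^ 2 * B + b ^ 2 * A - 2 * C * b * s * B) * hHd
      rw [e, hD, hN]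
      linear_combination (-b * A * B - a * A * B - 2 * A ^ 2 * C * s + 2 * B ^ 2 * C * s
        - b * B ^ 2 * (a * b + 1)) * hab
    have hb1 : b < 1 := by nlinarith
    have h1 : 0 < a - b ^ 3 := by
      have := pow_lt_one₀ hb0.le hb1 three_ne_zero
      linarith
    have h2 : 0 < A ^ 2 - (a * B) ^ 2 :=
      sub_pos.2 (pow_lt_pow_left₀ hA' (by positivity) two_ne_zero)
    have h3 : 0 < A ^ 2 - B ^ 2 := sub_pos.2 (pow_lt_pow_left₀ hAD hd.le two_ne_zero)
    have h4 : 0 < -s := by linarith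
    have h5 : 0 < cycleDen C t * (A * (1 - σ) + B) := by
      rw [key]
      positivity
    exact (pos_iff_pos_of_mul_pos h5).1 hden
  · have h1 : 0 < A - H * B := by nlinarith
    have h2 : A - H * B < A := by nlinarith
    have h3 : 2 * C * b * (-s) * (A - H * B) ≤ A - H * B := by
      have : 2 * C * b * (-s) ≤ 1 := by
        have : 0 < 2 * C * b := by positivity
        nlinarith
      nlinarith
    have h4 : 0 < H * (a ^ 2 * B) + H * b ^ 2 * A := by
      have : 0 < a := by linarith
      positivity
    linarith

theorem isStableCycle_of_time {C Λ t : ℝ} (hC : 0 < C) (hΛ : 0 < Λ)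
    (ht : t ∈ Set.Ioo Real.pi (2 * Real.pi)) (hd : 0 < departure C t) :
    IsStableCycle C (cycleH C t) Λ (endOf C (eqHeight C Λ) t) (slopeOf C (eqHeight C Λ) t) t := by
  have hk := eqHeight_pos (C := C) hΛ
  have hcyc := isSymmetricCycle_of_time hC hΛ ht hd
  have ht0 := Real.pi_pos.trans ht.1
  have hs := sin_neg_of_mem ht
  have hA := arrival_pos hC ht0 ht.2
  have hAD := departure_lt_arrival hC ht0
  have hab := exp_mul_exp_neg (C * t)
  have hE : Real.exp (-2 * C * t) = Real.exp (-(C * t)) ^ 2 := by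
    rw [sq, ← Real.exp_add]
    ring_nf
  set k := eqHeight C Λ with hkdef
  set g := -k * Real.exp (-(C * t)) * arrival C t / Real.sin t ^ 2 with hg
  have hg0 : g ≠ 0 := by
    rw [hg]
    exact div_ne_zero (mul_ne_zero (mul_ne_zero (by linarith) (Real.exp_ne_zero _)) hA.ne')
      (pow_ne_zero 2 hs.ne)
  have hstrict := hasStrictDerivAt_slopeOf C k hs.ne
  rw [← hg] at hstrict
  set θ := hstrict.localInverse _ _ _ hg0
  have hθ : HasDerivAt θ g⁻¹ (slopeOf C k t) := (hstrict.to_localInverse hg0).hasDerivAt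
  have hinv : ∀ᶠ y in 𝓝 (slopeOf C k t), slopeOf C k (θ y) = y :=
    hstrict.eventually_right_inverse hg0
  have hθt : θ (slopeOf C k t) = t :=
    (hstrict.hasStrictFDerivAt_equiv hg0).localInverse_apply_image
  have hret := eventually_isHalfReturn (H := cycleH C t) hC hΛ ht hd hcyc.x_pos hθ.continuousAt
    hθt hinv
  refine hcyc.isStableCycle hret (hθ.continuousAt.comp (f := Prod.snd)
    (x := (endOf C k t, slopeOf C k t)) continuousAt_snd) hθt ?_
  obtain ⟨L, hL, hLv⟩ := hasFDerivAt_halfMap (H := cycleH C t) (x := endOf C k t) hθ hθt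
    (hasDerivAt_endOf C k hs.ne)
  have hab1 : -k * Real.exp (C * t) * departure C t / Real.sin t ^ 2 * g⁻¹ =
      Real.exp (C * t) ^ 2 * departure C t / arrival C t := by
    rw [hg, Real.exp_neg]
    have := hs.ne
    field_simp
  have hδ : -k * Real.exp (C * t) * departure C t / Real.sin t ^ 2 * g⁻¹ * Real.exp (-2 * C * t)
      = departure C t / arrival C t := by
    rw [hab1, hE]
    field_simp
    linear_combination (Real.exp (C * t) * Real.exp (-(C * t)) + 1) * hab
  set σ := cycleH C t * (-k * Real.exp (C * t) * departure C t / Real.sin t ^ 2 * g⁻¹)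
    + cycleH C t * Real.exp (-2 * C * t)
    + 2 * C * g⁻¹ * Real.exp (-2 * C * t) * (endOf C k t - cycleH C t * slopeOf C k t) with hσ
  have hσA : σ * arrival C t = cycleH C t * (Real.exp (C * t) ^ 2 * departure C t)
      + cycleH C t * Real.exp (-(C * t)) ^ 2 * arrival C t
      + 2 * C * Real.exp (-(C * t)) * Real.sin t
        * (arrival C t - cycleH C t * departure C t) := by
    rw [hσ, hab1, hE, hg, endOf, slopeOf]
    have := hs.ne
    have := (Real.exp_pos (-(C * t))).ne'
    field_simp
    ring
  obtain ⟨h1, h2⟩ := halfMap_schurCohn hC ht hd rfl hσA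
  refine discreteAsymptoticallyStable_of_hasFDerivAt (σ := σ) ?_ hL hLv ?_ (Real.exp_pos _) ?_ ?_ ?_
  · have h3 := hret.self_of_nhds.return_eq
    rw [← hkdef] at h3
    simp only [hθt] at h3
    have h4 := hcyc.upper_end
    rw [h3] at h4
    have h5 := congrArg symm h4
    rw [symm_symm, symm_symm] at h5
    have e0 := congrFun h5 0
    have e1 := congrFun h5 1
    simp [pt] at e0 e1
    exact Prod.ext e0 e1
  · rw [hab1]
    positivity
  · rw [hδ, div_lt_one hA]
    exact hAD
  · rw [hδ]
    have : 1 - σ + departure C t / arrival C t =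
        (arrival C t * (1 - σ) + departure C t) / arrival C t := by field_simp
    rw [this]
    positivity
  · rw [hδ]
    have : 1 + σ + departure C t / arrival C t =
        (arrival C t * (1 + σ) + departure C t) / arrival C t := by field_simp
    rw [this]
    positivity

/-- The time parametrization of the symmetric cycles for `Λ > 0`. -/
theorem IsSymmetricCycle.eq_of_pos {C H Λ x y T : ℝ} (h : IsSymmetricCycle C H Λ x y T)
    (hC : 0 < C) (hΛ : 0 < Λ) : T ∈ Set.Ioo Real.pi (2 * Real.pi) ∧ 0 < departure C T ∧
      H = cycleH C T ∧ y = slopeOf C (eqHeight C Λ) T ∧ x = endOf C (eqHeight C Λ) T := by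
  have hT := h.time_mem_of_pos hC hΛ
  have hs := sin_neg_of_mem hT
  obtain ⟨hy, hx⟩ := h.slopeOf_eq hs.ne
  have hd := (slopeOf_pos_iff (eqHeight_pos hΛ) hT).1 (hy ▸ h.y_pos)
  exact ⟨hT, hd, h.eq_cycleH hΛ.ne' hs.ne (cycleDen_pos hC h.T_pos hT.2 hd).ne', hy, hx⟩

theorem IsSymmetricCycle.isStableCycle_of_pos {C H Λ x y T : ℝ}
    (h : IsSymmetricCycle C H Λ x y T) (hC : 0 < C) (hΛ : 0 < Λ) : IsStableCycle C H Λ x y T := by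
  obtain ⟨hT, hd, hH, hy, hx⟩ := h.eq_of_pos hC hΛ
  rw [hH, hy, hx]
  exact isStableCycle_of_time hC hΛ hT hd

/-! ### Roots of monic quadratics -/

theorem exists_quadratic_roots (p q : ℂ) : ∃ r s : ℂ, r + s = p ∧ r * s = q := by
  obtain ⟨d, hd⟩ := IsAlgClosed.exists_pow_nat_eq (p ^ 2 - 4 * q) two_pos
  refine ⟨(p + d) / 2, (p - d) / 2, by ring, ?_⟩
  linear_combination -hd / 4

/-- A monic quadratic that is small at `w` has a root near `w`. -/
theorem exists_root_near (p q w : ℂ) :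
    ∃ r : ℂ, r ^ 2 - p * r + q = 0 ∧ ‖r - w‖ ^ 2 ≤ ‖w ^ 2 - p * w + q‖ := by
  obtain ⟨r, s, hp, hq⟩ := exists_quadratic_roots p q
  have hf : w ^ 2 - p * w + q = (r - w) * (s - w) := by
    rw [← hp, ← hq]
    ring
  rw [hf, norm_mul]
  rcases le_total ‖r - w‖ ‖s - w‖ with h | h
  · refine ⟨r, by rw [← hp, ← hq]; ring, ?_⟩
    rw [sq]
    exact mul_le_mul_of_nonneg_left h (norm_nonneg _)
  · refine ⟨s, by rw [← hp, ← hq]; ring, ?_⟩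
    rw [sq]
    exact mul_le_mul_of_nonneg_right h (norm_nonneg _)

/-- The Schur–Cohn criterion for real quadratics. -/
theorem quadratic_roots_lt_one_iff (a b : ℝ) :
    (∀ μ : ℂ, μ ^ 2 - (a : ℂ) * μ + (b : ℂ) = 0 → ‖μ‖ < 1) ↔
      0 < 1 - b ∧ 0 < 1 - a + b ∧ 0 < 1 + a + b := by
  constructor
  · intro h
    have hreal : ∀ x : ℝ, x ^ 2 - a * x + b = 0 → |x| < 1 := fun x hx => by
      have := h x (by exact_mod_cast congrArg (fun r : ℝ => (r : ℂ)) hx)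
      simpa using this
    have hb : |b| < 1 := by
      obtain ⟨r, s, hp, hq⟩ := exists_quadratic_roots a b
      have h1 := h r (by rw [← hp, ← hq]; ring)
      have h2 := h s (by rw [← hp, ← hq]; ring)
      have h3 := congrArg norm hq
      rw [norm_mul, Complex.norm_real, Real.norm_eq_abs] at h3
      rw [← h3]
      exact mul_lt_one_of_nonneg_of_lt_one_left (norm_nonneg _) h1 h2.le
    refine ⟨by linarith [le_abs_self b], ?_, ?_⟩
    · by_contra! hle
      have hd : 0 ≤ a ^ 2 - 4 * b := by nlinarith [sq_nonneg (a - 2)]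
      have hs := Real.sq_sqrt hd
      have hs0 := Real.sqrt_nonneg (a ^ 2 - 4 * b)
      have h1 := hreal ((a + √(a ^ 2 - 4 * b)) / 2) (by nlinarith)
      have h2 : 2 - a ≤ √(a ^ 2 - 4 * b) := Real.le_sqrt_of_sq_le (by nlinarith)
      linarith [le_abs_self ((a + √(a ^ 2 - 4 * b)) / 2)]
    · by_contra! hle
      have hd : 0 ≤ a ^ 2 - 4 * b := by nlinarith [sq_nonneg (a + 2)]
      have hs := Real.sq_sqrt hd
      have hs0 := Real.sqrt_nonneg (a ^ 2 - 4 * b)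
      have h1 := hreal ((a - √(a ^ 2 - 4 * b)) / 2) (by nlinarith)
      have h2 : 2 + a ≤ √(a ^ 2 - 4 * b) := Real.le_sqrt_of_sq_le (by nlinarith)
      linarith [neg_abs_le ((a - √(a ^ 2 - 4 * b)) / 2)]
  · rintro ⟨h1, h2, h3⟩ μ hμ
    have hre := congrArg Complex.re hμ
    have him := congrArg Complex.im hμ
    simp [sq] at hre him
    have hn : ‖μ‖ ^ 2 = μ.re ^ 2 + μ.im ^ 2 := by
      rw [← Complex.normSq_eq_norm_sq, Complex.normSq_apply]
      ring
    suffices μ.re ^ 2 + μ.im ^ 2 < 1 by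
      rw [← hn] at this
      nlinarith [norm_nonneg μ]
    set x := μ.re
    set y := μ.im
    rcases eq_or_ne y 0 with hy | hy
    · rw [hy] at hre ⊢
      have e1 : 0 < (1 - x) * (1 - (a - x)) := by nlinarith
      have e2 : 0 < (1 + x) * (1 + (a - x)) := by nlinarith
      have e3 : x * (a - x) = b := by nlinarith
      have hx1 : x < 1 := by
        by_contra! hx
        have : 1 - (a - x) < 0 := by
          by_contra! h
          nlinarith
        nlinarith
      have hx2 : -1 < x := by
        by_contra! hx
        have : 1 + (a - x) < 0 := by
          by_contra! h
          nlinarith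
        nlinarith
      nlinarith
    · have hx : 2 * x = a := by
        have : y * (2 * x - a) = 0 := by linarith
        rcases mul_eq_zero.1 this with h | h
        · exact absurd h hy
        · linarith
      nlinarith

/-! ### The asymptotic trace and the stability band -/

section Band

variable {C H : ℝ}

theorem disc_pos (h0 : 0 < H) (h1 : H < 1) : 0 < disc H := by
  unfold disc
  have : 0 < 1 - H := by linarith
  positivity

theorem mΓ_pos (h0 : 0 < H) : 0 < mΓ H := by
  unfold mΓ
  positivity

/-- The polynomial `1 - m + m²`. -/
def qpoly (m : ℝ) : ℝ := 1 - m + m ^ 2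

theorem qpoly_pos (m : ℝ) : 0 < qpoly m := by
  unfold qpoly
  nlinarith [sq_nonneg (2 * m - 1)]

theorem mΓ_relations (h0 : 0 < H) (h1 : H < 1) :
    H * qpoly (mΓ H) = mΓ H ∧ √(disc H) * qpoly (mΓ H) = 1 - mΓ H ^ 2 := by
  have hr := Real.sq_sqrt (disc_pos h0 h1).le
  have hr0 := Real.sqrt_nonneg (disc H)
  set r := √(disc H) with hrdef
  have hu : 0 < H + r + 1 := by linarith
  rw [disc] at hr
  simp only [qpoly, mΓ, ← hrdef]
  constructor
  · field_simp
    linear_combination hr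
  · field_simp
    linear_combination (r + 1) * hr

theorem mΓ_lt_one (h0 : 0 < H) (h1 : H < 1) : mΓ H < 1 := by
  have h2 := Real.sqrt_pos.2 (disc_pos h0 h1)
  rw [mΓ, div_lt_one (by linarith)]
  linarith

theorem H_eq (h0 : 0 < H) (h1 : H < 1) : H = mΓ H / qpoly (mΓ H) := by
  rw [eq_div_iff (qpoly_pos _).ne']
  exact (mΓ_relations h0 h1).1

/-- The limit trace, multiplied by `(1 - m + m²)²`, as a function of `m` and `a = e^{πC}`. -/
def tauNum (m a b : ℝ) : ℝ :=
  m ^ 2 * ((1 + m ^ 2) * (m ^ 2 - 2 * m + 2)) * a ^ 2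
    - 2 * ((1 + m ^ 2) * (1 - m) ^ 2) * b + m ^ 2 * b ^ 4

theorem τΓ_eq (h0 : 0 < H) (h1 : H < 1) :
    τΓ C H * qpoly (mΓ H) ^ 2 =
      tauNum (mΓ H) (Real.exp (Real.pi * C)) (Real.exp (-(Real.pi * C))) := by
  have hH := H_eq h0 h1
  have hm := mΓ_pos h0
  have hq := qpoly_pos (mΓ H)
  have hr : √(disc H) = (1 - mΓ H ^ 2) / qpoly (mΓ H) := by
    rw [eq_div_iff hq.ne']
    exact (mΓ_relations h0 h1).2
  have e1 : Real.exp (2 * Real.pi * C) = Real.exp (Real.pi * C) ^ 2 := by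
    rw [← Real.exp_nat_mul]
    push_cast
    ring_nf
  have e2 : Real.exp (-(4 * Real.pi * C)) = Real.exp (-(Real.pi * C)) ^ 4 := by
    rw [← Real.exp_nat_mul]
    push_cast
    ring_nf
  rw [τΓ, e1, e2]
  set a := Real.exp (Real.pi * C)
  set b := Real.exp (-(Real.pi * C))
  set m := mΓ H
  have p2 : Ψp2 H * qpoly m ^ 2 = (1 + m ^ 2) * (m ^ 2 - 2 * m + 2) := by
    rw [Ψp2, hr, hH]
    field_simp
    simp only [qpoly]
    ring
  have p4 : Ψm4 H * qpoly m ^ 2 = 1 := by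
    rw [Ψm4, hr, hH]
    field_simp
    simp only [qpoly]
    ring
  have p1 : m ^ 2 * Ψm1 H * qpoly m ^ 2 = -2 * ((1 + m ^ 2) * (1 - m) ^ 2) := by
    have e : Ψm1 H = (H ^ 2 - 1) * (2 * Ψm4 H) / H ^ 2 := by
      rw [Ψm1, Ψm4]
      ring
    have e3 : Ψm4 H = 1 / qpoly m ^ 2 := by
      rw [eq_div_iff (by positivity)]
      exact p4
    rw [e, e3, hH]
    field_simp
    simp only [qpoly]
    ring
  simp only [tauNum]
  linear_combination m ^ 2 * a ^ 2 * p2 + b * p1 + m ^ 2 * b ^ 4 * p4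

/-- The cofactor of `1 - m a` in the upper boundary polynomial. -/
def upperCofactor (m a : ℝ) : ℝ :=
  -m ^ 2 - m ^ 3 * a - m ^ 4 * a ^ 2 + (2 * ((1 + m ^ 2) * (1 - m) ^ 2) - m ^ 5) * a ^ 3
    + (1 + m ^ 2) * (m ^ 2 - 2 * m + 2) * a ^ 4 + m * ((1 + m ^ 2) * (m ^ 2 - 2 * m + 2)) * a ^ 5

theorem upperCofactor_pos {m a : ℝ} (h0 : 0 < m) (h1 : m < 1) (ha : 1 < a) :
    0 < upperCofactor m a := by
  have hc : 0 < m ^ 2 - 2 * m + 2 := by nlinarith [sq_nonneg (m - 1)]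
  have hQ : 0 < 4 * (1 - m) * (1 + m ^ 2) := by
    have : 0 < 1 - m := by linarith
    positivity
  have e : upperCofactor m a = 4 * (1 - m) * (1 + m ^ 2) * a ^ 3 + m ^ 2 * (a ^ 3 - 1)
      + m ^ 3 * (a ^ 3 - a) + m ^ 4 * (a ^ 3 - a ^ 2)
      + (1 + m ^ 2) * (m ^ 2 - 2 * m + 2) * (a ^ 4 - a ^ 3)
      + m * ((1 + m ^ 2) * (m ^ 2 - 2 * m + 2)) * (a ^ 5 - a ^ 3) := by
    simp only [upperCofactor]
    ring
  have f1 : 0 < a ^ 3 - 1 := sub_pos.2 (one_lt_pow₀ ha three_ne_zero)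
  have f2 : 0 < a ^ 3 - a := by
    have := pow_lt_pow_right₀ ha (show 1 < 3 by norm_num)
    simpa using this
  have f3 : 0 < a ^ 3 - a ^ 2 := sub_pos.2 (pow_lt_pow_right₀ ha (by norm_num))
  have f4 : 0 < a ^ 4 - a ^ 3 := sub_pos.2 (pow_lt_pow_right₀ ha (by norm_num))
  have f5 : 0 < a ^ 5 - a ^ 3 := sub_pos.2 (pow_lt_pow_right₀ ha (by norm_num))
  have ha0 : 0 < a := by linarith
  rw [e]
  positivity

theorem upper_factor (m a b : ℝ) (hab : a * b = 1) :
    (2 + m ^ 2) * qpoly m ^ 2 - tauNum m a b = (1 - m * a) * (upperCofactor m a * b ^ 4) := by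
  have ha : a ≠ 0 := left_ne_zero_of_mul_eq_one hab
  have hb : b = 1 / a := by field_simp; linarith
  rw [hb]
  simp only [qpoly, tauNum, upperCofactor]
  field_simp
  ring

theorem one_lt_exp_pi (hC : 0 < C) : 1 < Real.exp (Real.pi * C) :=
  Real.one_lt_exp_iff.2 (mul_pos Real.pi_pos hC)

/-- The upper inequality of the band, in factored form. -/
theorem upper_eq (hC : 0 < C) (h0 : 0 < H) (h1 : H < 1) : ∃ P : ℝ, 0 < P ∧
    2 + mΓ H ^ 2 - τΓ C H = (1 - mΓ H * Real.exp (Real.pi * C)) * P := by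
  have hq := qpoly_pos (mΓ H)
  refine ⟨upperCofactor (mΓ H) (Real.exp (Real.pi * C)) * Real.exp (-(Real.pi * C)) ^ 4
    / qpoly (mΓ H) ^ 2, ?_, ?_⟩
  · have := upperCofactor_pos (mΓ_pos h0) (mΓ_lt_one h0 h1) (one_lt_exp_pi hC)
    positivity
  · have h2 := upper_factor (mΓ H) _ _ (exp_mul_exp_neg (Real.pi * C))
    rw [← τΓ_eq h0 h1] at h2
    field_simp
    linear_combination h2

theorem Hcrit_eq (C : ℝ) : Hcrit C = Real.exp (Real.pi * C) / qpoly (Real.exp (Real.pi * C)) := by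
  have hab := exp_mul_exp_neg (Real.pi * C)
  have hq := qpoly_pos (Real.exp (Real.pi * C))
  have ha := Real.exp_pos (Real.pi * C)
  rw [Hcrit, Real.cosh_eq]
  have e : 2 * ((Real.exp (Real.pi * C) + Real.exp (-(Real.pi * C))) / 2) - 1
      = qpoly (Real.exp (Real.pi * C)) / Real.exp (Real.pi * C) := by
    rw [eq_div_iff ha.ne', qpoly]
    linear_combination hab
  rw [e, one_div_div]

theorem Hcrit_mem (hC : 0 < C) : 0 < Hcrit C ∧ Hcrit C < 1 := by
  have ha := one_lt_exp_pi hC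
  have hq := qpoly_pos (Real.exp (Real.pi * C))
  rw [Hcrit_eq]
  refine ⟨by positivity, ?_⟩
  rw [div_lt_one hq, qpoly]
  nlinarith

theorem sub_Hcrit (hC : 0 < C) (h0 : 0 < H) (h1 : H < 1) : ∃ P : ℝ, 0 < P ∧
    Hcrit C - H = (1 - mΓ H * Real.exp (Real.pi * C)) * P := by
  have ha := one_lt_exp_pi hC
  have hm := mΓ_lt_one h0 h1
  have hq := qpoly_pos (Real.exp (Real.pi * C))
  have hq' := qpoly_pos (mΓ H)
  refine ⟨(Real.exp (Real.pi * C) - mΓ H) / (qpoly (Real.exp (Real.pi * C)) * qpoly (mΓ H)),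
    div_pos (by linarith) (by positivity), ?_⟩
  rw [Hcrit_eq]
  nth_rewrite 1 [H_eq h0 h1]
  field_simp
  simp only [qpoly]
  ring

theorem upper_pos_iff (hC : 0 < C) (h0 : 0 < H) (h1 : H < 1) :
    0 < 2 + mΓ H ^ 2 - τΓ C H ↔ H < Hcrit C := by
  obtain ⟨P, hP, e⟩ := upper_eq hC h0 h1
  obtain ⟨P', hP', e'⟩ := sub_Hcrit hC h0 h1
  rw [e, ← sub_pos (a := Hcrit C), e', mul_pos_iff_of_pos_right hP, mul_pos_iff_of_pos_right hP']

theorem upper_eq_zero_iff (hC : 0 < C) (h0 : 0 < H) (h1 : H < 1) :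
    2 + mΓ H ^ 2 - τΓ C H = 0 ↔ H = Hcrit C := by
  obtain ⟨P, hP, e⟩ := upper_eq hC h0 h1
  obtain ⟨P', hP', e'⟩ := sub_Hcrit hC h0 h1
  rw [e, eq_comm (a := H), ← sub_eq_zero (a := Hcrit C), e', mul_eq_zero, mul_eq_zero,
    or_iff_left hP.ne', or_iff_left hP'.ne']

theorem mΓ_Hcrit (hC : 0 < C) : mΓ (Hcrit C) = Real.exp (-(Real.pi * C)) := by
  obtain ⟨h0, h1⟩ := Hcrit_mem hC
  obtain ⟨P', hP', e'⟩ := sub_Hcrit hC h0 h1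
  rw [sub_self] at e'
  have h2 := (mul_eq_zero.1 e'.symm).resolve_right hP'.ne'
  have hab := exp_mul_exp_neg (Real.pi * C)
  linear_combination Real.exp (-(Real.pi * C)) * (-h2) - mΓ (Hcrit C) * hab

theorem upperBoundary_eq : upperBoundary = {p : ℝ × ℝ | 0 < p.1 ∧ p.2 = Hcrit p.1} := by
  ext ⟨C, H⟩
  constructor
  · rintro ⟨⟨hC, h0, h1⟩, h⟩
    exact ⟨hC, (upper_eq_zero_iff hC h0 h1).1 h⟩
  · rintro ⟨hC, h⟩
    simp only at hC h
    have h2 := Hcrit_mem hC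
    rw [← h] at h2
    exact ⟨⟨hC, h2.1, h2.2⟩, (upper_eq_zero_iff hC h2.1 h2.2).2 h⟩

theorem continuousOn_mΓ : ContinuousOn mΓ (Set.Ici 0) := by
  unfold mΓ disc
  refine ContinuousOn.div (by fun_prop) (by fun_prop) fun H hH => ?_
  have : 0 ≤ H := hH
  positivity

theorem continuousOn_τΓ : ContinuousOn (fun p : ℝ × ℝ => τΓ p.1 p.2) paramRegion := by
  have hm : ContinuousOn (fun p : ℝ × ℝ => mΓ p.2) paramRegion :=
    continuousOn_mΓ.comp continuousOn_snd fun p hp => hp.2.1.le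
  unfold τΓ Ψp2 Ψm1 Ψm4 disc
  refine (hm.pow 2).mul (ContinuousOn.add (ContinuousOn.add ?_ ?_) ?_)
  · fun_prop
  · refine ContinuousOn.mul (ContinuousOn.div (by fun_prop) (by fun_prop) fun p hp => ?_)
      (by fun_prop)
    exact pow_ne_zero 2 hp.2.1.ne'
  · fun_prop

theorem isOpen_paramRegion : IsOpen paramRegion := by
  unfold paramRegion
  simp only [Set.ofPred_and]
  exact (isOpen_lt continuous_const continuous_fst).inter
    ((isOpen_lt continuous_const continuous_snd).inter (isOpen_lt continuous_snd continuous_const))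

theorem continuousOn_mΓ_sq : ContinuousOn (fun p : ℝ × ℝ => mΓ p.2 ^ 2) paramRegion :=
  (continuousOn_mΓ.comp continuousOn_snd fun _ hp => hp.2.1.le).pow 2

theorem continuousOn_upper :
    ContinuousOn (fun p : ℝ × ℝ => 2 + mΓ p.2 ^ 2 - τΓ p.1 p.2) paramRegion :=
  (continuousOn_const.add continuousOn_mΓ_sq).sub continuousOn_τΓ

theorem continuousOn_lower :
    ContinuousOn (fun p : ℝ × ℝ => τΓ p.1 p.2 + mΓ p.2 ^ 2) paramRegion :=
  continuousOn_τΓ.add continuousOn_mΓ_sq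

theorem isOpen_stabilityBand : IsOpen stabilityBand := by
  have h1 := continuousOn_upper.isOpen_inter_preimage isOpen_paramRegion (isOpen_Ioi (a := (0 : ℝ)))
  have h2 := continuousOn_lower.isOpen_inter_preimage isOpen_paramRegion (isOpen_Ioi (a := (0 : ℝ)))
  convert h1.inter h2 using 1
  ext p
  simp only [stabilityBand, Set.mem_ofPred_eq, Set.mem_inter_iff, Set.mem_preimage, Set.mem_Ioi]
  tauto

/-- Along a horizontal line the lower function changes sign at most once, from `-` to `+`. -/
theorem lower_pos_of_lt {C' : ℝ} (hC : 0 < C) (h0 : 0 < H) (h1 : H < 1) (hCC : C < C')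
    (h : 0 ≤ τΓ C H + mΓ H ^ 2) : 0 < τΓ C' H + mΓ H ^ 2 := by
  have hq := qpoly_pos (mΓ H)
  have hm := mΓ_pos h0
  have hm1 := mΓ_lt_one h0 h1
  have t1 := τΓ_eq (C := C) h0 h1
  have t2 := τΓ_eq (C := C') h0 h1
  have ha := one_lt_exp_pi hC
  have haa : Real.exp (Real.pi * C) < Real.exp (Real.pi * C') :=
    Real.exp_lt_exp.2 (mul_lt_mul_of_pos_left hCC Real.pi_pos)
  have hab := exp_mul_exp_neg (Real.pi * C)
  have hab' := exp_mul_exp_neg (Real.pi * C')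
  set m := mΓ H
  set a := Real.exp (Real.pi * C)
  set a' := Real.exp (Real.pi * C')
  have hb : Real.exp (-(Real.pi * C)) = 1 / a := by
    rw [eq_div_iff (by positivity)]
    linarith
  have hb' : Real.exp (-(Real.pi * C')) = 1 / a' := by
    rw [eq_div_iff (by positivity)]
    linarith
  rw [hb] at t1
  rw [hb'] at t2
  have ha0 : 0 < a := by linarith
  have ha0' : 0 < a' := by linarith
  have hc : 1 ≤ (1 + m ^ 2) * (m ^ 2 - 2 * m + 2) := by
    nlinarith [sq_nonneg (m - 1), sq_nonneg m, mul_nonneg (sq_nonneg m) (sq_nonneg (m - 1))]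
  have k1 : 1 / a ^ 3 - 1 / a' ^ 3 < a' ^ 3 - a ^ 3 := by
    have g1 : a ^ 3 < a' ^ 3 := pow_lt_pow_left₀ haa ha0.le three_ne_zero
    have g2 : 1 < a ^ 3 := one_lt_pow₀ ha three_ne_zero
    have g3 : 1 / a ^ 3 - 1 / a' ^ 3 = (a' ^ 3 - a ^ 3) / (a ^ 3 * a' ^ 3) := by field_simp
    rw [g3, div_lt_iff₀ (by positivity)]
    have g4 : 1 < a ^ 3 * a' ^ 3 := by nlinarith
    nlinarith
  have g1 : a ^ 3 < a' ^ 3 := pow_lt_pow_left₀ haa ha0.le three_ne_zero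
  have key : a * (tauNum m a (1 / a) + m ^ 2 * qpoly m ^ 2) <
      a' * (tauNum m a' (1 / a') + m ^ 2 * qpoly m ^ 2) := by
    have e1 : ∀ x : ℝ, 0 < x → x * (tauNum m x (1 / x) + m ^ 2 * qpoly m ^ 2) =
        m ^ 2 * ((1 + m ^ 2) * (m ^ 2 - 2 * m + 2) * x ^ 3 + qpoly m ^ 2 * x + 1 / x ^ 3)
          - 2 * ((1 + m ^ 2) * (1 - m) ^ 2) := fun x hx => by
      simp only [tauNum]
      field_simp
      ring
    rw [e1 a ha0, e1 a' ha0']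
    have e2 : (1 + m ^ 2) * (m ^ 2 - 2 * m + 2) * a ^ 3 + qpoly m ^ 2 * a + 1 / a ^ 3 <
        (1 + m ^ 2) * (m ^ 2 - 2 * m + 2) * a' ^ 3 + qpoly m ^ 2 * a' + 1 / a' ^ 3 := by
      have e3 : qpoly m ^ 2 * a ≤ qpoly m ^ 2 * a' := by gcongr
      nlinarith
    have e4 := mul_lt_mul_of_pos_left e2 (show 0 < m ^ 2 by positivity)
    linarith
  have h2 : 0 ≤ a * (tauNum m a (1 / a) + m ^ 2 * qpoly m ^ 2) := by
    rw [← t1, ← add_mul]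
    positivity
  have h3 := h2.trans_lt key
  rw [← t2, ← add_mul] at h3
  exact (pos_iff_pos_of_mul_pos ((pos_iff_pos_of_mul_pos h3).1 ha0')).2 (by positivity)

/-- The lower function is negative for small `H`. -/
theorem eventually_lower_neg (C : ℝ) : ∀ᶠ H in 𝓝[>] (0 : ℝ), τΓ C H + mΓ H ^ 2 < 0 := by
  have hm : Tendsto mΓ (𝓝[>] 0) (𝓝 0) := by
    have h1 := (continuousOn_mΓ 0 Set.self_mem_Ici).mono_left
      (nhdsWithin_mono 0 (Set.Ioi_subset_Ici_self))
    have h2 : mΓ 0 = 0 := by simp [mΓ]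
    rwa [h2] at h1
  have hcont : Continuous fun m : ℝ =>
      tauNum m (Real.exp (Real.pi * C)) (Real.exp (-(Real.pi * C))) + m ^ 2 * qpoly m ^ 2 := by
    unfold tauNum qpoly
    fun_prop
  have h3 := (hcont.tendsto 0).comp hm
  have h4 : ∀ᶠ H in 𝓝[>] (0 : ℝ), tauNum (mΓ H) (Real.exp (Real.pi * C))
      (Real.exp (-(Real.pi * C))) + mΓ H ^ 2 * qpoly (mΓ H) ^ 2 < 0 := by
    refine h3.eventually_lt_const ?_
    have := Real.exp_pos (-(Real.pi * C))
    simp only [tauNum, qpoly]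
    norm_num
    exact this
  filter_upwards [h4, Ioo_mem_nhdsGT (zero_lt_one' ℝ)] with H hH h01
  rw [← τΓ_eq h01.1 h01.2, ← add_mul] at hH
  by_contra! hge
  have := mul_nonneg hge (sq_nonneg (qpoly (mΓ H)))
  linarith

theorem exists_lowerBoundary (hC : 0 < C) (h0 : 0 < H) (h1 : H < 1)
    (h : 0 < τΓ C H + mΓ H ^ 2) : ∃ H' < H, (C, H') ∈ lowerBoundary := by
  obtain ⟨G, hG, hG0⟩ := ((eventually_lower_neg C).and (Ioo_mem_nhdsGT h0)).exists
  have hcont : ContinuousOn (fun H' => τΓ C H' + mΓ H' ^ 2) (Set.Icc G H) :=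
    continuousOn_lower.comp (f := fun H' => (C, H')) (by fun_prop)
      fun H' hH' => ⟨hC, hG0.1.trans_le hH'.1, hH'.2.trans_lt h1⟩
  obtain ⟨H', hH', he⟩ := intermediate_value_Ioo hG0.2.le hcont ⟨hG, h⟩
  exact ⟨H', hH'.2, ⟨hC, hG0.1.trans hH'.1, hH'.2.trans h1⟩, he⟩

theorem lower_Hcrit_pos (hC : 0 < C) : 0 < τΓ C (Hcrit C) + mΓ (Hcrit C) ^ 2 := by
  obtain ⟨h0, h1⟩ := Hcrit_mem hC
  have := (upper_eq_zero_iff hC h0 h1).2 rfl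
  nlinarith [sq_nonneg (mΓ (Hcrit C))]

/-- Just below the critical value the parameters lie in the band. -/
theorem eventually_mem_stabilityBand (hC : 0 < C) :
    ∀ᶠ H in 𝓝[<] (Hcrit C), (C, H) ∈ stabilityBand := by
  obtain ⟨h0, h1⟩ := Hcrit_mem hC
  have hmem : (C, Hcrit C) ∈ paramRegion := ⟨hC, h0, h1⟩
  have hc : ContinuousAt (fun H => τΓ C H + mΓ H ^ 2) (Hcrit C) :=
    (continuousOn_lower.continuousAt (isOpen_paramRegion.mem_nhds hmem)).comp
      (f := fun H => (C, H)) (x := Hcrit C) (by fun_prop)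
  have h2 : ∀ᶠ H in 𝓝 (Hcrit C), 0 < τΓ C H + mΓ H ^ 2 :=
    hc.eventually_const_lt (lower_Hcrit_pos hC)
  filter_upwards [h2.filter_mono nhdsWithin_le_nhds, Ioo_mem_nhdsLT h0] with H hH hH0
  exact ⟨⟨hC, hH0.1, hH0.2.trans h1⟩, (upper_pos_iff hC hH0.1 (hH0.2.trans h1)).2 hH0.2, hH⟩

theorem frontier_stabilityBand :
    frontier stabilityBand ∩ paramRegion = upperBoundary ∪ lowerBoundary := by
  ext ⟨C, H⟩
  rw [isOpen_stabilityBand.frontier_eq]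
  constructor
  · rintro ⟨⟨hcl, hnot⟩, hp⟩
    have hU := continuousOn_upper.continuousAt (isOpen_paramRegion.mem_nhds hp)
    have hL := continuousOn_lower.continuousAt (isOpen_paramRegion.mem_nhds hp)
    have hfr := mem_closure_iff_frequently.1 hcl
    have hU0 : 0 ≤ 2 + mΓ H ^ 2 - τΓ C H := by
      by_contra! hlt
      have h1 := hU.eventually_lt_const hlt
      obtain ⟨p, hp1, hp2⟩ := (hfr.and_eventually h1).exists
      exact absurd hp1.2.1 (not_lt.2 hp2.le)
    have hL0 : 0 ≤ τΓ C H + mΓ H ^ 2 := by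
      by_contra! hlt
      have h1 := hL.eventually_lt_const hlt
      obtain ⟨p, hp1, hp2⟩ := (hfr.and_eventually h1).exists
      exact absurd hp1.2.2 (not_lt.2 hp2.le)
    rcases hU0.eq_or_lt with h | h
    · exact Or.inl ⟨hp, h.symm⟩
    · rcases hL0.eq_or_lt with h' | h'
      · exact Or.inr ⟨hp, h'.symm⟩
      · exact absurd ⟨hp, h, h'⟩ hnot
  · rintro (⟨hp, h⟩ | ⟨hp, h⟩)
    · refine ⟨⟨?_, fun hb => absurd hb.2.1 (by simp only at h ⊢; rw [h]; exact lt_irrefl _)⟩, hp⟩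
      have hH : H = Hcrit C := (upper_eq_zero_iff hp.1 hp.2.1 hp.2.2).1 h
      have hev := eventually_mem_stabilityBand hp.1
      have ht : Tendsto (fun H' => (C, H')) (𝓝[<] (Hcrit C)) (𝓝 (C, H)) := by
        rw [hH]
        exact (Continuous.tendsto (by fun_prop) (Hcrit C)).mono_left nhdsWithin_le_nhds
      exact mem_closure_of_tendsto ht hev
    · refine ⟨⟨?_, fun hb => absurd hb.2.2 (by simp only at h ⊢; rw [h]; exact lt_irrefl _)⟩, hp⟩
      have hU := continuousOn_upper.continuousAt (isOpen_paramRegion.mem_nhds hp)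
      have ht : Tendsto (fun C' => (C', H)) (𝓝[>] C) (𝓝 (C, H)) :=
        (Continuous.tendsto (f := fun C' : ℝ => (C', H)) (by fun_prop) C).mono_left
          nhdsWithin_le_nhds
      have hU1 : (0 : ℝ) < 2 + mΓ H ^ 2 - τΓ C H := by
        simp only at h
        nlinarith [sq_nonneg (mΓ H)]
      refine mem_closure_of_tendsto ht ?_
      filter_upwards [ht.eventually (hU.eventually_const_lt hU1), self_mem_nhdsWithin] with C' h1 h2
      exact ⟨⟨hp.1.trans h2, hp.2.1, hp.2.2⟩, h1,
        lower_pos_of_lt hp.1 hp.2.1 hp.2.2 h2 h.ge⟩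

end Band

/-! ### The monodromy matrix -/

theorem saltationXY_mulVec {C H Λ : ℝ} {p : Fin 3 → ℝ} (h : X C H Λ p 2 ≠ 0) :
    (saltationXY C H Λ p).mulVec (X C H Λ p) = Y C H Λ p := by
  have he : e₃ ⬝ᵥ X C H Λ p = X C H Λ p 2 := by simp [e₃, dotProduct, Fin.sum_univ_three]
  rw [saltationXY, Matrix.add_mulVec, Matrix.one_mulVec, Matrix.smul_mulVec,
    Matrix.vecMulVec_mulVec, he]
  ext i
  simp
  field_simp
  ring

theorem saltationYX_mulVec {C H Λ : ℝ} {p : Fin 3 → ℝ} (h : Y C H Λ p 2 ≠ 0) :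
    (saltationYX C H Λ p).mulVec (Y C H Λ p) = X C H Λ p := by
  have he : e₃ ⬝ᵥ Y C H Λ p = Y C H Λ p 2 := by simp [e₃, dotProduct, Fin.sum_univ_three]
  rw [saltationYX, Matrix.sub_mulVec, Matrix.one_mulVec, Matrix.smul_mulVec,
    Matrix.vecMulVec_mulVec, he]
  ext i
  simp
  field_simp
  ring

/-- The field is an eigenvector of the monodromy matrix for the eigenvalue `1`. -/
theorem IsSymmetricCycle.monodromy_mulVec {C H Λ x y T : ℝ} (h : IsSymmetricCycle C H Λ x y T) :
    (monodromy C H Λ x y T).mulVec (X C H Λ (pt x y)) = X C H Λ (pt x y) := by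
  have hx : X C H Λ (symm (pt x y)) 2 ≠ 0 := by
    have := h.x_pos.ne'
    simpa [X, upperField, symm, pt] using this
  have e1 := exp_mulVec_field (DX C H) ![H * Λ, Λ, 0] (pt x y) T
  have e2 := exp_mulVec_field (DY C H) ![-Λ, -(H * Λ), 0] (symm (pt x y)) T
  have h1 : affineFlow (DX C H) ![H * Λ, Λ, 0] T (pt x y) = symm (pt x y) := h.upper_end
  have h2 : affineFlow (DY C H) ![-Λ, -(H * Λ), 0] T (symm (pt x y)) = pt x y := h.lower_end
  rw [h1, ← X_eq, ← X_eq] at e1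
  rw [h2, ← Y_eq, ← Y_eq] at e2
  rw [monodromy, ← Matrix.mulVec_mulVec, ← Matrix.mulVec_mulVec, ← Matrix.mulVec_mulVec, e1,
    saltationXY_mulVec hx, e2, saltationYX_mulVec h.Y_up.ne']

/-- The characteristic polynomial of a real `3 × 3` matrix with eigenvalue `1`. -/
theorem charpoly_eq_of_mulVec_eq {M : Matrix (Fin 3) (Fin 3) ℝ} {v : Fin 3 → ℝ} (hv : v ≠ 0)
    (h : M.mulVec v = v) : (M.map (fun r : ℝ => (r : ℂ))).charpoly =
      (Polynomial.X - Polynomial.C (1 : ℂ)) * transversePoly M := by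
  have hdet : (1 - M).det = 0 :=
    Matrix.exists_mulVec_eq_zero_iff.1
      ⟨v, hv, by rw [Matrix.sub_mulVec, Matrix.one_mulVec, h, sub_self]⟩
  have hC := congrArg (fun r : ℝ => Polynomial.C (r : ℂ)) hdet
  rw [Matrix.det_fin_three] at hC
  rw [Matrix.charpoly, Matrix.det_fin_three, transversePoly, Matrix.det_fin_three, Matrix.trace,
    Fin.sum_univ_three]
  simp at hC ⊢
  linear_combination Polynomial.X * hC

theorem transversePoly_isRoot {M : Matrix (Fin 3) (Fin 3) ℝ} {μ : ℂ} :
    (transversePoly M).IsRoot μ ↔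
      μ ^ 2 - ((M.trace - 1 : ℝ) : ℂ) * μ + ((M.det : ℝ) : ℂ) = 0 := by
  simp [transversePoly, Polynomial.IsRoot]

theorem transversePoly_roots_iff (M : Matrix (Fin 3) (Fin 3) ℝ) :
    (∀ μ : ℂ, (transversePoly M).IsRoot μ → ‖μ‖ < 1) ↔ SchurCohn M := by
  simp only [transversePoly_isRoot]
  rw [quadratic_roots_lt_one_iff, SchurCohn]
  have e1 : 1 - (M.trace - 1) + M.det = 2 - M.trace + M.det := by ring
  have e2 : 1 + (M.trace - 1) + M.det = M.trace + M.det := by ring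
  rw [e1, e2]

/-- If the transverse polynomials converge to one with root `w`, then some transverse multiplier
tends to `w`. -/
theorem exists_multiplier_tendsto {ι : Type*} {l : Filter ι} {M : ι → Matrix (Fin 3) (Fin 3) ℝ}
    {t d w : ℝ} (ht : Tendsto (fun i => (M i).trace) l (𝓝 t))
    (hd : Tendsto (fun i => (M i).det) l (𝓝 d)) (hw : w ^ 2 - (t - 1) * w + d = 0) :
    ∃ μ : ι → ℂ, (∀ i, (transversePoly (M i)).IsRoot (μ i)) ∧ Tendsto μ l (𝓝 (w : ℂ)) := by
  choose μ h1 h2 using fun i =>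
    exists_root_near (((M i).trace - 1 : ℝ) : ℂ) (((M i).det : ℝ) : ℂ) (w : ℂ)
  refine ⟨μ, fun i => transversePoly_isRoot.2 (h1 i), ?_⟩
  have h3 : Tendsto (fun i => w ^ 2 - ((M i).trace - 1) * w + (M i).det) l (𝓝 0) := by
    rw [← hw]
    exact (tendsto_const_nhds.sub ((ht.sub_const 1).mul_const w)).add hd
  have h4 : Tendsto (fun i => ‖μ i - w‖ ^ 2) l (𝓝 0) := by
    refine squeeze_zero (fun i => by positivity) (fun i => ?_) (by simpa using h3.abs)
    refine (h2 i).trans_eq ?_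
    rw [← Real.norm_eq_abs, ← Complex.norm_real]
    push_cast
    rfl
  rw [tendsto_iff_norm_sub_tendsto_zero]
  have h5 := h4.sqrt
  simpa [Real.sqrt_sq] using h5

/-- The exponential of `t DX`. -/
def expX (C H t : ℝ) : Matrix (Fin 3) (Fin 3) ℝ :=
  !![Real.exp (-2 * C * t),
      H * (Real.exp (C * t) * (Real.cos t - 3 * C * Real.sin t) - Real.exp (-2 * C * t)),
      2 * C * H * Real.exp (-2 * C * t) - H * Real.exp (C * t)
        * ((1 + C ^ 2) * Real.sin t + 2 * C * Real.cos t + 2 * C ^ 2 * Real.sin t);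
    0, Real.exp (C * t) * (Real.cos t - C * Real.sin t),
      -((1 + C ^ 2) * Real.exp (C * t) * Real.sin t);
    0, Real.exp (C * t) * Real.sin t, Real.exp (C * t) * (Real.cos t + C * Real.sin t)]

/-- The exponential of `t DY`. -/
def expY (C H t : ℝ) : Matrix (Fin 3) (Fin 3) ℝ :=
  !![Real.exp (C * t) * (Real.cos t - C * Real.sin t), 0,
      -((1 + C ^ 2) * Real.exp (C * t) * Real.sin t);
    H * (Real.exp (C * t) * (Real.cos t - 3 * C * Real.sin t) - Real.exp (-2 * C * t)),
      Real.exp (-2 * C * t),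
      2 * C * H * Real.exp (-2 * C * t) - H * Real.exp (C * t)
        * ((1 + C ^ 2) * Real.sin t + 2 * C * Real.cos t + 2 * C ^ 2 * Real.sin t);
    Real.exp (C * t) * Real.sin t, 0, Real.exp (C * t) * (Real.cos t + C * Real.sin t)]

theorem exp_DX_mulVec (C H t : ℝ) (w : Fin 3 → ℝ) :
    (NormedSpace.exp (t • DX C H)).mulVec w = explicitFlow C H 0 t w := by
  have h : flowX C H 0 t w = (NormedSpace.exp (t • DX C H)).mulVec w := by
    rw [← affineFlow_zero_right, flowX]
    congr 1
    ext i
    fin_cases i <;> simp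
  rw [← h, flowX_eq, eqHeight, zero_div]

theorem exp_DY_mulVec (C H t : ℝ) (w : Fin 3 → ℝ) :
    (NormedSpace.exp (t • DY C H)).mulVec w = symm (explicitFlow C H 0 t (symm w)) := by
  have h : flowY C H 0 t w = (NormedSpace.exp (t • DY C H)).mulVec w := by
    rw [← affineFlow_zero_right, flowY]
    congr 1
    ext i
    fin_cases i <;> simp
  rw [← h]
  conv_lhs => rw [← symm_symm w, flowY_symm]
  rw [flowX_eq, eqHeight, zero_div]

theorem exp_DX (C H t : ℝ) : NormedSpace.exp (t • DX C H) = expX C H t := by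
  refine Matrix.ext_of_mulVec_single fun j => ?_
  rw [exp_DX_mulVec]
  ext i
  fin_cases j <;> fin_cases i <;> simp [explicitFlow, slope, height, expX] <;> ring

theorem exp_DY (C H t : ℝ) : NormedSpace.exp (t • DY C H) = expY C H t := by
  refine Matrix.ext_of_mulVec_single fun j => ?_
  rw [exp_DY_mulVec]
  ext i
  fin_cases j <;> fin_cases i <;> simp [explicitFlow, slope, height, expY, symm] <;> ring

/-- The saltation matrix at the downward crossing, with `δ = y / x` and `ε = Λ (1 + H) / x`. -/
def saltDown (C δ ε : ℝ) : Matrix (Fin 3) (Fin 3) ℝ :=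
  !![1, 0, 2 * C * δ + ε; 0, 1, -2 * C + ε; 0, 0, δ]

/-- The saltation matrix at the upward crossing, with `δ = y / x` and `ε = Λ (1 + H) / x`. -/
def saltUp (C δ ε : ℝ) : Matrix (Fin 3) (Fin 3) ℝ :=
  !![1, 0, -2 * C + ε; 0, 1, 2 * C * δ + ε; 0, 0, δ]

theorem saltationXY_eq (C H Λ y : ℝ) {x : ℝ} (hx : x ≠ 0) :
    saltationXY C H Λ (symm (pt x y)) = saltDown C (y / x) (Λ * (1 + H) / x) := by
  ext i j
  fin_cases i <;> fin_cases j <;>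
    simp [saltationXY, saltDown, X, Y, upperField, lowerField, symm, pt, e₃]
      <;> field_simp <;> ring

theorem saltationYX_eq (C H Λ y : ℝ) {x : ℝ} (hx : x ≠ 0) :
    saltationYX C H Λ (pt x y) = saltUp C (y / x) (Λ * (1 + H) / x) := by
  ext i j
  fin_cases i <;> fin_cases j <;>
    simp [saltationYX, saltUp, X, Y, upperField, lowerField, pt, e₃]
      <;> field_simp <;> ring

/-- The monodromy matrix in closed form. -/
def monodromyForm (C H δ ε t : ℝ) : Matrix (Fin 3) (Fin 3) ℝ :=
  saltUp C δ ε * expY C H t * saltDown C δ ε * expX C H t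

theorem monodromy_eq (C H Λ y t : ℝ) {x : ℝ} (hx : x ≠ 0) :
    monodromy C H Λ x y t = monodromyForm C H (y / x) (Λ * (1 + H) / x) t := by
  rw [monodromy, saltationXY_eq C H Λ y hx, saltationYX_eq C H Λ y hx, exp_DX, exp_DY,
    monodromyForm]

theorem continuous_monodromyForm (C : ℝ) :
    Continuous fun q : ℝ × ℝ × ℝ × ℝ => monodromyForm C q.1 q.2.1 q.2.2.1 q.2.2.2 := by
  have h1 : Continuous fun q : ℝ × ℝ × ℝ × ℝ => saltUp C q.2.1 q.2.2.1 := by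
    refine continuous_matrix fun i j => ?_
    fin_cases i <;> fin_cases j <;> simp [saltUp] <;> fun_prop
  have h2 : Continuous fun q : ℝ × ℝ × ℝ × ℝ => saltDown C q.2.1 q.2.2.1 := by
    refine continuous_matrix fun i j => ?_
    fin_cases i <;> fin_cases j <;> simp [saltDown] <;> fun_prop
  have h3 : Continuous fun q : ℝ × ℝ × ℝ × ℝ => expX C q.1 q.2.2.2 := by
    refine continuous_matrix fun i j => ?_
    fin_cases i <;> fin_cases j <;> simp [expX] <;> fun_prop
  have h4 : Continuous fun q : ℝ × ℝ × ℝ × ℝ => expY C q.1 q.2.2.2 := by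
    refine continuous_matrix fun i j => ?_
    fin_cases i <;> fin_cases j <;> simp [expY] <;> fun_prop
  exact ((h1.matrix_mul h4).matrix_mul h2).matrix_mul h3

theorem det_monodromyForm_pi (C H δ : ℝ) : (monodromyForm C H δ 0 Real.pi).det = δ ^ 2 := by
  have h : Real.exp (-(2 * C * Real.pi)) * Real.exp (C * Real.pi) ^ 2 = 1 := by
    rw [← Real.exp_nat_mul, ← Real.exp_add]
    push_cast
    ring_nf
    exact Real.exp_zero
  have hX : (expX C H Real.pi).det = 1 := by
    rw [Matrix.det_fin_three]
    simp [expX]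
    linear_combination h
  have hY : (expY C H Real.pi).det = 1 := by
    rw [Matrix.det_fin_three]
    simp [expY]
    linear_combination h
  rw [monodromyForm, Matrix.det_mul, Matrix.det_mul, Matrix.det_mul, hX, hY, Matrix.det_fin_three,
    Matrix.det_fin_three]
  simp [saltUp, saltDown]
  ring

theorem trace_monodromyForm_pi {C H : ℝ} (h0 : 0 < H) (h1 : H < 1) :
    (monodromyForm C H (mΓ H) 0 Real.pi).trace = τΓ C H := by
  have hq := qpoly_pos (mΓ H)
  have ht := τΓ_eq (C := C) h0 h1
  have hH := H_eq h0 h1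
  have hab := exp_mul_exp_neg (Real.pi * C)
  have hα : Real.exp (-2 * C * Real.pi) = Real.exp (-(Real.pi * C)) ^ 2 := by
    rw [← Real.exp_nat_mul]
    push_cast
    ring_nf
  have hβ : Real.exp (C * Real.pi) = Real.exp (Real.pi * C) := by rw [mul_comm]
  have e : (monodromyForm C H (mΓ H) 0 Real.pi).trace * qpoly (mΓ H) ^ 2 =
      tauNum (mΓ H) (Real.exp (Real.pi * C)) (Real.exp (-(Real.pi * C))) := by
    have hX : expX C H Real.pi = !![Real.exp (-(Real.pi * C)) ^ 2,
        -(H * (Real.exp (Real.pi * C) + Real.exp (-(Real.pi * C)) ^ 2)),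
        2 * C * H * (Real.exp (Real.pi * C) + Real.exp (-(Real.pi * C)) ^ 2);
        0, -Real.exp (Real.pi * C), 0; 0, 0, -Real.exp (Real.pi * C)] := by
      ext i j
      fin_cases i <;> fin_cases j <;> simp [expX, hβ, ← hα] <;> ring
    have hY : expY C H Real.pi = !![-Real.exp (Real.pi * C), 0, 0;
        -(H * (Real.exp (Real.pi * C) + Real.exp (-(Real.pi * C)) ^ 2)),
        Real.exp (-(Real.pi * C)) ^ 2,
        2 * C * H * (Real.exp (Real.pi * C) + Real.exp (-(Real.pi * C)) ^ 2);
        0, 0, -Real.exp (Real.pi * C)] := by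
      ext i j
      fin_cases i <;> fin_cases j <;> simp [expY, hβ, ← hα] <;> ring
    rw [monodromyForm, hX, hY, Matrix.trace, Fin.sum_univ_three]
    simp [saltUp, saltDown]
    have hb : Real.exp (-(Real.pi * C)) = 1 / Real.exp (Real.pi * C) := by
      rw [eq_div_iff (Real.exp_pos _).ne']
      linarith
    rw [hb]
    have ha := (Real.exp_pos (Real.pi * C)).ne'
    clear ht hX hY hα hβ hab hb
    generalize Real.exp (Real.pi * C) = a at *
    generalize mΓ H = m at *
    subst hH
    simp only [tauNum]
    field_simp
    simp only [qpoly]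
    ring
  rw [← ht] at e
  exact mul_right_cancel₀ (by positivity) e

/-! ### The branch and the half-return time for large `y` -/

theorem IsSymmetricCycle.halfReturnTime_eq {C H Λ x y T : ℝ} (h : IsSymmetricCycle C H Λ x y T) :
    halfReturnTime C H Λ x y = T := by
  refine IsLeast.csInf_eq ⟨⟨h.T_pos, ?_⟩, fun t ht => ?_⟩
  · rw [h.upper_end]
    simp [symm, pt]
  · by_contra! hlt
    have := h.upper_arc t ⟨ht.1, hlt⟩
    rw [ht.2] at this
    exact lt_irrefl _ this

theorem sin_pi_add_neg {η : ℝ} (h0 : 0 < η) (h1 : η < Real.pi) : Real.sin (Real.pi + η) < 0 :=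
  sin_neg_of_mem ⟨by linarith, by linarith⟩

/-- For large `y` the first return to `z = 0` happens near the time `π`. -/
theorem exists_halfReturnTime_near {C Λ η : ℝ} (hC : 0 < C) (hΛ : Λ ≠ 0) (h0 : 0 < η)
    (h1 : η < Real.pi) : ∃ ν : ℝ, ∀ H x y, ν < y →
      halfReturnTime C H Λ x y ∈ Set.Icc (Real.pi - η) (Real.pi + η) := by
  set k := eqHeight C Λ
  have hs1 : 0 < Real.sin (Real.pi - η) := by
    rw [Real.sin_pi_sub]
    exact Real.sin_pos_of_pos_of_lt_pi h0 h1
  have hs2 := sin_pi_add_neg h0 h1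
  refine ⟨max 0 (max (slopeOf C k (Real.pi - η)) (slopeOf C k (Real.pi + η))),
    fun H x y hy => ?_⟩
  obtain ⟨hy0, hy12⟩ := max_lt_iff.1 hy
  obtain ⟨hy1, hy2⟩ := max_lt_iff.1 hy12
  have hpos : ∀ t ∈ Set.Ioc 0 (Real.pi - η), 0 < height C k y 0 t := by
    intro t ht
    have hst : 0 < Real.sin t := Real.sin_pos_of_pos_of_lt_pi ht.1 (by linarith [ht.2])
    rw [height_pt_pos_iff]
    rcases hΛ.lt_or_gt with hn | hp
    · have hk := eqHeight_neg (C := C) hn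
      have hle := (strictMonoOn_slopeOf hC hk).monotoneOn ⟨ht.1, by linarith [ht.2]⟩
        ⟨by linarith, by linarith⟩ ht.2
      have h2 : slopeOf C k t * Real.sin t = -k * departure C t := by
        rw [slopeOf]
        field_simp
      have h3 : slopeOf C k t < y := hle.trans_lt hy1
      nlinarith
    · have hk := eqHeight_pos (C := C) hp
      have := departure_pos_of_le_pi (C := C) ht.1 (by linarith [ht.2])
      positivity
  have hneg : height C k y 0 (Real.pi + η) < 0 := by
    rw [height_pt]
    refine mul_neg_of_pos_of_neg (Real.exp_pos _) ?_
    have h2 : slopeOf C k (Real.pi + η) * Real.sin (Real.pi + η)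
        = -k * departure C (Real.pi + η) := by
      rw [slopeOf]
      field_simp [hs2.ne]
    nlinarith
  have hcont : Continuous fun t => height C k y 0 t :=
    continuous_iff_continuousAt.2 fun t => (hasDerivAt_height C k y 0 t).continuousAt
  obtain ⟨t, ht, ht0⟩ := intermediate_value_Icc' (show Real.pi - η ≤ Real.pi + η by linarith)
    hcont.continuousOn ⟨hneg.le, (hpos (Real.pi - η) ⟨by linarith, le_rfl⟩).le⟩
  have hmem : t ∈ {t : ℝ | 0 < t ∧ flowX C H Λ t (pt x y) 2 = 0} :=
    ⟨by linarith [ht.1], by rw [flowX_pt_two]; exact ht0⟩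
  have hlow : ∀ s ∈ {t : ℝ | 0 < t ∧ flowX C H Λ t (pt x y) 2 = 0}, Real.pi - η ≤ s := by
    rintro s ⟨hs, hs0⟩
    by_contra! hlt
    rw [flowX_pt_two] at hs0
    have := hpos s ⟨hs, hlt.le⟩
    linarith
  exact ⟨le_csInf ⟨t, hmem⟩ hlow, (csInf_le ⟨_, hlow⟩ hmem).trans ht.2⟩

theorem tendsto_halfReturnTime {C H Λ : ℝ} (hC : 0 < C) (hΛ : Λ ≠ 0) (x : ℝ → ℝ) :
    Tendsto (fun y => halfReturnTime C H Λ (x y) y) atTop (𝓝 Real.pi) := by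
  rw [Metric.tendsto_nhds]
  intro ε hε
  have hπ := Real.pi_pos
  obtain ⟨ν, hν⟩ := exists_halfReturnTime_near hC hΛ (η := min (ε / 2) (Real.pi / 2))
    (by positivity) (by linarith [min_le_right (ε / 2) (Real.pi / 2)])
  filter_upwards [eventually_gt_atTop ν] with y hy
  have := hν H (x y) y hy
  rw [Real.dist_eq, abs_lt]
  constructor <;> linarith [this.1, this.2, min_le_left (ε / 2) (Real.pi / 2)]

theorem tendsto_sqrt_quadratic_div (A B D : ℝ) :
    Tendsto (fun y : ℝ => √(A + B * y + D * y ^ 2) / y) atTop (𝓝 (√D)) := by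
  have hi : Tendsto (fun y : ℝ => y⁻¹) atTop (𝓝 0) := tendsto_inv_atTop_zero
  have h1 : Tendsto (fun y : ℝ => A * y⁻¹ ^ 2 + B * y⁻¹ + D) atTop (𝓝 D) := by
    simpa using (((hi.pow 2).const_mul A).add (hi.const_mul B)).add_const D
  refine h1.sqrt.congr' ?_
  filter_upwards [eventually_gt_atTop 0] with y hy
  have : A + B * y + D * y ^ 2 = (A * y⁻¹ ^ 2 + B * y⁻¹ + D) * y ^ 2 := by
    field_simp
  rw [this, Real.sqrt_mul' _ (sq_nonneg y), Real.sqrt_sq hy.le, mul_div_assoc, div_self hy.ne',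
    mul_one]

theorem tendsto_branchX_div {C H Λ : ℝ} (h0 : 0 < H) :
    Tendsto (fun y => branchX C H Λ y / y) atTop (𝓝 (mΓ H)⁻¹) := by
  have hi : Tendsto (fun y : ℝ => y⁻¹) atTop (𝓝 0) := tendsto_inv_atTop_zero
  have h1 := tendsto_sqrt_quadratic_div
    (Λ * ((C ^ 2 + 1) * Λ - Λ * H) / (H * (C ^ 2 + 1) ^ 2))
    (Λ * ((C ^ 2 + 1) * (C * (1 - H))) / (H * (C ^ 2 + 1) ^ 2)) (disc H / (4 * H ^ 2))
  have h2 := ((hi.const_mul (Λ * C / (C ^ 2 + 1))).const_add ((H + 1) / (2 * H))).add h1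
  have hlim : (H + 1) / (2 * H) + Λ * C / (C ^ 2 + 1) * 0 + √(disc H / (4 * H ^ 2))
      = (mΓ H)⁻¹ := by
    have : √(4 * H ^ 2) = 2 * H := by
      rw [show 4 * H ^ 2 = (2 * H) ^ 2 by ring, Real.sqrt_sq (by linarith)]
    rw [Real.sqrt_div' _ (by positivity), this, mΓ, inv_div]
    field_simp
    ring
  rw [hlim] at h2
  refine h2.congr' ?_
  filter_upwards [eventually_gt_atTop 0] with y hy
  have e : branchRadicand C H Λ y = Λ * ((C ^ 2 + 1) * Λ - Λ * H) / (H * (C ^ 2 + 1) ^ 2)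
      + Λ * ((C ^ 2 + 1) * (C * (1 - H))) / (H * (C ^ 2 + 1) ^ 2) * y
      + disc H / (4 * H ^ 2) * y ^ 2 := by
    rw [branchRadicand]
    ring
  rw [branchX, e, add_div, add_div]
  congr 2
  field_simp

theorem tendsto_branchX_atTop {C H Λ : ℝ} (h0 : 0 < H) :
    Tendsto (fun y => branchX C H Λ y) atTop atTop := by
  have h := (tendsto_branchX_div (C := C) (Λ := Λ) h0).pos_mul_atTop (inv_pos.2 (mΓ_pos h0))
    tendsto_id
  refine h.congr' ?_
  filter_upwards [eventually_gt_atTop 0] with y hy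
  simp
  field_simp

theorem tendsto_branchMonodromy {C H Λ : ℝ} (hC : 0 < C) (hΛ : Λ ≠ 0) (h0 : 0 < H) :
    Tendsto (fun y => branchMonodromy C H Λ y) atTop
      (𝓝 (monodromyForm C H (mΓ H) 0 Real.pi)) := by
  have hx := tendsto_branchX_atTop (C := C) (Λ := Λ) h0
  have hδ : Tendsto (fun y => y / branchX C H Λ y) atTop (𝓝 (mΓ H)) := by
    have := (tendsto_branchX_div (C := C) (Λ := Λ) h0).inv₀ (inv_ne_zero (mΓ_pos h0).ne')
    simpa using this
  have hε : Tendsto (fun y => Λ * (1 + H) / branchX C H Λ y) atTop (𝓝 0) :=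
    hx.const_div_atTop _
  have ht := tendsto_halfReturnTime (H := H) hC hΛ (fun y => branchX C H Λ y)
  have h := ((continuous_monodromyForm C).tendsto (H, mΓ H, 0, Real.pi)).comp
    ((tendsto_const_nhds (x := H) (f := atTop)).prodMk_nhds
      (hδ.prodMk_nhds (hε.prodMk_nhds ht)))
  refine h.congr' ?_
  filter_upwards [hx.eventually_gt_atTop 0] with y hy
  rw [branchMonodromy, monodromy_eq C H Λ y _ hy.ne']
  rfl

theorem tendsto_det_branchMonodromy {C H Λ : ℝ} (hC : 0 < C) (hΛ : Λ ≠ 0) (h0 : 0 < H) :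
    Tendsto (fun y => (branchMonodromy C H Λ y).det) atTop (𝓝 (mΓ H ^ 2)) := by
  rw [← det_monodromyForm_pi C H]
  exact ((continuous_id.matrix_det).tendsto _).comp (tendsto_branchMonodromy hC hΛ h0)

theorem tendsto_trace_branchMonodromy {C H Λ : ℝ} (hC : 0 < C) (hΛ : Λ ≠ 0) (h0 : 0 < H)
    (h1 : H < 1) : Tendsto (fun y => (branchMonodromy C H Λ y).trace) atTop (𝓝 (τΓ C H)) := by
  rw [← trace_monodromyForm_pi h0 h1]
  exact ((continuous_id.matrix_trace).tendsto _).comp (tendsto_branchMonodromy hC hΛ h0)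

/-! ### Cycles of large amplitude -/

/-- The initial point of a symmetric cycle lies on the conic. -/
theorem IsSymmetricCycle.conic_eq {C H Λ x y T : ℝ} (h : IsSymmetricCycle C H Λ x y T)
    (hC : 0 < C) : H * (x ^ 2 + y ^ 2) - (H + 1) * x * y + 2 * C * H * eqHeight C Λ * (y - x)
      + eqHeight C Λ ^ 2 * (1 + C ^ 2) * (H - 1) = 0 ∧
      (y + C * eqHeight C Λ) ^ 2 < (x - C * eqHeight C Λ) ^ 2 := by
  obtain ⟨h1, h2, h3⟩ := h.equations
  have hx := h.x_pos
  have hy := h.y_pos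
  set k := eqHeight C Λ
  have hsc := Real.sin_sq_add_cos_sq T
  have hE : Real.exp (-2 * C * T) * Real.exp (C * T) ^ 2 = 1 := by
    rw [← Real.exp_nat_mul, ← Real.exp_add]
    push_cast
    ring_nf
    exact Real.exp_zero
  have ha : 1 < Real.exp (C * T) := Real.one_lt_exp_iff.2 (mul_pos hC h.T_pos)
  rw [slope, h1] at h2
  rw [height] at h1
  set a := Real.exp (C * T)
  set E := Real.exp (-2 * C * T)
  have hq : k ^ 2 + (x - C * k) ^ 2 = a ^ 2 * (k ^ 2 + (y + C * k) ^ 2) := by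
    have e1 : a * ((y + C * 0 + C * k) * Real.cos T - (0 - k) * Real.sin T) = -(x - C * k) := by
      linarith
    have e2 : a * ((0 - k) * Real.cos T + (y + C * 0 + C * k) * Real.sin T) = -k := by linarith
    have e3 : k ^ 2 + (x - C * k) ^ 2 = (-k) ^ 2 + (-(x - C * k)) ^ 2 := by ring
    rw [e3, ← e1, ← e2]
    linear_combination (a ^ 2 * (k ^ 2 + (y + C * k) ^ 2)) * hsc
  constructor
  · have h4 : (x + y) * (H * (x ^ 2 + y ^ 2) - (H + 1) * x * y + 2 * C * H * k * (y - x)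
        + k ^ 2 * (1 + C ^ 2) * (H - 1)) = 0 := by
      linear_combination (k ^ 2 + (x - C * k) ^ 2) * h3 + E * (x - H * y) * hq
        + (x - H * y) * (k ^ 2 + (y + C * k) ^ 2) * hE
    exact (mul_eq_zero.1 h4).resolve_left (by positivity)
  · have hk : k ^ 2 + (y + C * k) ^ 2 < a ^ 2 * (k ^ 2 + (y + C * k) ^ 2) ∨
        k ^ 2 + (y + C * k) ^ 2 = 0 := by
      rcases (by positivity : 0 ≤ k ^ 2 + (y + C * k) ^ 2).eq_or_lt with h0 | h0
      · exact Or.inr h0.symm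
      · left
        have : 1 < a ^ 2 := one_lt_pow₀ ha two_ne_zero
        nlinarith
    rcases hk with hk | hk
    · linarith
    · have hk0 : k = 0 := by nlinarith [sq_nonneg k, sq_nonneg (y + C * k)]
      rw [hk0] at hk
      nlinarith

theorem IsSymmetricCycle.eq_branchX {C H Λ x y T : ℝ} (h : IsSymmetricCycle C H Λ x y T)
    (hC : 0 < C) (h0 : 0 < H) (h1 : H < 1) (hy : 2 * C * |eqHeight C Λ| < y) :
    x = branchX C H Λ y := by
  obtain ⟨hcon, hlt⟩ := h.conic_eq hC
  have hx0 := h.x_pos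
  have hy0 := h.y_pos
  have hΛ := eqHeight_mul C Λ
  set k := eqHeight C Λ
  have hk1 : -(C * |k|) ≤ C * k := by nlinarith [neg_abs_le k]
  have hk2 : C * k ≤ C * |k| := by nlinarith [le_abs_self k]
  have hxy : y + 2 * C * k < x := by
    by_contra! hle
    have h2 : -(y + C * k) ≤ x - C * k := by nlinarith
    exact hlt.not_ge (sq_le_sq' h2 (by linarith))
  set cen := (H + 1) * y / (2 * H) + C * k with hcen
  have hrad : branchRadicand C H Λ y = k ^ 2 * (1 + C ^ 2) / H + k * C * (1 - H) * y / H - k ^ 2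
      + disc H * y ^ 2 / (4 * H ^ 2) := by
    rw [branchRadicand, ← hΛ]
    field_simp
    ring
  have hX : branchX C H Λ y = cen + √(branchRadicand C H Λ y) := by
    rw [branchX, hcen, ← hΛ]
    congr 2
    field_simp
    ring
  have hsq : (x - cen) ^ 2 = branchRadicand C H Λ y := by
    rw [hrad, hcen, disc]
    field_simp
    linear_combination 16 * H * hcon
  have hin : (y + 2 * C * k - cen) ^ 2 < branchRadicand C H Λ y := by
    have hp : 0 < (1 - H) * ((y + 2 * C * k) * y + k ^ 2 * (1 + C ^ 2)) := by
      have : 0 < y + 2 * C * k := by linarith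
      have : 0 < 1 - H := by linarith
      positivity
    have e : branchRadicand C H Λ y - (y + 2 * C * k - cen) ^ 2 =
        (1 - H) * ((y + 2 * C * k) * y + k ^ 2 * (1 + C ^ 2)) / H := by
      rw [hrad, hcen, disc]
      field_simp
      ring
    have := div_pos hp h0
    linarith
  have hge : 0 ≤ x - cen := by
    by_contra! hneg
    nlinarith
  rw [hX, ← hsq, Real.sqrt_sq hge]
  ring

/-- For `Λ < 0`, cycles of large amplitude only exist above the critical value. -/
theorem exists_Hcrit_lt_of_neg {C Λ : ℝ} (hC : 0 < C) (hΛ : Λ < 0) :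
    ∃ ν : ℝ, ∀ H x y T, IsSymmetricCycle C H Λ x y T → ν < y → Hcrit C < H := by
  have hk := eqHeight_neg (C := C) hΛ
  have hπ := Real.pi_pos
  have hgap := cycleGap_pos hC hπ
  have hnum := cycleNum_pos hC hπ (by linarith) (departure_pos_of_le_pi (C := C) hπ le_rfl)
  set φ : ℝ → ℝ := fun t => cycleNum C t * cycleGap C Real.pi - cycleNum C Real.pi * cycleGap C t
  have hφ := ((hasDerivAt_cycleNum C Real.pi).mul_const (cycleGap C Real.pi)).sub
    ((hasDerivAt_cycleGap C Real.pi).const_mul (cycleNum C Real.pi))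
  have hd : deriv φ Real.pi < 0 := by
    have h1 := deriv_cycleGap_pos hC hπ
    have h2 := mul_pos hnum h1
    rw [show deriv φ Real.pi = _ from hφ.deriv, Real.sin_pi]
    linarith
  have hev := eventually_nhdsWithin_sign_eq_of_deriv_neg hd (by simp [φ, mul_comm])
  obtain ⟨l, hl, hsub⟩ := mem_nhdsLT_iff_exists_Ioo_subset.1
    (hev.filter_mono (nhdsWithin_le_nhds (s := Set.Iio Real.pi)))
  set l' := max l (Real.pi / 2)
  have hl' : l' < Real.pi := max_lt hl (by linarith)
  have hl0 : 0 < l' := lt_of_lt_of_le (by linarith) (le_max_right l (Real.pi / 2))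
  refine ⟨slopeOf C (eqHeight C Λ) l', fun H x y T h hy => ?_⟩
  have hT := h.time_mem_of_neg hΛ
  have hs : 0 < Real.sin T := Real.sin_pos_of_pos_of_lt_pi hT.1 hT.2
  have hyT := (h.slopeOf_eq hs.ne').1
  have hlT : l' < T := by
    by_contra! hle
    have := (strictMonoOn_slopeOf hC hk).monotoneOn hT ⟨hl0, hl'⟩ hle
    linarith
  have hsign : SignType.sign (φ T) = SignType.sign (Real.pi - T) :=
    hsub ⟨(le_max_left _ _).trans_lt hlT, hT.2⟩
  rw [sign_pos (sub_pos.2 hT.2), sign_eq_one_iff] at hsign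
  have hdep := departure_pos_of_le_pi (C := C) hT.1 hT.2.le
  have hden := cycleDen_pos hC hT.1 (by linarith [hT.2]) hdep
  have hgapT := cycleGap_pos hC hT.1
  have hnumT := cycleNum_pos hC hT.1 (by linarith [hT.2]) hdep
  rw [h.eq_cycleH hΛ.ne hs.ne' hden.ne', ← cycleH_pi C hC, cycleH, cycleH, cycleDen_eq,
    cycleDen_eq, div_lt_div_iff₀ (by linarith) (by linarith)]
  simp only [φ] at hsign
  linarith

/-! ### The region of parameters with a symmetric cycle, for `Λ > 0` -/

theorem departure_pos_of_le {C s t : ℝ} (hs : Real.pi ≤ s) (hst : s ≤ t) (ht : t ≤ 2 * Real.pi)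
    (hd : 0 < departure C t) : 0 < departure C s := by
  have h : AntitoneOn (fun t => Real.exp (C * t) * departure C t)
      (Set.Icc Real.pi (2 * Real.pi)) := by
    refine antitoneOn_of_deriv_nonpos (convex_Icc _ _) (fun t _ =>
      (hasDerivAt_exp_mul_departure C t).continuousAt.continuousWithinAt) (fun t _ =>
      (hasDerivAt_exp_mul_departure C t).differentiableAt.differentiableWithinAt) fun t ht => ?_
    rw [interior_Icc] at ht
    rw [(hasDerivAt_exp_mul_departure C t).deriv]
    exact mul_nonpos_of_nonneg_of_nonpos (by positivity) (sin_neg_of_mem ht).le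
  have h1 := h ⟨hs, hst.trans ht⟩ ⟨hs.trans hst, ht⟩ hst
  have h2 := mul_pos (Real.exp_pos (C * t)) hd
  exact (pos_iff_pos_of_mul_pos (h2.trans_le h1)).1 (Real.exp_pos _)

/-- The pairs `(C, t)` such that `t` is the half-period of a symmetric cycle. -/
def timeDomain : Set (ℝ × ℝ) :=
  {p | 0 < p.1 ∧ p.2 ∈ Set.Ioo Real.pi (2 * Real.pi) ∧ 0 < departure p.1 p.2}

/-- The pairs `(C, H)` for which there is a symmetric cycle. -/
def cycleRegion : Set (ℝ × ℝ) := {p | ∃ t, (p.1, t) ∈ timeDomain ∧ cycleH p.1 t = p.2}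

open Classical in
/-- The half-period of the symmetric cycle. -/
def cycleTime (p : ℝ × ℝ) : ℝ :=
  if h : ∃ t, (p.1, t) ∈ timeDomain ∧ cycleH p.1 t = p.2 then h.choose else 0

theorem cycleTime_spec {p : ℝ × ℝ} (hp : p ∈ cycleRegion) :
    (p.1, cycleTime p) ∈ timeDomain ∧ cycleH p.1 (cycleTime p) = p.2 := by
  have h : ∃ t, (p.1, t) ∈ timeDomain ∧ cycleH p.1 t = p.2 := hp
  rw [cycleTime, dif_pos h]
  exact h.choose_spec

theorem cycleTime_eq {p : ℝ × ℝ} {t : ℝ} (ht : (p.1, t) ∈ timeDomain) (hp : cycleH p.1 t = p.2) :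
    cycleTime p = t := by
  obtain ⟨h1, h2⟩ := cycleTime_spec (p := p) ⟨t, ht, hp⟩
  rcases lt_trichotomy (cycleTime p) t with h | h | h
  · have := cycleH_lt h1.1 h1.2.1.1.le h ht.2.1.2 ht.2.2
    linarith
  · exact h
  · have := cycleH_lt h1.1 ht.2.1.1.le h h1.2.1.2 h1.2.2
    linarith

theorem continuous_departure : Continuous fun p : ℝ × ℝ => departure p.1 p.2 := by
  unfold departure
  fun_prop

theorem continuous_arrival : Continuous fun p : ℝ × ℝ => arrival p.1 p.2 := by
  unfold arrival
  fun_prop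

theorem continuousAt_cycleH {C t : ℝ} (hd : cycleDen C t ≠ 0) :
    ContinuousAt (fun p : ℝ × ℝ => cycleH p.1 p.2) (C, t) := by
  have h1 := continuous_departure
  have h2 := continuous_arrival
  refine ContinuousAt.div ?_ ?_ hd
  · unfold cycleNum
    fun_prop
  · unfold cycleDen
    fun_prop

/-- The values of `cycleH C` between two times are attained in between. -/
theorem exists_cycleH_eq {C H s t : ℝ} (hC : 0 < C) (hs : Real.pi ≤ s) (hst : s < t)
    (ht : t < 2 * Real.pi) (hd : 0 < departure C t) (h1 : cycleH C t < H) (h2 : H < cycleH C s) :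
    ∃ u ∈ Set.Ioo s t, (C, u) ∈ timeDomain ∧ cycleH C u = H := by
  have hdu : ∀ u ∈ Set.Icc s t, 0 < departure C u := fun u hu =>
    departure_pos_of_le (hs.trans hu.1) hu.2 ht.le hd
  have hcont : ContinuousOn (cycleH C) (Set.Icc s t) := fun u hu =>
    ((continuousAt_cycleH (cycleDen_pos hC (Real.pi_pos.trans_le (hs.trans hu.1))
      (hu.2.trans_lt ht) (hdu u hu)).ne').comp
      (f := fun u => (C, u)) (by fun_prop)).continuousWithinAt
  obtain ⟨u, hu, he⟩ := intermediate_value_Ioo' hst.le hcont ⟨h1, h2⟩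
  exact ⟨u, hu, ⟨hC, ⟨hs.trans_lt hu.1, hu.2.trans ht⟩, hdu u ⟨hu.1.le, hu.2.le⟩⟩, he⟩

theorem eventually_cycleTime_mem {p : ℝ × ℝ} (hp : p ∈ cycleRegion) {W : Set ℝ}
    (hW : W ∈ 𝓝 (cycleTime p)) : ∀ᶠ q in 𝓝 p, q ∈ cycleRegion ∧ cycleTime q ∈ W := by
  obtain ⟨⟨hC, ht, hd⟩, hH⟩ := cycleTime_spec hp
  set t := cycleTime p
  have hev : ∀ᶠ u in 𝓝 t, u ∈ W ∧ u ∈ Set.Ioo Real.pi (2 * Real.pi) ∧ 0 < departure p.1 u := by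
    refine (eventually_mem_set.2 hW).and
      ((eventually_mem_set.2 (Ioo_mem_nhds ht.1 ht.2)).and ?_)
    exact (hasDerivAt_departure p.1 t).continuousAt.eventually (lt_mem_nhds hd)
  obtain ⟨η, hη, hball⟩ := Metric.eventually_nhds_iff_ball.1 hev
  have hIcc : ∀ u ∈ Set.Icc (t - η / 2) (t + η / 2), u ∈ Metric.ball t η := fun u hu => by
    rw [Metric.mem_ball, Real.dist_eq, abs_lt]
    constructor <;> linarith [hu.1, hu.2]
  obtain ⟨-, hs, hds⟩ := hball _ (hIcc (t - η / 2) ⟨le_rfl, by linarith⟩)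
  obtain ⟨-, hr, hdr⟩ := hball _ (hIcc (t + η / 2) ⟨by linarith, le_rfl⟩)
  have hcont : ∀ u ∈ Set.Ioo Real.pi (2 * Real.pi), 0 < departure p.1 u →
      ContinuousAt (fun q : ℝ × ℝ => cycleH q.1 u) p := fun u hu hdu =>
    ContinuousAt.comp (x := p) (f := fun q : ℝ × ℝ => (q.1, u))
      (continuousAt_cycleH (cycleDen_pos hC (Real.pi_pos.trans hu.1) hu.2 hdu).ne') (by fun_prop)
  have h1 := (hcont _ hr hdr).eventually_lt continuousAt_snd
    ((cycleH_lt hC ht.1.le (by linarith) hr.2 hdr).trans_eq hH)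
  have h2 := continuousAt_snd.eventually_lt (hcont _ hs hds)
    (hH.symm.trans_lt (cycleH_lt hC hs.1.le (by linarith) ht.2 hd))
  have h3 : ∀ᶠ q : ℝ × ℝ in 𝓝 p, 0 < departure q.1 (t + η / 2) :=
    (continuous_departure.comp (f := fun q : ℝ × ℝ => (q.1, t + η / 2))
      (by fun_prop)).continuousAt.eventually (lt_mem_nhds hdr)
  have h4 : ∀ᶠ q : ℝ × ℝ in 𝓝 p, 0 < q.1 := continuousAt_fst.eventually (lt_mem_nhds hC)
  filter_upwards [h1, h2, h3, h4] with q q1 q2 q3 q4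
  obtain ⟨u, hu, hu1, hu2⟩ := exists_cycleH_eq q4 hs.1.le (by linarith) hr.2 q3 q1 q2
  refine ⟨⟨u, hu1, hu2⟩, ?_⟩
  rw [cycleTime_eq hu1 hu2]
  exact (hball u (hIcc u ⟨hu.1.le, hu.2.le⟩)).1

theorem isOpen_cycleRegion : IsOpen cycleRegion :=
  isOpen_iff_mem_nhds.2 fun _ hp => (eventually_cycleTime_mem hp univ_mem).mono fun _ h => h.1

theorem continuousAt_cycleTime {p : ℝ × ℝ} (hp : p ∈ cycleRegion) : ContinuousAt cycleTime p :=
  fun _ hW => (eventually_cycleTime_mem hp hW).mono fun _ h => h.2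

theorem cycleRegion_subset : cycleRegion ⊆ paramRegion := by
  rintro ⟨C, H⟩ ⟨t, ⟨hC, ht, hd⟩, hH⟩
  dsimp only at hH
  rw [← hH]
  exact cycleH_mem hC (Real.pi_pos.trans ht.1) ht.2 hd

/-- The coordinates of the upward crossing point of the symmetric cycle. -/
def cycleX (Λ : ℝ) (p : ℝ × ℝ) : ℝ := endOf p.1 (eqHeight p.1 Λ) (cycleTime p)

def cycleY (Λ : ℝ) (p : ℝ × ℝ) : ℝ := slopeOf p.1 (eqHeight p.1 Λ) (cycleTime p)

theorem continuous_eqHeight (Λ : ℝ) : Continuous fun C => eqHeight C Λ := by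
  unfold eqHeight
  exact continuous_const.div (by fun_prop) fun C => by positivity

theorem continuousOn_cycleX (Λ : ℝ) : ContinuousOn (cycleX Λ) cycleRegion := fun p hp => by
  have hT := continuousAt_cycleTime hp
  have hs := (sin_neg_of_mem (cycleTime_spec hp).1.2.1).ne
  have h1 := (continuous_eqHeight Λ).continuousAt.comp (continuousAt_fst (p := p))
  have h2 := continuous_arrival.continuousAt.comp (continuousAt_fst.prodMk hT)
  exact ((h1.neg.mul h2).div (Real.continuous_sin.continuousAt.comp hT) hs).continuousWithinAt

theorem continuousOn_cycleY (Λ : ℝ) : ContinuousOn (cycleY Λ) cycleRegion := fun p hp => by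
  have hT := continuousAt_cycleTime hp
  have hs := (sin_neg_of_mem (cycleTime_spec hp).1.2.1).ne
  have h1 := (continuous_eqHeight Λ).continuousAt.comp (continuousAt_fst (p := p))
  have h2 := continuous_departure.continuousAt.comp (continuousAt_fst.prodMk hT)
  exact ((h1.neg.mul h2).div (Real.continuous_sin.continuousAt.comp hT) hs).continuousWithinAt

theorem isSymmetricCycle_of_mem {Λ : ℝ} (hΛ : 0 < Λ) {p : ℝ × ℝ} (hp : p ∈ cycleRegion) :
    IsSymmetricCycle p.1 p.2 Λ (cycleX Λ p) (cycleY Λ p) (cycleTime p) := by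
  obtain ⟨⟨hC, ht, hd⟩, hH⟩ := cycleTime_spec hp
  have h := isSymmetricCycle_of_time hC hΛ ht hd
  rwa [hH] at h

theorem IsSymmetricCycle.eq_of_mem {C H Λ x y T : ℝ} (h : IsSymmetricCycle C H Λ x y T)
    (hC : 0 < C) (hΛ : 0 < Λ) : (C, H) ∈ cycleRegion ∧ x = cycleX Λ (C, H) ∧
      y = cycleY Λ (C, H) ∧ T = cycleTime (C, H) := by
  obtain ⟨hT, hd, hH, hy, hx⟩ := h.eq_of_pos hC hΛ
  have ht := cycleTime_eq (p := (C, H)) (t := T) ⟨hC, hT, hd⟩ hH.symm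
  refine ⟨⟨T, ⟨hC, hT, hd⟩, hH.symm⟩, ?_, ?_, ht.symm⟩
  · rw [cycleX, ht, hx]
  · rw [cycleY, ht, hy]

/-! ### The limit at the critical value -/

theorem eventually_cycleTime_near {C t : ℝ} (hC : 0 < C) (ht : Real.pi < t) :
    ∀ᶠ H in 𝓝[<] (Hcrit C), (C, H) ∈ cycleRegion ∧ cycleTime (C, H) ∈ Set.Ioo Real.pi t := by
  have hev : ∀ᶠ u in 𝓝[>] Real.pi, u ∈ Set.Ioo Real.pi (min t (2 * Real.pi)) ∧
      0 < departure C u := by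
    refine Eventually.and (Ioo_mem_nhdsGT (lt_min ht (by linarith [Real.pi_pos]))) ?_
    exact ((hasDerivAt_departure C Real.pi).continuousAt.eventually
      (lt_mem_nhds (departure_pos_of_le_pi Real.pi_pos le_rfl))).filter_mono nhdsWithin_le_nhds
  obtain ⟨u, hu, hd⟩ := hev.exists
  have hu2 : u < 2 * Real.pi := hu.2.trans_le (min_le_right _ _)
  have hlt := cycleH_lt hC le_rfl hu.1 hu2 hd
  rw [cycleH_pi C hC] at hlt
  filter_upwards [Ioo_mem_nhdsLT hlt] with H hH
  obtain ⟨v, hv, hv1, hv2⟩ := exists_cycleH_eq hC le_rfl hu.1 hu2 hd hH.1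
    (hH.2.trans_eq (cycleH_pi C hC).symm)
  refine ⟨⟨v, hv1, hv2⟩, ?_⟩
  rw [cycleTime_eq (p := (C, H)) hv1 hv2]
  exact ⟨hv.1, hv.2.trans (hu.2.trans_le (min_le_left _ _))⟩

theorem tendsto_cycleTime {C : ℝ} (hC : 0 < C) :
    Tendsto (fun H => cycleTime (C, H)) (𝓝[<] (Hcrit C)) (𝓝[>] Real.pi) := by
  rw [(nhdsGT_basis Real.pi).tendsto_right_iff]
  exact fun t ht => (eventually_cycleTime_near hC ht).mono fun _ h => h.2

theorem tendsto_neg_mul_div_sin {f : ℝ → ℝ} {k : ℝ} (hk : 0 < k) (hf : ContinuousAt f Real.pi)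
    (h0 : 0 < f Real.pi) : Tendsto (fun t => -k * f t / Real.sin t) (𝓝[>] Real.pi) atTop := by
  have hs : Tendsto Real.sin (𝓝[>] Real.pi) (𝓝[<] 0) := by
    refine tendsto_nhdsWithin_iff.2 ⟨?_, ?_⟩
    · have := Real.continuous_sin.tendsto Real.pi
      rw [Real.sin_pi] at this
      exact this.mono_left nhdsWithin_le_nhds
    · filter_upwards [Ioo_mem_nhdsGT (show Real.pi < 2 * Real.pi by linarith [Real.pi_pos])]
        with t ht using sin_neg_of_mem ht
  have h1 : Tendsto (fun t => -k * f t) (𝓝[>] Real.pi) (𝓝 (-k * f Real.pi)) :=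
    (hf.tendsto.const_mul (-k)).mono_left nhdsWithin_le_nhds
  exact h1.neg_mul_atBot (by nlinarith) (tendsto_inv_nhdsLT_zero.comp hs)

theorem tendsto_slopeOf {C k : ℝ} (hk : 0 < k) :
    Tendsto (slopeOf C k) (𝓝[>] Real.pi) atTop :=
  tendsto_neg_mul_div_sin hk (hasDerivAt_departure C Real.pi).continuousAt
    (departure_pos_of_le_pi Real.pi_pos le_rfl)

theorem tendsto_endOf {C k : ℝ} (hC : 0 < C) (hk : 0 < k) :
    Tendsto (endOf C k) (𝓝[>] Real.pi) atTop :=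
  tendsto_neg_mul_div_sin hk (hasDerivAt_arrival C Real.pi).continuousAt
    (arrival_pos hC Real.pi_pos (by linarith [Real.pi_pos]))

theorem tendsto_cycleY {C Λ : ℝ} (hC : 0 < C) (hΛ : 0 < Λ) :
    Tendsto (fun H => cycleY Λ (C, H)) (𝓝[<] (Hcrit C)) atTop :=
  (tendsto_slopeOf (eqHeight_pos hΛ)).comp (tendsto_cycleTime hC)

theorem tendsto_cycleX {C Λ : ℝ} (hC : 0 < C) (hΛ : 0 < Λ) :
    Tendsto (fun H => cycleX Λ (C, H)) (𝓝[<] (Hcrit C)) atTop :=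
  (tendsto_endOf hC (eqHeight_pos hΛ)).comp (tendsto_cycleTime hC)

theorem tendsto_slopeOf_div_endOf {C k : ℝ} (hC : 0 < C) (hk : 0 < k) :
    Tendsto (fun t => slopeOf C k t / endOf C k t) (𝓝[>] Real.pi) (𝓝 (mΓ (Hcrit C))) := by
  have hpi : arrival C Real.pi ≠ 0 := (arrival_pos hC Real.pi_pos (by linarith [Real.pi_pos])).ne'
  have h := ((hasDerivAt_departure C Real.pi).continuousAt.div
    (hasDerivAt_arrival C Real.pi).continuousAt hpi).tendsto.mono_left
      (nhdsWithin_le_nhds (s := Set.Ioi Real.pi))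
  have he : (departure C / arrival C) Real.pi = mΓ (Hcrit C) := by
    rw [mΓ_Hcrit hC, Pi.div_apply, div_eq_iff hpi]
    simp only [departure, arrival, Real.cos_pi, Real.sin_pi, mul_comm Real.pi C]
    linear_combination -exp_mul_exp_neg (C * Real.pi)
  rw [he] at h
  refine h.congr' ?_
  filter_upwards [Ioo_mem_nhdsGT (show Real.pi < 2 * Real.pi by linarith [Real.pi_pos])] with t ht
  have hs := (sin_neg_of_mem ht).ne
  have ha := (arrival_pos hC (Real.pi_pos.trans ht.1) ht.2).ne'
  rw [Pi.div_apply, slopeOf, endOf]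
  field_simp

theorem tendsto_monodromy_cycle {C Λ : ℝ} (hC : 0 < C) (hΛ : 0 < Λ) :
    Tendsto (fun H => monodromy C H Λ (cycleX Λ (C, H)) (cycleY Λ (C, H)) (cycleTime (C, H)))
      (𝓝[<] (Hcrit C)) (𝓝 (monodromyForm C (Hcrit C) (mΓ (Hcrit C)) 0 Real.pi)) := by
  have hH : Tendsto (fun H : ℝ => H) (𝓝[<] (Hcrit C)) (𝓝 (Hcrit C)) :=
    tendsto_id.mono_left nhdsWithin_le_nhds
  have hT := tendsto_cycleTime hC
  have hx := tendsto_cycleX hC hΛ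
  have h1 : Tendsto (fun H => cycleY Λ (C, H) / cycleX Λ (C, H)) (𝓝[<] (Hcrit C))
      (𝓝 (mΓ (Hcrit C))) :=
    (tendsto_slopeOf_div_endOf hC (eqHeight_pos hΛ)).comp hT
  have h2 : Tendsto (fun H => Λ * (1 + H) / cycleX Λ (C, H)) (𝓝[<] (Hcrit C)) (𝓝 0) :=
    ((hH.const_add 1).const_mul Λ).div_atTop hx
  have h3 := (((continuous_monodromyForm C).tendsto
    (Hcrit C, mΓ (Hcrit C), 0, Real.pi)).comp
      (hH.prodMk_nhds (h1.prodMk_nhds (h2.prodMk_nhds (hT.mono_right nhdsWithin_le_nhds)))))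
  refine h3.congr' ?_
  filter_upwards [hx.eventually_gt_atTop 0] with H hpos
  exact (monodromy_eq C H Λ _ _ hpos.ne').symm

end PWL

end

open PWL in
theorem mainTheorem2 (Λ : ℝ) (hΛ : Λ ≠ 0) :
    -- transverse multipliers and Schur–Cohn conditions of every symmetric cycle;
    -- cycles of large amplitude start on the branch `Γ`
    (∀ C H x y T : ℝ, (C, H) ∈ paramRegion → IsSymmetricCycle C H Λ x y T →
      ((monodromy C H Λ x y T).map (fun r : ℝ => (r : ℂ))).charpoly =
        (Polynomial.X - Polynomial.C (1 : ℂ)) * transversePoly (monodromy C H Λ x y T) ∧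
      ((∀ μ : ℂ, (transversePoly (monodromy C H Λ x y T)).IsRoot μ → ‖μ‖ < 1) ↔
        SchurCohn (monodromy C H Λ x y T))) ∧
    (∀ C : ℝ, 0 < C → ∃ ν : ℝ, ∀ H x y T : ℝ, (C, H) ∈ paramRegion →
      IsSymmetricCycle C H Λ x y T → ν < y →
        x = branchX C H Λ y ∧ monodromy C H Λ x y T = branchMonodromy C H Λ y) ∧
    -- the asymptotic Schur–Cohn conditions reduce to the two inequalities of the band
    (∀ C H : ℝ, (C, H) ∈ paramRegion →
      Tendsto (fun y => (branchMonodromy C H Λ y).det) atTop (𝓝 (mΓ H ^ 2)) ∧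
      Tendsto (fun y => (branchMonodromy C H Λ y).trace) atTop (𝓝 (τΓ C H)) ∧
      mΓ H ^ 2 < 1 ∧
      ((∀ μ : ℂ, μ ^ 2 - ((τΓ C H - 1 : ℝ) : ℂ) * μ + ((mΓ H ^ 2 : ℝ) : ℂ) = 0 → ‖μ‖ < 1) ↔
        0 < 2 + mΓ H ^ 2 - τΓ C H ∧ 0 < τΓ C H + mΓ H ^ 2)) ∧
    -- the band is open
    IsOpen stabilityBand ∧
    -- the large-amplitude tail is asymptotically stable for parameters in the band
    (∀ C H : ℝ, (C, H) ∈ stabilityBand → ∀ᶠ y in atTop,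
      SchurCohn (branchMonodromy C H Λ y) ∧
      ∀ μ : ℂ, (transversePoly (branchMonodromy C H Λ y)).IsRoot μ → ‖μ‖ < 1) ∧
    (∀ C : ℝ, 0 < C → ∃ ν : ℝ, ∀ H x y T : ℝ, (C, H) ∈ stabilityBand →
      IsSymmetricCycle C H Λ x y T → ν < y → IsStableCycle C H Λ x y T) ∧
    -- the stability region obtained by continuation
    (0 < Λ → ∃ (B : Set (ℝ × ℝ)) (x y T : ℝ × ℝ → ℝ),
      IsOpen B ∧ B ⊆ paramRegion ∧
      ContinuousOn x B ∧ ContinuousOn y B ∧ ContinuousOn T B ∧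
      (∀ p ∈ B, IsSymmetricCycle p.1 p.2 Λ (x p) (y p) (T p) ∧
        IsStableCycle p.1 p.2 Λ (x p) (y p) (T p)) ∧
      (∀ C : ℝ, 0 < C → ∃ ν : ℝ, ∀ H x' y' T' : ℝ, (C, H) ∈ stabilityBand →
        IsSymmetricCycle C H Λ x' y' T' → ν < y' →
          (C, H) ∈ B ∧ x' = x (C, H) ∧ y' = y (C, H) ∧ T' = T (C, H)) ∧
      (∀ C : ℝ, 0 < C →
        (∀ᶠ H in 𝓝[<] (Hcrit C), (C, H) ∈ B ∧ (C, H) ∈ stabilityBand) ∧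
        Tendsto (fun H => y (C, H)) (𝓝[<] (Hcrit C)) atTop ∧
        ∃ μ : ℝ → ℂ,
          (∀ᶠ H in 𝓝[<] (Hcrit C),
            (transversePoly
              (monodromy C H Λ (x (C, H)) (y (C, H)) (T (C, H)))).IsRoot (μ H)) ∧
          Tendsto μ (𝓝[<] (Hcrit C)) (𝓝 1))) ∧
    -- the boundary of the band
    frontier stabilityBand ∩ paramRegion = upperBoundary ∪ lowerBoundary ∧
    (∀ C : ℝ, 0 < C → ∃ H : ℝ, H < Hcrit C ∧ (C, H) ∈ lowerBoundary) ∧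
    (∀ C H : ℝ, (C, H) ∈ stabilityBand →
      H < Hcrit C ∧ ∃ H' : ℝ, H' < H ∧ (C, H') ∈ lowerBoundary) ∧
    -- (i) the upper boundary
    upperBoundary = {p : ℝ × ℝ | 0 < p.1 ∧ p.2 = Hcrit p.1} ∧
    (∀ C H : ℝ, (C, H) ∈ upperBoundary → ∃ μ : ℝ → ℂ,
      (∀ᶠ y in atTop, (transversePoly (branchMonodromy C H Λ y)).IsRoot (μ y)) ∧
      Tendsto μ atTop (𝓝 1)) ∧
    -- (ii) the lower boundary
    (∀ C H : ℝ, (C, H) ∈ lowerBoundary → ∃ μ : ℝ → ℂ,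
      (∀ᶠ y in atTop, (transversePoly (branchMonodromy C H Λ y)).IsRoot (μ y)) ∧
      Tendsto μ atTop (𝓝 (-1))) := by
  have hcond : ∀ C H : ℝ, (C, H) ∈ stabilityBand → ∀ᶠ y in atTop,
      SchurCohn (branchMonodromy C H Λ y) := by
    rintro C H ⟨⟨hC, h0, h1⟩, hu, hl⟩
    have hdet := tendsto_det_branchMonodromy (H := H) hC hΛ h0
    have htr := tendsto_trace_branchMonodromy hC hΛ h0 h1
    have hm : 0 < 1 - mΓ H ^ 2 :=
      sub_pos.2 (pow_lt_one₀ (mΓ_pos h0).le (mΓ_lt_one h0 h1) two_ne_zero)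
    have e1 := (hdet.const_sub 1).eventually (lt_mem_nhds hm)
    have e2 := ((htr.const_sub 2).add hdet).eventually
      (lt_mem_nhds (show 0 < 2 - τΓ C H + mΓ H ^ 2 by linarith))
    have e3 := (htr.add hdet).eventually (lt_mem_nhds hl)
    filter_upwards [e1, e2, e3] with y y1 y2 y3 using ⟨y1, y2, y3⟩
  refine ⟨?_, ?_, ?_, isOpen_stabilityBand, ?_, ?_, ?_, frontier_stabilityBand, ?_, ?_,
    upperBoundary_eq, ?_, ?_⟩
  · intro C H x y T _ h
    refine ⟨charpoly_eq_of_mulVec_eq (fun h0 => ?_) h.monodromy_mulVec, transversePoly_roots_iff _⟩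
    have := h.X_up
    rw [h0] at this
    exact lt_irrefl _ this
  · intro C hC
    refine ⟨2 * C * |eqHeight C Λ|, fun H x y T hp h hy => ?_⟩
    have hx := h.eq_branchX hC hp.2.1 hp.2.2 hy
    refine ⟨hx, ?_⟩
    rw [branchMonodromy, ← hx, h.halfReturnTime_eq]
  · rintro C H ⟨hC, h0, h1⟩
    have hm : mΓ H ^ 2 < 1 := pow_lt_one₀ (mΓ_pos h0).le (mΓ_lt_one h0 h1) two_ne_zero
    refine ⟨tendsto_det_branchMonodromy hC hΛ h0, tendsto_trace_branchMonodromy hC hΛ h0 h1, hm, ?_⟩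
    rw [quadratic_roots_lt_one_iff]
    constructor
    · rintro ⟨-, h2, h3⟩
      constructor <;> linarith
    · rintro ⟨h2, h3⟩
      refine ⟨?_, ?_, ?_⟩ <;> linarith
  · exact fun C H hp => (hcond C H hp).mono fun y hy => ⟨hy, (transversePoly_roots_iff _).2 hy⟩
  · intro C hC
    rcases hΛ.lt_or_gt with hneg | hpos
    · obtain ⟨ν, hν⟩ := exists_Hcrit_lt_of_neg hC hneg
      refine ⟨ν, fun H x y T hp h hy => ?_⟩
      have := (upper_pos_iff hC hp.1.2.1 hp.1.2.2).1 hp.2.1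
      exact absurd (hν H x y T h hy) this.not_gt
    · exact ⟨0, fun H x y T _ h _ => h.isStableCycle_of_pos hC hpos⟩
  · intro hpos
    refine ⟨cycleRegion, cycleX Λ, cycleY Λ, cycleTime, isOpen_cycleRegion, cycleRegion_subset,
      continuousOn_cycleX Λ, continuousOn_cycleY Λ,
      fun p hp => (continuousAt_cycleTime hp).continuousWithinAt, fun p hp => ?_, fun C hC => ?_,
      fun C hC => ?_⟩
    · have h := isSymmetricCycle_of_mem hpos hp
      exact ⟨h, h.isStableCycle_of_pos (cycleRegion_subset hp).1 hpos⟩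
    · exact ⟨0, fun H x y T _ h _ => h.eq_of_mem hC hpos⟩
    · obtain ⟨h0, h1⟩ := Hcrit_mem hC
      have hM := tendsto_monodromy_cycle hC hpos
      have htr := ((continuous_id.matrix_trace).tendsto _).comp hM
      have hdet := ((continuous_id.matrix_det).tendsto _).comp hM
      simp only [id] at htr hdet
      rw [trace_monodromyForm_pi h0 h1] at htr
      rw [det_monodromyForm_pi] at hdet
      have hw : (1 : ℝ) ^ 2 - (τΓ C (Hcrit C) - 1) * 1 + mΓ (Hcrit C) ^ 2 = 0 := by
        have := (upper_eq_zero_iff hC h0 h1).2 rfl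
        linarith
      obtain ⟨μ, hμ, hlim⟩ := exists_multiplier_tendsto htr hdet hw
      refine ⟨?_, tendsto_cycleY hC hpos, μ, Eventually.of_forall hμ, by simpa using hlim⟩
      filter_upwards [eventually_cycleTime_near hC (lt_add_one Real.pi),
        eventually_mem_stabilityBand hC] with H h2 h3 using ⟨h2.1, h3⟩
  · intro C hC
    obtain ⟨h0, h1⟩ := Hcrit_mem hC
    exact exists_lowerBoundary hC h0 h1 (lower_Hcrit_pos hC)
  · rintro C H ⟨⟨hC, h0, h1⟩, hu, hl⟩
    exact ⟨(upper_pos_iff hC h0 h1).1 hu, exists_lowerBoundary hC h0 h1 hl⟩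
  · rintro C H ⟨⟨hC, h0, h1⟩, h⟩
    obtain ⟨μ, hμ, hlim⟩ := exists_multiplier_tendsto (w := 1)
      (tendsto_trace_branchMonodromy hC hΛ h0 h1) (tendsto_det_branchMonodromy hC hΛ h0)
      (by dsimp only at h; linarith)
    exact ⟨μ, Eventually.of_forall hμ, by simpa using hlim⟩
  · rintro C H ⟨⟨hC, h0, h1⟩, h⟩
    obtain ⟨μ, hμ, hlim⟩ := exists_multiplier_tendsto (w := -1)
      (tendsto_trace_branchMonodromy hC hΛ h0 h1) (tendsto_det_branchMonodromy hC hΛ h0)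
      (by dsimp only at h; linarith)
    exact ⟨μ, Eventually.of_forall hμ, by simpa using hlim⟩
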